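/- Let $n \ge 1$, and let $W$ be the Weyl group of type $C_n$, that is, the group of signed permutations: the permutations $w$ of $\{\pm 1, \ldots, \pm n\}$ with $w(-i) = -w(i)$. It is generated by $s_1 = (1\ \,{-1})$ and $s_k = (k-1\ \,k)(-(k-1)\ \,{-k})$ for $2 \le k \le n$; let $\ell$ be the length with respect to these generators, and let $w_0 \in W$ be the longest element, $w_0(i) = -i$. **Skew pipe dreams.** Let $SY_n = \{(i,j) \in \mathbb{Z}^2 : 1 \le i \le n,\ i \le j \le 2n-i\}$. A skew pipe dream is a subset $D \subseteq SY_n$. Put $N = n^2$, let $(i_1, \ldots, i_N) = (1,\ 2,1,2,\ 3,2,1,2,3,\ \ldots,\ n,n-1,\ldots,1,\ldots,n-1,n)$, and list the boxes of $SY_n$ as $(p_1,q_1), \ldots, (p_N,q_N) = (n,n), (n-1,n+1), (n-1,n), (n-1,n-1), \ldots, (1,2), (1,1)$ (rows from bottom to top, each row from right to left). For $w \in W$ let $(k_1 < \cdots < k_{\ell(w)})$ be the lexicographically smallest sequence of indices in $\{1, \ldots, N\}$ such that $(i_{k_1}, \ldots, i_{k_{\ell(w)}})$ is a reduced word for $w$,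 and put $D(w) = SY_n \setminus \{(p_{k_r},q_{k_r}) : 1 \le r \le \ell(w)\}$. **Ladder moves.** Let $D \subseteq SY_n$ and $(i,j) = (p_k,q_k)$. The symplectic ladder move $L_{i,j}(D)$ is defined if $(i,j) \in D$, $(i,j+1) \notin D$, and there is $k < l \le N$ with $q_l \in \{j, 2n-j\}$ such that $(p_l,q_l), (p_l,q_l+1) \in SY_n \setminus D$ and $(p_r,q_r), (p_r,q_r+1) \in D$ for all $k < r < l$ with $q_r \in \{j, 2n-j\}$; then $L_{i,j}(D) = (D \cup \{(p_l,q_l+1)\}) \setminus \{(i,j)\}$. Let $\mathscr{L}(D)$ be the set of skew pipe dreams obtained from $D$ by finite (possibly empty) sequences of ladder moves. **Path model.** Let $\widetilde{SY}_n = \{(i,j) : 1 \le j \le n,\ 1 \le i \le 2j-1\}$. Let $\Omega(D) \subseteq \widetilde{SY}_n$ be the set whose $(2k-1)$-st row is $\{(2k-1,j) : k \le j \le n,\ (k,j) \in D\}$ and whose $2k$-th row is $\{(2k,j) : k < j \le n,\ (k,2n+1-j) \in D\}$. The diagram $\mathscr{G}(D)$ is drawn, in matrix coordinates, on the boxes of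 $\widetilde{SY}_n \sqcup \{(2k,k) : 1 \le k \le n\} \sqcup \{(k,n+1) : 1 \le k \le 2n\}$. A box in $\Omega(D)$ carries a crossing (joining left with right and top with bottom). A box $(i,j) \notin \Omega(D)$ carries an elbow joint (joining left with top and bottom with right) if $j \le n$ and $i$ is odd, or if $j = n+1$ and $i$ is even; otherwise it carries a reversed elbow joint (joining left with bottom and top with right). For $1 \le k \le n$ let $\ell_k$ be the pipe of $\mathscr{G}(D)$ that starts at the left end of row $2(n-k)+1$, and for $1 \le j \le n$ let $L_j$ be the pipe that ends at the top of column $n+1-j$. There is a unique permutation $v_D$ of $\{1, \ldots, n\}$ with $\ell_k = L_{v_D(k)}$ for all $k$. Let $\mathrm{sign}(L_j)$ be the number of self-crossings of $L_j$, and define $w_D \in W$ by $w_D(j) = (-1)^{\mathrm{sign}(L_j)+1}\, v_D^{-1}(j)$ for $1 \le j \le n$. The skew pipe dream $D$ is called reduced if $|D| = \ell(w_0) - \ell(w_D)$. **Theorem.** For every $w \in W$, the set $\mathscr{L}(D(w))$ is equal to the set of reduced skew pipe dreams $D \subseteq SY_n$ with $w_D = w$. -/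

import Mathlib

namespace SkewPipe

/-! ### Signed permutations -/

/-- The Weyl group of type `C_n`: signed permutations of `{±1, …, ±n}`. Each one is extended to `ℤ`
by fixing all other integers (oddness already forces `0 ↦ 0`). -/
def W (n : ℕ) : Subgroup (Equiv.Perm ℤ) where
  carrier := {σ | (∀ i, σ (-i) = -σ i) ∧ ∀ i, (n : ℤ) < |i| → σ i = i}
  one_mem' := ⟨fun _ => rfl, fun _ _ => rfl⟩
  mul_mem' := by
    rintro σ τ ⟨h1, h2⟩ ⟨h3, h4⟩
    refine ⟨fun i => ?_, fun i hi => ?_⟩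
    · simp [h3, h1]
    · simp [h4 i hi, h2 i hi]
  inv_mem' := by
    rintro σ ⟨h1, h2⟩
    refine ⟨fun i => ?_, fun i hi => ?_⟩
    · rw [Equiv.Perm.inv_eq_iff_eq, h1, ← Equiv.Perm.mul_apply, mul_inv_cancel, Equiv.Perm.one_apply]
    · rw [Equiv.Perm.inv_eq_iff_eq, h2 i hi]

/-- The simple reflections: `s₁ = (1 -1)` and `s_k = (k-1 k)(-(k-1) -k)` for `k ≥ 2`. -/
def s (k : ℕ) : Equiv.Perm ℤ :=
  if k = 1 then Equiv.swap 1 (-1)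
  else Equiv.swap ((k : ℤ) - 1) k * Equiv.swap (-((k : ℤ) - 1)) (-k)

/-- `l` is a word in the letters `1, …, n` with product `w`. -/
def IsWord (n : ℕ) (l : List ℕ) (w : Equiv.Perm ℤ) : Prop :=
  (∀ k ∈ l, 1 ≤ k ∧ k ≤ n) ∧ (l.map s).prod = w

/-- The length `ℓ(w)`. -/
noncomputable def len (n : ℕ) (w : Equiv.Perm ℤ) : ℕ :=
  sInf {r | ∃ l : List ℕ, l.length = r ∧ IsWord n l w}

/-- `l` is a reduced word for `w`. -/
def IsReducedWord (n : ℕ) (l : List ℕ) (w : Equiv.Perm ℤ) : Prop :=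
  IsWord n l w ∧ l.length = len n w

/-- The longest element `w₀ = (1 -1)(2 -2)⋯(n -n)`. -/
def w0 (n : ℕ) : W n :=
  ⟨Function.Involutive.toPerm (fun i : ℤ => if |i| ≤ n then -i else i) (by
      intro i
      by_cases h : |i| ≤ (n : ℤ) <;> simp [h]),
    fun i => by
      by_cases h : |i| ≤ (n : ℤ) <;> simp [Function.Involutive.toPerm, h],
    fun i hi => by simp [Function.Involutive.toPerm, not_le.mpr hi]⟩

/-! ### Skew pipe dreams and the distinguished skew pipe dream -/

/-- The shifted diagram `SY_n`. -/
noncomputable def SY (n : ℕ) : Finset (ℤ × ℤ) :=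
  (Finset.Icc (1 : ℤ) n ×ˢ Finset.Icc (1 : ℤ) (2 * n)).filter
    fun b => b.1 ≤ b.2 ∧ b.2 ≤ 2 * n - b.1

/-- The skew pipe dreams: all subsets of `SY_n`. -/
noncomputable def SPD (n : ℕ) : Finset (Finset (ℤ × ℤ)) := (SY n).powerset

/-- The word `i_C = (1, 2,1,2, 3,2,1,2,3, …, n,…,1,…,n)`, of length `n²`. -/
def wordC (n : ℕ) : List ℕ :=
  (List.range n).flatMap fun a =>
    (List.range (2 * a + 1)).map fun b => ((a : ℤ) - b).natAbs + 1

/-- The boxes of `SY_n` in the order `(n,n), (n-1,n+1), (n-1,n), (n-1,n-1), …, (1,2), (1,1)`: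
rows from bottom to top, each row from right to left. -/
def boxList (n : ℕ) : List (ℤ × ℤ) :=
  (List.range n).flatMap fun a =>
    (List.range (2 * a + 1)).map fun b => ((n : ℤ) - a, (n : ℤ) + a - b)

/-- The letter `i_k` of `i_C`, for `1 ≤ k ≤ n²`. -/
def letter (n k : ℕ) : ℕ := (wordC n).getD (k - 1) 0

/-- The box `(p_k, q_k)`, for `1 ≤ k ≤ n²`. -/
def pq (n k : ℕ) : ℤ × ℤ := (boxList n).getD (k - 1) (0, 0)

/-- `R(i_C, w)`: the index sequences `k₁ < ⋯ < k_{ℓ(w)}` of the subwords of `i_C` that are reduced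
words for `w`. -/
def R (n : ℕ) (w : Equiv.Perm ℤ) : Set (List ℕ) :=
  {ks | ks.length = len n w ∧ ks.Pairwise (· < ·) ∧ (∀ k ∈ ks, 1 ≤ k ∧ k ≤ n ^ 2) ∧
    IsReducedWord n (ks.map (letter n)) w}

open Classical in
/-- `k_w`: the least element of `R(i_C, w)` (the order on `List ℕ` is the lexicographic one). The
default value is irrelevant: `R(i_C, w)` is finite, and it is nonempty for `w ∈ W n` because `i_C` is
a reduced word for `w₀`. -/
noncomputable def kMin (n : ℕ) (w : Equiv.Perm ℤ) : List ℕ :=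
  if h : ∃ ks, IsLeast (R n w) ks then h.choose else []

/-- `D(w)`: the boxes of `SY_n` outside `D(w)` are those whose indices form `k_w`. -/
noncomputable def Dw (n : ℕ) (w : Equiv.Perm ℤ) : Finset (ℤ × ℤ) :=
  (SY n).filter fun b => ∀ k ∈ kMin n w, pq n k ≠ b

/-! ### Ladder moves -/

/-- The ladder move `L_{i,j}` is defined at `D`, and `D'` is its result. -/
def LadderMove (n : ℕ) (i j : ℤ) (D D' : Finset (ℤ × ℤ)) : Prop :=
  ∃ k, 1 ≤ k ∧ k ≤ n ^ 2 ∧ pq n k = (i, j) ∧ (i, j) ∈ D ∧ (i, j + 1) ∉ D ∧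
    ∃ l, k + 1 ≤ l ∧ l ≤ n ^ 2 ∧ ((pq n l).2 = j ∨ (pq n l).2 = 2 * n - j) ∧
      pq n l ∈ SY n \ D ∧ ((pq n l).1, (pq n l).2 + 1) ∈ SY n \ D ∧
      (∀ r, k < r → r < l → ((pq n r).2 = j ∨ (pq n r).2 = 2 * n - j) →
        pq n r ∈ D ∧ ((pq n r).1, (pq n r).2 + 1) ∈ D) ∧
      D' = (D ∪ {((pq n l).1, (pq n l).2 + 1)}) \ {(i, j)}

/-- `𝓛(D)`: everything obtained from `D` by finite (possibly empty) sequences of ladder moves. -/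
def ladderSet (n : ℕ) (D : Finset (ℤ × ℤ)) : Set (Finset (ℤ × ℤ)) :=
  {E | Relation.ReflTransGen (fun A B => ∃ i j, LadderMove n i j A B) D E}

/-! ### The path model -/

/-- The diagram `S̃Y_n`: columns `1 ≤ j ≤ n`, rows `1 ≤ i ≤ 2j-1`. -/
noncomputable def SYt (n : ℕ) : Finset (ℤ × ℤ) :=
  (Finset.Icc (1 : ℤ) (2 * n) ×ˢ Finset.Icc (1 : ℤ) n).filter fun b => b.1 ≤ 2 * b.2 - 1

/-- The Gelfand–Tsetlin type rearrangement `Ω(D)`: row `2k-1` consists of the first `n-k+1` boxes of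
row `k` of `D` (columns `k, …, n`), and row `2k` of its last `n-k` boxes in reversed order
(column `j` of `Ω(D)` is column `2n+1-j` of `D`). -/
noncomputable def Omega (n : ℕ) (D : Finset (ℤ × ℤ)) : Finset (ℤ × ℤ) :=
  (SYt n).filter fun b =>
    if Odd b.1 then ((b.1 + 1) / 2, b.2) ∈ D else (b.1 / 2, 2 * (n : ℤ) + 1 - b.2) ∈ D

/-- The extended diagram `S̃Y_n ⊔ {(2k,k) : 1 ≤ k ≤ n} ⊔ {(k,n+1) : 1 ≤ k ≤ 2n}`. -/
noncomputable def SYex (n : ℕ) : Finset (ℤ × ℤ) :=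
  SYt n ∪ (Finset.Icc (1 : ℤ) n).image (fun k => (2 * k, k)) ∪
    (Finset.Icc (1 : ℤ) (2 * n)).image (fun k => (k, (n : ℤ) + 1))

/-- The sides of boxes: `h i j` is the left side of box `(i,j)` (the right side of `(i,j-1)`), and
`v i j` is the top side of box `(i,j)` (the bottom side of `(i-1,j)`). -/
inductive Side where
  | h (i j : ℤ)
  | v (i j : ℤ)

/-- The empty box `(i,j)` carries an elbow joint. -/
def IsElbow (n : ℕ) (D : Finset (ℤ × ℤ)) (i j : ℤ) : Prop :=
  (i, j) ∈ SYex n \ Omega n D ∧ ((j ≤ n ∧ Odd i) ∨ (j = n + 1 ∧ Even i))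

/-- The empty box `(i,j)` carries a reversed elbow joint. -/
def IsRevElbow (n : ℕ) (D : Finset (ℤ × ℤ)) (i j : ℤ) : Prop :=
  (i, j) ∈ SYex n \ Omega n D ∧ ((j ≤ n ∧ Even i) ∨ (j = n + 1 ∧ Odd i))

/-- The arcs of the diagram `𝓖(D)`. In each box two arcs join the four sides in pairs: a crossing
joins left–right and top–bottom, an elbow joint left–top and bottom–right, a reversed elbow joint
left–bottom and top–right. -/
inductive Arc (n : ℕ) (D : Finset (ℤ × ℤ)) : Side → Side → Prop
  | cross_h {i j : ℤ} : (i, j) ∈ Omega n D → Arc n D (.h i j) (.h i (j + 1))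
  | cross_v {i j : ℤ} : (i, j) ∈ Omega n D → Arc n D (.v i j) (.v (i + 1) j)
  | elbow_lt {i j : ℤ} : IsElbow n D i j → Arc n D (.h i j) (.v i j)
  | elbow_br {i j : ℤ} : IsElbow n D i j → Arc n D (.v (i + 1) j) (.h i (j + 1))
  | rev_lb {i j : ℤ} : IsRevElbow n D i j → Arc n D (.h i j) (.v (i + 1) j)
  | rev_tr {i j : ℤ} : IsRevElbow n D i j → Arc n D (.v i j) (.h i (j + 1))

/-- Two sides are met by the same pipe of `𝓖(D)`. -/
def SamePipe (n : ℕ) (D : Finset (ℤ × ℤ)) : Side → Side → Prop := Relation.EqvGen (Arc n D)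

/-- The start of the pipe `ℓ_k`: the left end of the row pair that has `k` columns in `S̃Y_n`, that is,
of row `2(n-k)+1`, whose leftmost box is in column `n-k+1`. -/
def start (n : ℕ) (k : ℤ) : Side := .h (2 * (n - k) + 1) (n - k + 1)

/-- The end of the pipe `L_j`: the top of column `n+1-j`. -/
def top (n : ℕ) (j : ℤ) : Side := .v 1 (n + 1 - j)

/-! #### Every pipe runs from a start to an end

The pipes are traversed from left to right in odd rows and from right to left in even rows. -/

theorem mem_SYt {n : ℕ} {i j : ℤ} :
    (i, j) ∈ SYt n ↔ 1 ≤ i ∧ 1 ≤ j ∧ j ≤ n ∧ i ≤ 2 * j - 1 := by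
  simp only [SYt, Finset.mem_filter, Finset.mem_product, Finset.mem_Icc]
  omega

theorem mem_SYex {n : ℕ} {i j : ℤ} :
    (i, j) ∈ SYex n ↔ 1 ≤ i ∧ ((1 ≤ j ∧ j ≤ n ∧ i ≤ 2 * j) ∨ (j = n + 1 ∧ i ≤ 2 * n)) := by
  simp only [SYex, Finset.mem_union, mem_SYt, Finset.mem_image, Finset.mem_Icc, Prod.mk.injEq]
  constructor
  · rintro ((h | ⟨k, h⟩) | ⟨k, h⟩) <;> omega
  · rintro ⟨h1, h | h⟩
    · by_cases h2 : i ≤ 2 * j - 1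
      · left; left; omega
      · left; right; exact ⟨j, by omega⟩
    · right; exact ⟨i, by omega⟩

theorem Omega_subset {n : ℕ} {D : Finset (ℤ × ℤ)} {i j : ℤ} (h : (i, j) ∈ Omega n D) :
    1 ≤ i ∧ 1 ≤ j ∧ j ≤ n ∧ i ≤ 2 * j - 1 :=
  mem_SYt.1 (Finset.mem_filter.1 h).1

/-- The sides met by the pipes `ℓ_1, …, ℓ_n` or by closed loops (the others only bound the
remnants of arcs along the border). -/
def Live (n : ℕ) : Side → Prop
  | .h i j => 1 ≤ i ∧ i ≤ 2 * n ∧ i + 1 ≤ 2 * j ∧ j ≤ n + 1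
  | .v i j => 1 ≤ i ∧ i ≤ 2 * j ∧ ((1 ≤ j ∧ j ≤ n) ∨ (j = n + 1 ∧ i % 2 = 0 ∧ i ≤ 2 * n))

/-- The sides at the top of the diagram. -/
def IsTop : Side → Prop
  | .h _ _ => False
  | .v i _ => i = 1

open Classical in
/-- The next side met by a pipe. -/
noncomputable def next (n : ℕ) (D : Finset (ℤ × ℤ)) : Side → Side
  | .h i j =>
    if i % 2 = 1 then
      if j = n + 1 then .v (i + 1) j else if (i, j) ∈ Omega n D then .h i (j + 1) else .v i j
    else if (i, j - 1) ∈ Omega n D then .h i (j - 1) else .v i (j - 1)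
  | .v i j =>
    if j = n + 1 then .h i j
    else if (i - 1, j) ∈ Omega n D then .v (i - 1) j
    else if i % 2 = 0 then .h (i - 1) (j + 1) else .h (i - 1) j

/-- One step along a pipe. -/
def Flow (n : ℕ) (D : Finset (ℤ × ℤ)) (a b : Side) : Prop :=
  Live n a ∧ ¬ IsTop a ∧ next n D a = b

theorem Flow.rightUnique {n : ℕ} {D : Finset (ℤ × ℤ)} : Relator.RightUnique (Flow n D) :=
  fun _ _ _ h1 h2 => h1.2.2.symm.trans h2.2.2

theorem Flow.live {n : ℕ} {D : Finset (ℤ × ℤ)} {a b : Side} (h : Flow n D a b) : Live n b := by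
  obtain ⟨h1, h2, rfl⟩ := h
  rcases a with ⟨i, j⟩ | ⟨i, j⟩ <;> simp only [next] <;> simp only [Live, IsTop] at h1 h2 <;>
    split_ifs <;> simp only [Live]
  all_goals first
    | omega
    | (have := Omega_subset (by assumption : (_, _) ∈ Omega n D); omega)

theorem Flow.leftUnique {n : ℕ} {D : Finset (ℤ × ℤ)} {a b c : Side} (h : Flow n D a c)
    (h' : Flow n D b c) : a = b := by
  obtain ⟨h1, h2, h3⟩ := h
  obtain ⟨h4, h5, h6⟩ := h'
  rw [← h6] at h3
  clear h6
  rcases a with ⟨i, j⟩ | ⟨i, j⟩ <;> rcases b with ⟨i', j'⟩ | ⟨i', j'⟩ <;>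
    simp only [next] at h3 <;> simp only [Live, IsTop] at h1 h2 h4 h5 <;>
    split_ifs at h3 <;> simp only [Side.h.injEq, Side.v.injEq, reduceCtorEq] at h3 ⊢
  all_goals grind [Omega_subset]

theorem Flow.not_start {n : ℕ} {D : Finset (ℤ × ℤ)} {a : Side} {k : ℤ} (hk : 1 ≤ k ∧ k ≤ n) :
    ¬ Flow n D a (start n k) := by
  rintro ⟨h1, h2, h3⟩
  rcases a with ⟨i, j⟩ | ⟨i, j⟩ <;> simp only [next, start] at h3 <;>
    simp only [Live, IsTop] at h1 h2 <;>
    split_ifs at h3 <;> simp only [Side.h.injEq] at h3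
  all_goals grind [Omega_subset]

theorem Arc.flow {n : ℕ} {D : Finset (ℤ × ℤ)} {a b : Side} (h : Arc n D a b) :
    (Live n a ↔ Live n b) ∧ (Live n a → Flow n D a b ∨ Flow n D b a) := by
  cases h with
  | @cross_h i j h =>
    have h' := Omega_subset h
    refine ⟨by simp only [Live]; omega, fun hl => ?_⟩
    rcases Int.emod_two_eq_zero_or_one i with hi | hi
    · right
      refine ⟨by simp only [Live]; omega, by simp [IsTop], ?_⟩
      simp [next, hi, h]
    · left
      refine ⟨hl, by simp [IsTop], ?_⟩
      simp only [next, hi, h, if_true]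
      rw [if_neg (by omega)]
  | @cross_v i j h =>
    have h' := Omega_subset h
    refine ⟨by simp only [Live]; omega, fun hl => ?_⟩
    right
    refine ⟨by simp only [Live]; omega, by simp only [IsTop]; omega, ?_⟩
    simp only [next, add_sub_cancel_right, h, if_true]
    rw [if_neg (by omega)]
  | @elbow_lt i j h =>
    obtain ⟨h1, h2⟩ := h
    rw [Finset.mem_sdiff, mem_SYex] at h1
    rw [Int.odd_iff, Int.even_iff] at h2
    obtain ⟨h1, h3⟩ := h1
    refine ⟨by simp only [Live]; omega, fun hl => ?_⟩
    simp only [Live] at hl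
    rcases h2 with h2 | h2
    · left
      refine ⟨by simp only [Live]; omega, by simp [IsTop], ?_⟩
      simp only [next, h2.2, h3, if_true, if_false]
      rw [if_neg (by omega)]
    · right
      refine ⟨by simp only [Live]; omega, by simp only [IsTop]; omega, ?_⟩
      simp [next, h2.1]
  | @elbow_br i j h =>
    obtain ⟨h1, h2⟩ := h
    rw [Finset.mem_sdiff, mem_SYex] at h1
    rw [Int.odd_iff, Int.even_iff] at h2
    obtain ⟨h1, h3⟩ := h1
    refine ⟨by simp only [Live]; omega, fun hl => ?_⟩
    simp only [Live] at hl
    left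
    refine ⟨by simp only [Live]; omega, by simp only [IsTop]; omega, ?_⟩
    simp only [next, add_sub_cancel_right, h3, if_false]
    rw [if_neg (by omega), if_pos (by omega)]
  | @rev_lb i j h =>
    obtain ⟨h1, h2⟩ := h
    rw [Finset.mem_sdiff, mem_SYex] at h1
    rw [Int.odd_iff, Int.even_iff] at h2
    obtain ⟨h1, h3⟩ := h1
    refine ⟨by simp only [Live]; omega, fun hl => ?_⟩
    simp only [Live] at hl
    rcases h2 with h2 | h2
    · right
      refine ⟨by simp only [Live]; omega, by simp only [IsTop]; omega, ?_⟩
      simp only [next, add_sub_cancel_right, h3, if_false]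
      rw [if_neg (by omega), if_neg (by omega)]
    · left
      refine ⟨by simp only [Live]; omega, by simp [IsTop], ?_⟩
      simp [next, h2.1, h2.2]
  | @rev_tr i j h =>
    obtain ⟨h1, h2⟩ := h
    rw [Finset.mem_sdiff, mem_SYex] at h1
    rw [Int.odd_iff, Int.even_iff] at h2
    obtain ⟨h1, h3⟩ := h1
    refine ⟨by simp only [Live]; omega, fun hl => ?_⟩
    simp only [Live] at hl
    right
    refine ⟨by simp only [Live]; omega, by simp [IsTop], ?_⟩
    simp only [next, add_sub_cancel_right, h3, if_false]
    rw [if_neg (by omega)]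

theorem Flow.arc {n : ℕ} {D : Finset (ℤ × ℤ)} {a b : Side} (h : Flow n D a b) :
    SamePipe n D a b := by
  obtain ⟨h1, h2, rfl⟩ := h
  rcases a with ⟨i, j⟩ | ⟨i, j⟩ <;> simp only [Live, IsTop] at h1 h2 <;> simp only [next]
  · split_ifs with h3 h4 h5 h5
    · exact .rel _ _ (.rev_lb ⟨Finset.mem_sdiff.2 ⟨mem_SYex.2 (by omega),
        fun h => by have := Omega_subset h; omega⟩, by rw [Int.odd_iff, Int.even_iff]; omega⟩)
    · exact .rel _ _ (.cross_h h5)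
    · exact .rel _ _ (.elbow_lt ⟨Finset.mem_sdiff.2 ⟨mem_SYex.2 (by omega), h5⟩,
        by rw [Int.odd_iff, Int.even_iff]; omega⟩)
    · have := Arc.cross_h h5
      rw [sub_add_cancel] at this
      exact .symm _ _ (.rel _ _ this)
    · have := Arc.rev_tr (n := n) (D := D) (i := i) (j := j - 1)
        ⟨Finset.mem_sdiff.2 ⟨mem_SYex.2 (by omega), h5⟩,
          by rw [Int.odd_iff, Int.even_iff]; omega⟩
      rw [sub_add_cancel] at this
      exact .symm _ _ (.rel _ _ this)
  · split_ifs with h3 h4 h5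
    · exact .symm _ _ (.rel _ _ (.elbow_lt ⟨Finset.mem_sdiff.2 ⟨mem_SYex.2 (by omega),
        fun h => by have := Omega_subset h; omega⟩, by rw [Int.odd_iff, Int.even_iff]; omega⟩))
    · have := Arc.cross_v h4
      rw [sub_add_cancel] at this
      exact .symm _ _ (.rel _ _ this)
    · have := Arc.elbow_br (n := n) (D := D) (i := i - 1) (j := j)
        ⟨Finset.mem_sdiff.2 ⟨mem_SYex.2 (by omega), h4⟩,
          by rw [Int.odd_iff, Int.even_iff]; omega⟩
      rw [sub_add_cancel] at this
      exact .rel _ _ this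
    · have := Arc.rev_lb (n := n) (D := D) (i := i - 1) (j := j)
        ⟨Finset.mem_sdiff.2 ⟨mem_SYex.2 (by omega), h4⟩,
          by rw [Int.odd_iff, Int.even_iff]; omega⟩
      rw [sub_add_cancel] at this
      exact .symm _ _ (.rel _ _ this)

theorem SamePipe.flow {n : ℕ} {D : Finset (ℤ × ℤ)} {a b : Side} (h : SamePipe n D a b) :
    (Live n a ↔ Live n b) ∧ (Live n a →
      Relation.ReflTransGen (Flow n D) a b ∨ Relation.ReflTransGen (Flow n D) b a) := by
  have hsw : Relator.RightUnique (Function.swap (Flow n D)) :=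
    fun _ _ _ h1 h2 => Flow.leftUnique h1 h2
  induction h with
  | rel x y h => exact ⟨h.flow.1, fun hl => (h.flow.2 hl).imp .single .single⟩
  | refl x => exact ⟨Iff.rfl, fun _ => .inl .refl⟩
  | symm x y _ ih => exact ⟨ih.1.symm, fun hl => (ih.2 (ih.1.2 hl)).symm⟩
  | trans x y z _ _ ih1 ih2 =>
    refine ⟨ih1.1.trans ih2.1, fun hl => ?_⟩
    rcases ih1.2 hl with h1 | h1 <;> rcases ih2.2 (ih1.1.1 hl) with h2 | h2
    · exact .inl (h1.trans h2)
    · have := Relation.ReflTransGen.total_of_right_unique hsw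
        (Relation.reflTransGen_swap.2 h1) (Relation.reflTransGen_swap.2 h2)
      exact (this.imp Relation.reflTransGen_swap.1 Relation.reflTransGen_swap.1).symm
    · exact Relation.ReflTransGen.total_of_right_unique Flow.rightUnique h1 h2
    · exact .inr (h2.trans h1)

theorem live_start {n : ℕ} {k : ℤ} (hk : 1 ≤ k ∧ k ≤ n) : Live n (start n k) := by
  simp only [Live, start]; omega

theorem live_top {n : ℕ} {j : ℤ} (hj : 1 ≤ j ∧ j ≤ n) : Live n (top n j) := by
  simp only [Live, top]; omega

theorem start_unique {n : ℕ} {D : Finset (ℤ × ℤ)} {k k' : ℤ} (hk : 1 ≤ k ∧ k ≤ n)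
    (hk' : 1 ≤ k' ∧ k' ≤ n) (h : SamePipe n D (start n k) (start n k')) : k = k' := by
  have key : ∀ {a b : ℤ}, (1 ≤ b ∧ b ≤ n) →
      Relation.ReflTransGen (Flow n D) (start n a) (start n b) → a = b := by
    intro a b hb h
    rcases Relation.ReflTransGen.cases_tail h with h | ⟨c, _, h⟩
    · simp only [start, Side.h.injEq] at h; omega
    · exact absurd h (Flow.not_start hb)
  rcases h.flow.2 (live_start hk) with h | h
  · exact key hk' h
  · exact (key hk h).symm

theorem top_unique {n : ℕ} {D : Finset (ℤ × ℤ)} {j j' : ℤ} (hj : 1 ≤ j ∧ j ≤ n)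
    (h : SamePipe n D (top n j) (top n j')) : j = j' := by
  have key : ∀ {a b : ℤ}, Relation.ReflTransGen (Flow n D) (top n a) (top n b) → a = b := by
    intro a b h
    rcases Relation.ReflTransGen.cases_head h with h | ⟨c, h, _⟩
    · simp only [top, Side.v.injEq] at h; omega
    · exact absurd (show IsTop (top n a) by simp [IsTop, top]) h.2.1
  rcases h.flow.2 (live_top hj) with h | h
  · exact key h
  · exact (key h).symm

theorem live_finite (n : ℕ) : {x | Live n x}.Finite := by
  refine Set.Finite.subset
    (((Set.finite_Icc (1 : ℤ) (2 * n)).prod (Set.finite_Icc (0 : ℤ) (n + 1))).image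
        (fun b : ℤ × ℤ => Side.h b.1 b.2) |>.union
      (((Set.finite_Icc (1 : ℤ) (2 * n)).prod (Set.finite_Icc (0 : ℤ) (n + 1))).image
        (fun b : ℤ × ℤ => Side.v b.1 b.2))) ?_
  rintro (⟨i, j⟩ | ⟨i, j⟩) h <;> simp only [Set.mem_ofPred_eq, Live] at h
  · exact .inl ⟨(i, j), ⟨⟨by simp; omega, by simp; omega⟩, rfl⟩⟩
  · exact .inr ⟨(i, j), ⟨⟨by simp; omega, by simp; omega⟩, rfl⟩⟩

theorem exists_top {n : ℕ} (D : Finset (ℤ × ℤ)) {k : ℤ} (hk : 1 ≤ k ∧ k ≤ n) :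
    ∃ j : ℤ, (1 ≤ j ∧ j ≤ n) ∧ SamePipe n D (start n k) (top n j) := by
  set S : Set Side := {x | Relation.ReflTransGen (Flow n D) (start n k) x} with hS
  have hlive : ∀ x ∈ S, Live n x := by
    intro x hx
    rcases Relation.ReflTransGen.cases_tail hx with h | ⟨c, _, h⟩
    · rw [h]; exact live_start hk
    · exact h.live
  have hpipe : ∀ x ∈ S, SamePipe n D (start n k) x := by
    intro x hx
    induction hx with
    | refl => exact .refl _
    | tail _ h ih => exact .trans _ _ _ (ih) h.arc
  by_contra hcon
  have hntop : ∀ x ∈ S, ¬ IsTop x := by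
    intro x hx ht
    have hl := hlive x hx
    rcases x with ⟨i, j⟩ | ⟨i, j⟩
    · exact ht
    · simp only [IsTop] at ht
      subst ht
      simp only [Live] at hl
      refine hcon ⟨n + 1 - j, by omega, ?_⟩
      have := hpipe _ hx
      simpa [top] using this
  have hstep : ∀ x ∈ S, Flow n D x (next n D x) := fun x hx => ⟨hlive x hx, hntop x hx, rfl⟩
  have hmaps : Set.MapsTo (next n D) S S := fun x hx => hx.tail (hstep x hx)
  have hinj : Set.InjOn (next n D) S := by
    intro x hx y hy hxy
    exact Flow.leftUnique (hstep x hx) (hxy ▸ hstep y hy)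
  have hfin : S.Finite := (live_finite n).subset hlive
  obtain ⟨x, hx, hxs⟩ :=
    ((hfin.injOn_iff_bijOn_of_mapsTo hmaps).1 hinj).surjOn (show start n k ∈ S from .refl)
  exact Flow.not_start hk (hxs ▸ hstep x hx)

theorem bijective_ends (n : ℕ) (D : Finset (ℤ × ℤ)) :
    Function.Bijective (fun k : Set.Icc (1 : ℤ) n =>
      (⟨(exists_top D k.2).choose, (exists_top D k.2).choose_spec.1⟩ : Set.Icc (1 : ℤ) n)) := by
  refine Function.Injective.bijective_of_finite fun k k' h => Subtype.ext ?_
  have h1 := (exists_top D k.2).choose_spec.2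
  have h2 := (exists_top D k'.2).choose_spec.2
  have h3 : (exists_top D k.2).choose = (exists_top D k'.2).choose := congrArg Subtype.val h
  rw [← h3] at h2
  exact start_unique k.2 k'.2 (.trans _ _ _ h1 (.symm _ _ h2))

/-! #### The signed permutation of a skew pipe dream -/

/-- The permutation `v_D` of `{1, …, n}`: the pipe `ℓ_k` is the pipe `L_{v_D(k)}`. -/
noncomputable def vD (n : ℕ) (D : Finset (ℤ × ℤ)) : Equiv.Perm (Set.Icc (1 : ℤ) n) :=
  Equiv.ofBijective _ (bijective_ends n D)

/-- The pipe `ℓ_k` ends at the top of column `n + 1 - j` exactly for `j = v_D(k)`. -/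
theorem vD_spec (n : ℕ) (D : Finset (ℤ × ℤ)) (k j : Set.Icc (1 : ℤ) n) :
    SamePipe n D (start n k) (top n j) ↔ vD n D k = j := by
  have h1 : SamePipe n D (start n k) (top n (vD n D k)) := (exists_top D k.2).choose_spec.2
  refine ⟨fun h => ?_, fun h => h ▸ h1⟩
  exact Subtype.ext (top_unique (vD n D k).2 (.trans _ _ _ (.symm _ _ h1) h))

open Classical in
/-- `sign(L_j)`: the number of self-crossings of the pipe `L_j`, that is, of crossings both strands
of which belong to `L_j`. -/
noncomputable def selfCrossings (n : ℕ) (D : Finset (ℤ × ℤ)) (j : ℤ) : ℕ :=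
  ((Omega n D).filter fun b =>
    SamePipe n D (top n j) (.h b.1 b.2) ∧ SamePipe n D (top n j) (.v b.1 b.2)).card

/-- The function `j ↦ (-1)^{sign(L_j)+1} v_D⁻¹(j)` on `{1, …, n}`, extended oddly to `{±1, …, ±n}` and
by the identity elsewhere. -/
noncomputable def wFun (n : ℕ) (D : Finset (ℤ × ℤ)) (j : ℤ) : ℤ :=
  if h : 1 ≤ j ∧ j ≤ n then
    (-1) ^ (selfCrossings n D j + 1) * ((vD n D).symm ⟨j, h⟩ : ℤ)
  else if h : 1 ≤ -j ∧ -j ≤ n then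
    -((-1) ^ (selfCrossings n D (-j) + 1) * ((vD n D).symm ⟨-j, h⟩ : ℤ))
  else j

theorem wFun_neg (n : ℕ) (D : Finset (ℤ × ℤ)) (j : ℤ) : wFun n D (-j) = -wFun n D j := by
  by_cases h1 : 1 ≤ j ∧ j ≤ n
  · have h2 : ¬ (1 ≤ -j ∧ -j ≤ n) := by omega
    simp only [wFun, neg_neg, dif_pos h1, dif_neg h2]
  · by_cases h2 : 1 ≤ -j ∧ -j ≤ n
    · simp only [wFun, neg_neg, dif_neg h1, dif_pos h2]
    · simp only [wFun, neg_neg, dif_neg h1, dif_neg h2]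

theorem wFun_pos {n : ℕ} (D : Finset (ℤ × ℤ)) {j : ℤ} (h : 1 ≤ j ∧ j ≤ n) :
    wFun n D j = ((vD n D).symm ⟨j, h⟩ : ℤ) ∨ wFun n D j = -((vD n D).symm ⟨j, h⟩ : ℤ) := by
  simp only [wFun, dif_pos h]
  rcases neg_one_pow_eq_or ℤ (selfCrossings n D j + 1) with h' | h' <;> simp [h']

theorem wFun_out {n : ℕ} (D : Finset (ℤ × ℤ)) {j : ℤ} (h : ¬ (1 ≤ j ∧ j ≤ n))
    (h' : ¬ (1 ≤ -j ∧ -j ≤ n)) : wFun n D j = j := by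
  simp only [wFun, dif_neg h, dif_neg h']

theorem wFun_bijective (n : ℕ) (D : Finset (ℤ × ℤ)) : Function.Bijective (wFun n D) := by
  have hsurj : ∀ i : ℤ, 1 ≤ i ∧ i ≤ n → ∃ j, wFun n D j = i := by
    intro i hi
    have h := wFun_pos D (vD n D ⟨i, hi⟩).2
    rw [Subtype.coe_eta, Equiv.symm_apply_apply] at h
    rcases h with h | h
    · exact ⟨_, h⟩
    · exact ⟨-(vD n D ⟨i, hi⟩ : ℤ), by rw [wFun_neg, h, neg_neg]⟩
  have habs : ∀ (j : ℤ) (h : 1 ≤ j ∧ j ≤ n), 1 ≤ |wFun n D j| ∧ |wFun n D j| ≤ n := by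
    intro j h
    have h1 := ((vD n D).symm ⟨j, h⟩).2
    rcases wFun_pos D h with h2 | h2 <;> rw [h2] <;> try rw [abs_neg]
    all_goals rw [abs_of_pos (by linarith [h1.1])]; exact h1
  have hpp : ∀ j j' : ℤ, (1 ≤ j ∧ j ≤ n) → (1 ≤ j' ∧ j' ≤ n) →
      |wFun n D j| = |wFun n D j'| → j = j' := by
    intro j j' hj hj' h
    have h1 := ((vD n D).symm ⟨j, hj⟩).2
    have h2 := ((vD n D).symm ⟨j', hj'⟩).2
    have h3 : |wFun n D j| = ((vD n D).symm ⟨j, hj⟩ : ℤ) := by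
      rcases wFun_pos D hj with h | h <;> rw [h] <;> try rw [abs_neg]
      all_goals exact abs_of_pos (by linarith [h1.1])
    have h4 : |wFun n D j'| = ((vD n D).symm ⟨j', hj'⟩ : ℤ) := by
      rcases wFun_pos D hj' with h | h <;> rw [h] <;> try rw [abs_neg]
      all_goals exact abs_of_pos (by linarith [h2.1])
    rw [h3, h4] at h
    have h5 := (vD n D).symm.injective (Subtype.ext h)
    exact congrArg Subtype.val h5
  have hmain : ∀ j j' : ℤ, (1 ≤ j ∧ j ≤ n) → wFun n D j = wFun n D j' → j = j' := by
    intro j j' hj h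
    by_cases h1 : 1 ≤ j' ∧ j' ≤ n
    · exact hpp j j' hj h1 (by rw [h])
    · by_cases h2 : 1 ≤ -j' ∧ -j' ≤ n
      · exfalso
        have h3 := hpp j (-j') hj h2 (by rw [wFun_neg, abs_neg, h])
        have h4 := habs j hj
        rw [← neg_neg j', ← h3, wFun_neg] at h
        have h5 : wFun n D j = 0 := by omega
        rw [h5] at h4
        simp at h4
      · exfalso
        have h4 := habs j hj
        rw [h, wFun_out D h1 h2] at h4
        rcases abs_cases j' with h5 | h5 <;> omega
  refine ⟨fun j j' h => ?_, fun i => ?_⟩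
  · by_cases h1 : 1 ≤ j ∧ j ≤ n
    · exact hmain j j' h1 h
    by_cases h2 : 1 ≤ -j ∧ -j ≤ n
    · exact neg_injective (hmain (-j) (-j') h2 (by rw [wFun_neg, wFun_neg, h]))
    by_cases h3 : 1 ≤ j' ∧ j' ≤ n
    · exact (hmain j' j h3 h.symm).symm
    by_cases h4 : 1 ≤ -j' ∧ -j' ≤ n
    · exact neg_injective (hmain (-j') (-j) h4 (by rw [wFun_neg, wFun_neg, h])).symm
    rwa [wFun_out D h1 h2, wFun_out D h3 h4] at h
  · by_cases h1 : 1 ≤ i ∧ i ≤ n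
    · exact hsurj i h1
    by_cases h2 : 1 ≤ -i ∧ -i ≤ n
    · obtain ⟨j, hj⟩ := hsurj (-i) h2
      exact ⟨-j, by rw [wFun_neg, hj, neg_neg]⟩
    exact ⟨i, wFun_out D h1 h2⟩

/-- The signed permutation `w_D`: `w_D(j) = (-1)^{sign(L_j)+1} v_D⁻¹(j)` for `1 ≤ j ≤ n`. -/
noncomputable def wD (n : ℕ) (D : Finset (ℤ × ℤ)) : W n :=
  ⟨Equiv.ofBijective (wFun n D) (wFun_bijective n D), wFun_neg n D, fun i hi => by
    rw [Equiv.ofBijective_apply]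
    exact wFun_out D (fun h => by rw [abs_of_pos (by omega)] at hi; omega)
      (fun h => by rw [abs_of_neg (by omega)] at hi; omega)⟩

/-- `D` is reduced: `|D| = ℓ(w₀) - ℓ(w_D)`. -/
def IsReduced (n : ℕ) (D : Finset (ℤ × ℤ)) : Prop :=
  (D.card : ℤ) = (len n (w0 n) : ℤ) - len n (wD n D)

end SkewPipe

namespace SkewPipe

/-! Unfold rows `2p-1` and `2p` of the path diagram into the single row `p` of `SY_n`. All empty
boxes then act alike: the strand coming along the row turns upwards, and the strand coming from
below turns into the row. Three facts about this picture give the theorem.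

Invariance. Take a ladder: rungs `(a,c), (a,c+1)` with `c` equal to `j` or `2n-j`, the right box of
the bottom rung and the left box of the top rung empty, all rungs in between full. Toggling at once
the left box of the bottom rung and the right box of the top rung preserves `w_D` (`Flip.wD_eq`).
For `j < n` the two vertical strands are interchanged at the bottom and again at the top, so the
ends of all pipes stay. Both toggled boxes would be crossings of the same two strands, so each pipe
keeps the parity of its number of self-crossings. For `j = n` each toggled box only creates or
removes a kink, and one pipe carries both kinks. A ladder move is such a toggle in which one
crossing goes and one comes, so it preserves both `|D|` and `w_D`.

Normal form. If some row of `D` is not an initial segment, the lowest violation is the top of a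
ladder (`exists_ladder`). Toggling it either undoes a ladder move or deletes two crossings, and it
lowers the sum of the positions of the boxes. Hence `D` descends to a left-justified `E` with `w_E =
w_D` and `|E| ≤ |D|`, and equality of the cardinalities forces `D ∈ 𝓛(E)` (`exists_leftJustified`).

Left-justified sets. Such an `E` lacks exactly the last `t a` boxes of row `n-a`. Following its
pipes gives `w_E = canon t n` (`wD_shape`), the product over `a` of the first `t a` letters of `a+1,
…, 1, …, a+1`. This is the factorization of `W` along the chain of the groups of type `C_a` by
minimal coset representatives: every `w` has one, lengths add up so that `|E| = n² - ℓ(w)`, and its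
letters occupy the lexicographically least positions (`canonIdx_isLeast`). Hence `E = D(w_E)`.

If now `D` is reduced with `w_D = w`, its descent ends at `E = D(w)`, and `|D| = n² - ℓ(w) = |E|`,
so `D ∈ 𝓛(D(w))`. The other inclusion is invariance. -/

theorem mem_SY {n : ℕ} {p q : ℤ} : (p, q) ∈ SY n ↔ 1 ≤ p ∧ p ≤ n ∧ p ≤ q ∧ q ≤ 2 * n - p := by
  simp only [SY, Finset.mem_filter, Finset.mem_product, Finset.mem_Icc]
  omega

/-! ### The pipes in the coordinates of `SY_n` -/

/-- The sides of the boxes of `SY_n`: `H p q` is the side through which the pipe running along row `p`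
enters the box `(p,q)`, and `V p q` is the bottom side of the corresponding box of `S̃Y_n`. -/
inductive Edge where
  | H (p q : ℤ)
  | V (p q : ℤ)

open Edge

/-- The side through which a pipe leaves the box `(p,q)` upwards. -/
def up (n : ℕ) (p q : ℤ) : Edge := if q ≤ n then V (p - 1) (2 * n + 1 - q) else V p (2 * n + 1 - q)

/-- The arcs of `𝓖(D)` in the coordinates of `SY_n`. -/
inductive Link (n : ℕ) (D : Finset (ℤ × ℤ)) : Edge → Edge → Prop
  | cross_row {p q : ℤ} : (p, q) ∈ D → Link n D (H p q) (H p (q + 1))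
  | cross_col {p q : ℤ} : (p, q) ∈ D → Link n D (V p q) (up n p q)
  -- The bound reaches one box past the end of row `p`: the box `(p, 2n+1-p)` stands for the
  -- additional diagonal box `(2p,p)`, where a pipe that crosses its whole row turns upwards.
  | turn_up {p q : ℤ} : 1 ≤ p → p ≤ n → p ≤ q → q ≤ 2 * n + 1 - p → (p, q) ∉ D →
      Link n D (H p q) (up n p q)
  | turn_row {p q : ℤ} : (p, q) ∈ SY n → (p, q) ∉ D → Link n D (V p q) (H p (q + 1))

/-- Two sides are met by the same pipe. -/
def Conn (n : ℕ) (D : Finset (ℤ × ℤ)) : Edge → Edge → Prop := Relation.EqvGen (Link n D)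

namespace Conn

variable {n : ℕ} {D D' : Finset (ℤ × ℤ)} {a b c : Edge} {p q : ℤ}

theorem refl : Conn n D a a := Relation.EqvGen.refl _

theorem symm (h : Conn n D a b) : Conn n D b a := Relation.EqvGen.symm _ _ h

theorem trans (h : Conn n D a b) (h' : Conn n D b c) : Conn n D a c := Relation.EqvGen.trans _ _ _ h h'

theorem of_link (h : Link n D a b) : Conn n D a b := Relation.EqvGen.rel _ _ h

theorem cross_row (h : (p, q) ∈ D) : Conn n D (H p q) (H p (q + 1)) := of_link (.cross_row h)

theorem cross_col (h : (p, q) ∈ D) : Conn n D (V p q) (up n p q) := of_link (.cross_col h)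

theorem turn_up (h : (p, q) ∈ SY n) (h' : (p, q) ∉ D) : Conn n D (H p q) (up n p q) := by
  rw [mem_SY] at h
  exact of_link (.turn_up (by omega) (by omega) (by omega) (by omega) h')

theorem turn_row (h : (p, q) ∈ SY n) (h' : (p, q) ∉ D) : Conn n D (V p q) (H p (q + 1)) :=
  of_link (.turn_row h h')

theorem right_iff (h : Conn n D a b) : Conn n D c a ↔ Conn n D c b :=
  ⟨fun h' => h'.trans h, fun h' => h'.trans h.symm⟩

theorem map (f : Edge → Edge) (hf : ∀ a b, Link n D a b → Conn n D' (f a) (f b))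
    (h : Conn n D a b) : Conn n D' (f a) (f b) := by
  induction h with
  | rel x y h => exact hf x y h
  | refl x => exact refl
  | symm x y _ ih => exact ih.symm
  | trans x y z _ _ ih1 ih2 => exact ih1.trans ih2

end Conn

/-! ### Comparison of the unfolded picture with the drawn diagram. -/

/-- The translation of the sides of `𝓖(D)`. -/
def toEdge (n : ℕ) : Side → Edge
  | .h i j => if i % 2 = 1 then H ((i + 1) / 2) j else H (i / 2) (2 * n + 2 - j)
  -- Around the wall the three consecutive sides `.h (2p-1) (n+1)`, `.v (2p) (n+1)` and `.h (2p)
  -- (n+1)` all collapse to `H p (n+1)`, so `ofEdge` inverts this map only up to motion along a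
  -- pipe.
  | .v i j => if j = n + 1 then H (i / 2) j
    else if i % 2 = 1 then V ((i - 1) / 2) (2 * n + 1 - j) else V (i / 2) j

/-- The inverse translation. -/
def ofEdge (n : ℕ) : Edge → Side
  | .H p q => if q ≤ n + 1 then .h (2 * p - 1) q else .h (2 * p) (2 * n + 2 - q)
  | .V p q => if q ≤ n then .v (2 * p) q else .v (2 * p + 1) (2 * n + 1 - q)

theorem mem_Omega_odd {n : ℕ} {D : Finset (ℤ × ℤ)} (hD : D ⊆ SY n) {p q : ℤ} :
    (2 * p - 1, q) ∈ Omega n D ↔ q ≤ n ∧ (p, q) ∈ D := by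
  have h1 : Odd (2 * p - 1) := ⟨p - 1, by ring⟩
  have h2 : (2 * p - 1 + 1) / 2 = p := by omega
  simp only [Omega, Finset.mem_filter, mem_SYt, h1, if_true, h2]
  constructor
  · rintro ⟨h, h'⟩
    exact ⟨by omega, h'⟩
  · rintro ⟨h, h'⟩
    have := mem_SY.1 (hD h')
    exact ⟨by omega, h'⟩

theorem mem_Omega_even {n : ℕ} {D : Finset (ℤ × ℤ)} (hD : D ⊆ SY n) {p q : ℤ} :
    (2 * p, q) ∈ Omega n D ↔ q ≤ n ∧ (p, 2 * n + 1 - q) ∈ D := by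
  have h1 : ¬ Odd (2 * p) := by simp
  have h2 : (2 * p) / 2 = p := by omega
  simp only [Omega, Finset.mem_filter, mem_SYt, h1, if_false, h2]
  constructor
  · rintro ⟨h, h'⟩
    exact ⟨by omega, h'⟩
  · rintro ⟨h, h'⟩
    have := mem_SY.1 (hD h')
    exact ⟨by omega, h'⟩

/-- A step of the flow becomes a single link, or nothing at all when it runs along the wall. -/
theorem Flow.conn {n : ℕ} {D : Finset (ℤ × ℤ)} (hD : D ⊆ SY n) {a b : Side} (h : Flow n D a b) :
    Conn n D (toEdge n a) (toEdge n b) := by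
  obtain ⟨h1, h2, rfl⟩ := h
  rcases a with ⟨i, j⟩ | ⟨i, j⟩ <;> simp only [Live, IsTop] at h1 h2 <;> simp only [next]
  · obtain ⟨p, rfl | rfl⟩ : ∃ p, i = 2 * p - 1 ∨ i = 2 * p := ⟨(i + 1) / 2, by omega⟩
    · rw [if_pos (by omega)]
      have e1 : toEdge n (.h (2 * p - 1) j) = H p j := by
        simp only [toEdge]; rw [if_pos (by omega)]; congr 1; omega
      rw [e1]
      by_cases h3 : j = n + 1
      · rw [if_pos h3]
        have : toEdge n (.v (2 * p - 1 + 1) j) = H p j := by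
          simp only [toEdge]; rw [if_pos h3]; congr 1; omega
        rw [this]; exact .refl
      rw [if_neg h3]
      by_cases h4 : (p, j) ∈ D
      · rw [if_pos ((mem_Omega_odd hD).2 ⟨by omega, h4⟩)]
        have : toEdge n (.h (2 * p - 1) (j + 1)) = H p (j + 1) := by
          simp only [toEdge]; rw [if_pos (by omega)]; congr 1; omega
        rw [this]; exact .cross_row h4
      · rw [if_neg (fun h => h4 ((mem_Omega_odd hD).1 h).2)]
        have : toEdge n (.v (2 * p - 1) j) = up n p j := by
          simp only [toEdge, up]; rw [if_neg h3, if_pos (by omega), if_pos (by omega)]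
          congr 1; omega
        rw [this]; exact .turn_up (mem_SY.2 (by omega)) h4
    · rw [if_neg (by omega)]
      have e1 : toEdge n (.h (2 * p) j) = H p (2 * n + 2 - j) := by
        simp only [toEdge]; rw [if_neg (by omega)]; congr 1; omega
      rw [e1]
      have e2 : 2 * (n : ℤ) + 1 - (j - 1) = 2 * n + 2 - j := by ring
      by_cases h4 : (p, 2 * (n : ℤ) + 2 - j) ∈ D
      · rw [if_pos ((mem_Omega_even hD).2 ⟨by omega, e2 ▸ h4⟩)]
        have : toEdge n (.h (2 * p) (j - 1)) = H p (2 * n + 2 - j + 1) := by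
          simp only [toEdge]; rw [if_neg (by omega)]; congr 1 <;> omega
        rw [this]; exact .cross_row h4
      · rw [if_neg (fun h => h4 (e2 ▸ ((mem_Omega_even hD).1 h).2))]
        have : toEdge n (.v (2 * p) (j - 1)) = up n p (2 * n + 2 - j) := by
          simp only [toEdge, up]; rw [if_neg (by omega), if_neg (by omega), if_neg (by omega)]
          congr 1 <;> omega
        rw [this]; exact .of_link (.turn_up (by omega) (by omega) (by omega) (by omega) h4)
  · by_cases h3 : j = n + 1
    · rw [if_pos h3]
      have e1 : toEdge n (.v i j) = H (i / 2) j := by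
        simp only [toEdge]; rw [if_pos h3]
      have e2 : toEdge n (.h i j) = H (i / 2) j := by
        simp only [toEdge]; rw [if_neg (by omega)]; congr 1; omega
      rw [e1, e2]; exact .refl
    rw [if_neg h3]
    obtain ⟨p, rfl | rfl⟩ : ∃ p, i = 2 * p + 1 ∨ i = 2 * p := ⟨i / 2, by omega⟩
    · have e1 : toEdge n (.v (2 * p + 1) j) = V p (2 * n + 1 - j) := by
        simp only [toEdge]; rw [if_neg h3, if_pos (by omega)]; congr 1; omega
      rw [e1, add_sub_cancel_right]
      by_cases h4 : (p, 2 * (n : ℤ) + 1 - j) ∈ D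
      · rw [if_pos ((mem_Omega_even hD).2 ⟨by omega, h4⟩)]
        have : toEdge n (.v (2 * p) j) = up n p (2 * n + 1 - j) := by
          simp only [toEdge, up]; rw [if_neg h3, if_neg (by omega), if_neg (by omega)]
          congr 1 <;> omega
        rw [this]; exact .cross_col h4
      · rw [if_neg (fun h => h4 ((mem_Omega_even hD).1 h).2), if_neg (by omega)]
        have : toEdge n (.h (2 * p) j) = H p (2 * n + 1 - j + 1) := by
          simp only [toEdge]; rw [if_neg (by omega)]; congr 1 <;> omega
        rw [this]; exact .turn_row (mem_SY.2 (by omega)) h4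
    · have e1 : toEdge n (.v (2 * p) j) = V p j := by
        simp only [toEdge]; rw [if_neg h3, if_neg (by omega)]; congr 1; omega
      rw [e1]
      by_cases h4 : (p, j) ∈ D
      · rw [if_pos ((mem_Omega_odd hD).2 ⟨by omega, h4⟩)]
        have : toEdge n (.v (2 * p - 1) j) = up n p j := by
          simp only [toEdge, up]; rw [if_neg h3, if_pos (by omega), if_pos (by omega)]
          congr 1; omega
        rw [this]; exact .cross_col h4
      · rw [if_neg (fun h => h4 ((mem_Omega_odd hD).1 h).2), if_pos (by omega)]
        have : toEdge n (.h (2 * p - 1) (j + 1)) = H p (j + 1) := by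
          simp only [toEdge]; rw [if_pos (by omega)]; congr 1; omega
        rw [this]; exact .turn_row (mem_SY.2 (by omega)) h4

/-- Arcs that are not live bound remnants at the border and have no counterpart in `SY_n`. For a
live side, one of the two sides is reached from the other by the flow, and each step translates. -/
theorem SamePipe.conn {n : ℕ} {D : Finset (ℤ × ℤ)} (hD : D ⊆ SY n) {a b : Side}
    (h : SamePipe n D a b) (ha : Live n a) : Conn n D (toEdge n a) (toEdge n b) := by
  have key : ∀ {a b}, Relation.ReflTransGen (Flow n D) a b →
      Conn n D (toEdge n a) (toEdge n b) := by
    intro a b h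
    induction h with
    | refl => exact .refl
    | tail _ h ih => exact ih.trans (h.conn hD)
  rcases h.flow.2 ha with h | h
  · exact key h
  · exact (key h).symm

theorem samePipe_next {n : ℕ} {D : Finset (ℤ × ℤ)} {a b : Side} (h1 : Live n a) (h2 : ¬ IsTop a)
    (h3 : next n D a = b) : SamePipe n D a b := Flow.arc ⟨h1, h2, h3⟩

theorem Link.samePipe {n : ℕ} {D : Finset (ℤ × ℤ)} (hD : D ⊆ SY n) {a b : Edge} (h : Link n D a b) :
    SamePipe n D (ofEdge n a) (ofEdge n b) := by
  have wall : ∀ p : ℤ, 1 ≤ p → p ≤ n →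
      SamePipe n D (.h (2 * p - 1) (n + 1)) (.h (2 * p) (n + 1)) := by
    intro p h1 h2
    refine .trans _ (.v (2 * p) (n + 1)) _ ?_ ?_
    · refine samePipe_next (by simp only [Live]; omega) (by simp [IsTop]) ?_
      have h : (2 * p - 1) % 2 = 1 := by omega
      simp [next, h]
    · refine samePipe_next ⟨by omega, by omega, .inr ⟨rfl, by omega, by omega⟩⟩
        (by simp only [IsTop]; omega) ?_
      simp [next]
  -- At `q = n+1` the inverse translation chooses the side in the odd row, which `wall` joins to the
  -- one in the even row.
  have eH : ∀ p q : ℤ, n + 1 ≤ q → 1 ≤ p → p ≤ n →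
      SamePipe n D (ofEdge n (H p q)) (.h (2 * p) (2 * n + 2 - q)) := by
    intro p q h1 h2 h3
    rcases eq_or_lt_of_le h1 with rfl | h1
    · simp only [ofEdge]; rw [if_pos (by omega)]
      have : 2 * (n : ℤ) + 2 - (n + 1) = n + 1 := by ring
      rw [this]; exact wall p h2 h3
    · simp only [ofEdge]; rw [if_neg (by omega)]; exact .refl _
  have hmem : ∀ {p q : ℤ}, (p, q) ∈ D → 1 ≤ p ∧ p ≤ n ∧ p ≤ q ∧ q ≤ 2 * n - p :=
    fun h => mem_SY.1 (hD h)
  have eO : ∀ p q : ℤ, q ≤ n + 1 → ofEdge n (H p q) = .h (2 * p - 1) q := by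
    intro p q h; simp only [ofEdge]; rw [if_pos h]
  have eV : ∀ p q : ℤ, q ≤ n → ofEdge n (V p q) = .v (2 * p) q := by
    intro p q h; simp only [ofEdge]; rw [if_pos h]
  have eV' : ∀ p q : ℤ, n + 1 ≤ q → ofEdge n (V p q) = .v (2 * p + 1) (2 * n + 1 - q) := by
    intro p q h; simp only [ofEdge]; rw [if_neg (by omega)]
  have eU : ∀ p q : ℤ, q ≤ n → ofEdge n (up n p q) = .v (2 * p - 1) q := by
    intro p q h; simp only [up, if_pos h]; rw [eV' _ _ (by omega)]; congr 1 <;> omega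
  have eU' : ∀ p q : ℤ, n + 1 ≤ q → ofEdge n (up n p q) = .v (2 * p) (2 * n + 1 - q) := by
    intro p q h; simp only [up]; rw [if_neg (by omega), eV _ _ (by omega)]
  cases h with
  | @cross_row p q h =>
    have := hmem h
    by_cases hq : q ≤ n
    · rw [eO _ _ (by omega), eO _ _ (by omega)]
      exact .rel _ _ (.cross_h ((mem_Omega_odd hD).2 ⟨hq, h⟩))
    · refine .trans _ _ _ (eH _ _ (by omega) (by omega) (by omega)) (.symm _ _ ?_)
      refine .trans _ _ _ (eH _ _ (by omega) (by omega) (by omega)) ?_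
      have h' : (2 * p, 2 * (n : ℤ) + 2 - (q + 1)) ∈ Omega n D :=
        (mem_Omega_even hD).2
          ⟨by omega, by rwa [show 2 * (n : ℤ) + 1 - (2 * n + 2 - (q + 1)) = q by ring]⟩
      have := Arc.cross_h h'
      rw [show 2 * (n : ℤ) + 2 - (q + 1) + 1 = 2 * n + 2 - q by ring] at this
      exact .rel _ _ this
  | @cross_col p q h =>
    have := hmem h
    by_cases hq : q ≤ n
    · rw [eV _ _ hq, eU _ _ hq]
      have := Arc.cross_v ((mem_Omega_odd hD).2 ⟨hq, h⟩)
      rw [sub_add_cancel] at this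
      exact .symm _ _ (.rel _ _ this)
    · rw [eV' _ _ (by omega), eU' _ _ (by omega)]
      have h' : (2 * p, 2 * (n : ℤ) + 1 - q) ∈ Omega n D :=
        (mem_Omega_even hD).2
          ⟨by omega, by rwa [show 2 * (n : ℤ) + 1 - (2 * n + 1 - q) = q by ring]⟩
      exact .symm _ _ (.rel _ _ (Arc.cross_v h'))
  | @turn_up p q h1 h2 h3 h4 h =>
    by_cases hq : q ≤ n
    · rw [eO _ _ (by omega), eU _ _ hq]
      refine samePipe_next (by simp only [Live]; omega) (by simp [IsTop]) ?_
      simp only [next]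
      rw [if_pos (by omega), if_neg (by omega), if_neg (fun h' => h ((mem_Omega_odd hD).1 h').2)]
    · rw [eU' _ _ (by omega)]
      refine .trans _ _ _ (eH _ _ (by omega) (by omega) (by omega)) ?_
      refine samePipe_next (by simp only [Live]; omega) (by simp [IsTop]) ?_
      simp only [next]
      rw [if_neg (by omega), if_neg]
      · congr 1; omega
      · rw [mem_Omega_even hD]
        rintro ⟨_, h'⟩
        rw [show 2 * (n : ℤ) + 1 - (2 * n + 2 - q - 1) = q by ring] at h'
        exact h h'
  | @turn_row p q h1 h =>
    rw [mem_SY] at h1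
    by_cases hq : q ≤ n
    · rw [eO _ _ (by omega), eV _ _ hq]
      refine samePipe_next (by simp only [Live]; omega) (by simp only [IsTop]; omega) ?_
      simp only [next]
      rw [if_neg (by omega), if_neg (fun h' => h ((mem_Omega_odd hD).1 h').2), if_pos (by omega)]
    · rw [eV' _ _ (by omega)]
      refine .trans _ _ _ ?_ (.symm _ _ (eH _ _ (by omega) (by omega) (by omega)))
      refine samePipe_next (by simp only [Live]; omega) (by simp only [IsTop]; omega) ?_
      simp only [next]
      rw [if_neg (by omega), if_neg, if_neg (by omega)]
      · congr 1 <;> omega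
      · rw [add_sub_cancel_right, mem_Omega_even hD]
        rintro ⟨_, h'⟩
        rw [show 2 * (n : ℤ) + 1 - (2 * n + 1 - q) = q by ring] at h'
        exact h h'

theorem Conn.samePipe {n : ℕ} {D : Finset (ℤ × ℤ)} (hD : D ⊆ SY n) {a b : Edge} (h : Conn n D a b) :
    SamePipe n D (ofEdge n a) (ofEdge n b) := by
  induction h with
  | rel x y h => exact h.samePipe hD
  | refl x => exact .refl _
  | symm x y _ ih => exact .symm _ _ ih
  | trans x y z _ _ ih1 ih2 => exact .trans _ _ _ ih1 ih2

/-! ### Ends, self-crossings and signed permutation in unfolded coordinates. -/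

/-- The first side of the pipe `ℓ_k`. -/
def source (n : ℕ) (k : ℤ) : Edge := H (n + 1 - k) (n + 1 - k)

/-- The last side of the pipe `L_j`. -/
def sink (n : ℕ) (j : ℤ) : Edge := V 0 (n + j)

theorem toEdge_start {n : ℕ} {k : ℤ} : toEdge n (start n k) = source n k := by
  simp only [toEdge, start, source]; rw [if_pos (by omega)]; congr 1 <;> omega

theorem ofEdge_source {n : ℕ} {k : ℤ} (hk : 0 ≤ k) : ofEdge n (source n k) = start n k := by
  simp only [ofEdge, start, source]; rw [if_pos (by omega)]; congr 1 <;> omega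

theorem toEdge_top {n : ℕ} {j : ℤ} (hj : 1 ≤ j) : toEdge n (top n j) = sink n j := by
  simp only [toEdge, top, sink]; rw [if_neg (by omega), if_pos (by omega)]; congr 1; omega

theorem ofEdge_sink {n : ℕ} {j : ℤ} (hj : 1 ≤ j) : ofEdge n (sink n j) = top n j := by
  simp only [ofEdge, top, sink]; rw [if_neg (by omega)]; congr 1; omega

theorem samePipe_start_top {n : ℕ} {D : Finset (ℤ × ℤ)} (hD : D ⊆ SY n) {k j : ℤ}
    (hk : 1 ≤ k ∧ k ≤ n) (hj : 1 ≤ j) :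
    SamePipe n D (start n k) (top n j) ↔ Conn n D (source n k) (sink n j) := by
  constructor
  · intro h
    have := h.conn hD (live_start hk)
    rwa [toEdge_start, toEdge_top hj] at this
  · intro h
    have := h.samePipe hD
    rwa [ofEdge_source (by omega), ofEdge_sink hj] at this

theorem Conn.source_unique {n : ℕ} {D : Finset (ℤ × ℤ)} (hD : D ⊆ SY n) {k k' : ℤ}
    (hk : 1 ≤ k ∧ k ≤ n) (hk' : 1 ≤ k' ∧ k' ≤ n) (h : Conn n D (source n k) (source n k')) :
    k = k' := by
  have := h.samePipe hD
  rw [ofEdge_source (by omega), ofEdge_source (by omega)] at this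
  exact start_unique hk hk' this

/-- Both strands of the crossing `b` belong to the pipe ending at `sink n j`. -/
def IsSelf (n : ℕ) (D : Finset (ℤ × ℤ)) (j : ℤ) (b : ℤ × ℤ) : Prop :=
  Conn n D (sink n j) (H b.1 b.2) ∧ Conn n D (sink n j) (V b.1 b.2)

/-- The box of `S̃Y_n` corresponding to a box of `SY_n`. -/
def toBox (n : ℕ) (b : ℤ × ℤ) : ℤ × ℤ :=
  if b.2 ≤ n then (2 * b.1 - 1, b.2) else (2 * b.1, 2 * n + 1 - b.2)

theorem Conn.sink_iff {n : ℕ} {D : Finset (ℤ × ℤ)} (hD : D ⊆ SY n) {j : ℤ} (hj : 1 ≤ j ∧ j ≤ n)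
    {a : Side} (ha : ofEdge n (toEdge n a) = a) :
    SamePipe n D (top n j) a ↔ Conn n D (sink n j) (toEdge n a) := by
  constructor
  · intro h
    have := h.conn hD (live_top hj)
    rwa [toEdge_top (by omega)] at this
  · intro h
    have := h.samePipe hD
    rwa [ha, ofEdge_sink (by omega)] at this

/-- The original definition tests the left and top sides of the box, `IsSelf` the side of entry
along the row and the bottom side. At a crossing opposite sides lie on the same strand, so the
choice does not matter. -/
theorem isSelf_iff {n : ℕ} {D : Finset (ℤ × ℤ)} (hD : D ⊆ SY n) {j : ℤ} (hj : 1 ≤ j ∧ j ≤ n)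
    {b : ℤ × ℤ} (hb : b ∈ D) :
    (SamePipe n D (top n j) (.h (toBox n b).1 (toBox n b).2) ∧
      SamePipe n D (top n j) (.v (toBox n b).1 (toBox n b).2)) ↔ IsSelf n D j b := by
  obtain ⟨p, q⟩ := b
  have h := mem_SY.1 (hD hb)
  by_cases hq : q ≤ n
  · have e : toBox n (p, q) = (2 * p - 1, q) := by simp [toBox, hq]
    have e1 : toEdge n (.h (2 * p - 1) q) = H p q := by
      simp only [toEdge]; rw [if_pos (by omega)]; congr 1; omega
    have e2 : toEdge n (.v (2 * p - 1) q) = up n p q := by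
      simp only [toEdge, up]; rw [if_neg (by omega), if_pos (by omega), if_pos hq]; congr 1; omega
    rw [e, Conn.sink_iff hD hj, Conn.sink_iff hD hj, e1, e2, ← (Conn.cross_col hb).right_iff]
    · rfl
    · rw [e2]; simp only [up, ofEdge]; rw [if_pos hq]; simp only []; rw [if_neg (by omega)]
      congr 1 <;> omega
    · rw [e1]; simp only [ofEdge]; rw [if_pos (by omega)]
  · have e : toBox n (p, q) = (2 * p, 2 * n + 1 - q) := by simp [toBox, hq]
    have e1 : toEdge n (.h (2 * p) (2 * n + 1 - q)) = H p (q + 1) := by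
      simp only [toEdge]; rw [if_neg (by omega)]; congr 1 <;> omega
    have e2 : toEdge n (.v (2 * p) (2 * n + 1 - q)) = up n p q := by
      simp only [toEdge, up]; rw [if_neg (by omega), if_neg (by omega), if_neg hq]; congr 1; omega
    rw [e, Conn.sink_iff hD hj, Conn.sink_iff hD hj, e1, e2, ← (Conn.cross_col hb).right_iff,
      ← (Conn.cross_row hb).right_iff]
    · rfl
    · rw [e2]; simp only [up, ofEdge]; rw [if_neg hq]; simp only []; rw [if_pos (by omega)]
    · rw [e1]; simp only [ofEdge]; rw [if_neg (by omega)]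
      congr 1; omega

open Classical in
theorem selfCrossings_eq {n : ℕ} {D : Finset (ℤ × ℤ)} (hD : D ⊆ SY n) {j : ℤ}
    (hj : 1 ≤ j ∧ j ≤ n) : selfCrossings n D j = (D.filter (IsSelf n D j)).card := by
  unfold selfCrossings
  symm
  refine Finset.card_bij (fun b _ => toBox n b) ?_ ?_ ?_
  · intro b hb
    rw [Finset.mem_filter] at hb ⊢
    refine ⟨?_, (isSelf_iff hD hj hb.1).2 hb.2⟩
    obtain ⟨p, q⟩ := b
    by_cases hq : q ≤ n
    · simp only [toBox, if_pos hq, mem_Omega_odd hD]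
      exact ⟨hq, hb.1⟩
    · simp only [toBox, if_neg hq, mem_Omega_even hD]
      exact ⟨by omega, by rw [sub_sub_cancel]; exact hb.1⟩
  · rintro ⟨p, q⟩ _ ⟨p', q'⟩ _ h
    simp only [toBox] at h
    split_ifs at h <;> simp only [Prod.mk.injEq] at h ⊢ <;> omega
  · rintro ⟨i, c⟩ h
    rw [Finset.mem_filter] at h
    obtain ⟨p, rfl | rfl⟩ : ∃ p, i = 2 * p - 1 ∨ i = 2 * p := ⟨(i + 1) / 2, by omega⟩
    · have h1 := (mem_Omega_odd hD).1 h.1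
      have e : toBox n (p, c) = (2 * p - 1, c) := by simp [toBox, h1.1]
      refine ⟨(p, c), Finset.mem_filter.2 ⟨h1.2, ?_⟩, e⟩
      rw [← isSelf_iff hD hj h1.2, e]
      exact h.2
    · have h1 := (mem_Omega_even hD).1 h.1
      have e : toBox n (p, 2 * n + 1 - c) = (2 * p, c) := by
        simp only [toBox]; rw [if_neg (by omega), sub_sub_cancel]
      refine ⟨(p, 2 * n + 1 - c), Finset.mem_filter.2 ⟨h1.2, ?_⟩, e⟩
      rw [← isSelf_iff hD hj h1.2, e]
      exact h.2

theorem vD_eq_iff {n : ℕ} {D : Finset (ℤ × ℤ)} (hD : D ⊆ SY n) (k j : Set.Icc (1 : ℤ) n) :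
    vD n D k = j ↔ Conn n D (source n k) (sink n j) := by
  rw [← vD_spec, samePipe_start_top hD k.2 j.2.1]

theorem wD_apply {n : ℕ} {D : Finset (ℤ × ℤ)} (hD : D ⊆ SY n) {k j : ℤ} (hk : 1 ≤ k ∧ k ≤ n)
    (hj : 1 ≤ j ∧ j ≤ n) (h : Conn n D (source n k) (sink n j)) :
    (wD n D : Equiv.Perm ℤ) j = (-1) ^ (selfCrossings n D j + 1) * k := by
  have h1 := (vD_eq_iff hD ⟨k, hk⟩ ⟨j, hj⟩).2 h
  have h2 : (vD n D).symm ⟨j, hj⟩ = ⟨k, hk⟩ := by rw [← h1, Equiv.symm_apply_apply]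
  change wFun n D j = _
  rw [wFun, dif_pos hj, h2]

theorem exists_source {n : ℕ} {D : Finset (ℤ × ℤ)} (hD : D ⊆ SY n) {j : ℤ}
    (hj : 1 ≤ j ∧ j ≤ n) : ∃ k : ℤ, (1 ≤ k ∧ k ≤ n) ∧ Conn n D (source n k) (sink n j) :=
  ⟨(vD n D).symm ⟨j, hj⟩, ((vD n D).symm ⟨j, hj⟩).2,
    (vD_eq_iff hD _ ⟨j, hj⟩).1 (Equiv.apply_symm_apply _ _)⟩

/-- Elements of `W n` are determined by their values on `{1, …, n}`. -/
theorem W_ext {n : ℕ} {w w' : W n}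
    (h : ∀ j : ℤ, 1 ≤ j → j ≤ n → (w : Equiv.Perm ℤ) j = (w' : Equiv.Perm ℤ) j) : w = w' := by
  have zero : ∀ u : W n, (u : Equiv.Perm ℤ) 0 = 0 := by
    intro u
    have := u.2.1 0
    rw [neg_zero] at this
    omega
  refine Subtype.ext (Equiv.ext fun j => ?_)
  by_cases h1 : |j| ≤ n
  · rcases lt_trichotomy j 0 with h2 | h2 | h2
    · rw [abs_of_neg h2] at h1
      have := h (-j) (by omega) h1
      rwa [w.2.1, w'.2.1, neg_inj] at this
    · rw [h2, zero, zero]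
    · rw [abs_of_pos h2] at h1
      exact h j (by omega) h1
  · rw [w.2.2 j (by omega), w'.2.2 j (by omega)]

/-- Only the pairing of starts with ends and the parities of the self-crossing numbers enter `w_D`.
-/
theorem wD_congr {n : ℕ} {D D' : Finset (ℤ × ℤ)} (hD : D ⊆ SY n) (hD' : D' ⊆ SY n)
    (h1 : ∀ k j : ℤ, 1 ≤ j → Conn n D (source n k) (sink n j) → Conn n D' (source n k) (sink n j))
    (h2 : ∀ j : ℤ, 1 ≤ j → j ≤ n →
      (Even (selfCrossings n D j) ↔ Even (selfCrossings n D' j))) : wD n D = wD n D' := by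
  refine W_ext fun j hj hj' => ?_
  obtain ⟨k, hk, hkj⟩ := exists_source hD ⟨hj, hj'⟩
  rw [wD_apply hD hk ⟨hj, hj'⟩ hkj, wD_apply hD' hk ⟨hj, hj'⟩ (h1 k j hj hkj)]
  congr 1
  rw [pow_succ, pow_succ]
  congr 1
  by_cases h : Even (selfCrossings n D j)
  · rw [h.neg_one_pow, ((h2 j hj hj').1 h).neg_one_pow]
  · rw [(Nat.not_even_iff_odd.1 h).neg_one_pow,
      (Nat.not_even_iff_odd.1 (fun h' => h ((h2 j hj hj').2 h'))).neg_one_pow]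

end SkewPipe

namespace SkewPipe
open Edge

/-! ### Exchanging two crossings of a ladder -/

/-- The row of `S̃Y_n` which contains the box corresponding to `(p,q)`. -/
def level (n : ℕ) (p q : ℤ) : ℤ := if q ≤ n then 2 * p - 1 else 2 * p

/-- `D` and `D'` differ exactly at the two boxes `(p,q)` and `(p',q'+1)` at the ends of a ladder formed
by the boxes in columns `j, j+1` and their mirror images. -/
structure Flip (n : ℕ) (j p q p' q' : ℤ) (D D' : Finset (ℤ × ℤ)) : Prop where
  j_le : j ≤ n
  col : q = j ∨ q = 2 * n - j
  col' : q' = j ∨ q' = 2 * n - j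
  lt : level n p' q' < level n p q
  mem : (p, q) ∈ SY n
  mem' : (p', q') ∈ SY n
  mem_succ : (p', q' + 1) ∈ SY n
  subset : D ⊆ SY n
  subset' : D' ⊆ SY n
  -- The box `(p,q+1)` is not required to lie in `SY_n`: the bottom rung may stick out at the end of
  -- its row, where the additional box also turns the pipe upwards.
  notMem : (p, q + 1) ∉ D
  notMem' : (p', q') ∉ D
  between : ∀ a c : ℤ, (c = j ∨ c = 2 * n - j) → level n p' q' < level n a c →
    level n a c < level n p q → (a, c) ∈ D ∧ (a, c + 1) ∈ D
  other : ∀ b, b ≠ (p, q) → b ≠ (p', q' + 1) → (b ∈ D ↔ b ∈ D')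
  -- The two toggles are independent of the initial state, so a ladder move, its inverse, and the
  -- creation or deletion of a pair of crossings are all instances, and the relation is symmetric.
  flip : (p, q) ∈ D ↔ (p, q) ∉ D'
  flip' : (p', q' + 1) ∈ D ↔ (p', q' + 1) ∉ D'

namespace Flip

variable {n : ℕ} {j p q p' q' : ℤ} {D D' : Finset (ℤ × ℤ)}

theorem symm (h : Flip n j p q p' q' D D') : Flip n j p q p' q' D' D where
  j_le := h.j_le
  col := h.col
  col' := h.col'
  lt := h.lt
  mem := h.mem
  mem' := h.mem'
  mem_succ := h.mem_succ
  subset := h.subset'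
  subset' := h.subset
  notMem := by
    rw [← h.other]
    · exact h.notMem
    · simp
    · intro he
      simp only [Prod.mk.injEq] at he
      have := h.lt
      rw [he.1, show q = q' by omega] at this
      exact lt_irrefl _ this
  notMem' := by
    rw [← h.other]
    · exact h.notMem'
    · intro he
      simp only [Prod.mk.injEq] at he
      have := h.lt
      rw [he.1, he.2] at this
      exact lt_irrefl _ this
    · simp
  between := by
    intro a c hc h1 h2
    have hb := h.between a c hc h1 h2
    have := h.col
    have := h.col'
    rw [← h.other, ← h.other]
    · exact hb
    · intro he
      simp only [Prod.mk.injEq] at he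
      omega
    · intro he
      simp only [Prod.mk.injEq] at he
      rw [he.1, show c = q' by omega] at h1
      exact lt_irrefl _ h1
    · intro he
      simp only [Prod.mk.injEq] at he
      rw [he.1, he.2] at h2
      exact lt_irrefl _ h2
    · intro he
      simp only [Prod.mk.injEq] at he
      omega
  other := fun b h1 h2 => (h.other b h1 h2).symm
  flip := by have := h.flip; tauto
  flip' := by have := h.flip'; tauto

theorem ne (h : Flip n j p q p' q' D D') : (p, q) ≠ (p', q' + 1) := by
  intro he
  simp only [Prod.mk.injEq] at he
  have := h.col
  have := h.col'
  omega

theorem mem_of_notMem (h : Flip n j p q p' q' D D') (hx : (p, q) ∉ D) : (p, q) ∈ D' :=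
  not_not.1 fun h' => hx (h.flip.2 h')

theorem mem_of_notMem' (h : Flip n j p q p' q' D D') (hx : (p', q' + 1) ∉ D) : (p', q' + 1) ∈ D' :=
  not_not.1 fun h' => hx (h.flip'.2 h')

/-- Climbing one row of `S̃Y_n` replaces a column `c` of `SY_n` by `2n+1-c`. The two columns of the
ladder thus return as the mirrored pair with left and right exchanged, and the level drops by one.
-/
theorem up_eq (hj : j < n) (a : ℤ) {c : ℤ} (hc : c = j ∨ c = 2 * n - j) :
    ∃ a' c' : ℤ, (c' = j ∨ c' = 2 * n - j) ∧ level n a' c' = level n a c - 1 ∧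
      up n a c = V a' (c' + 1) ∧ up n a (c + 1) = V a' c' := by
  by_cases h : c ≤ n
  · refine ⟨a - 1, 2 * n - c, by omega, ?_, ?_, ?_⟩
    · simp only [level]; rw [if_pos h, if_neg (by omega)]; ring
    · simp only [up]; rw [if_pos h]; congr 1; ring
    · simp only [up]; rw [if_pos (by omega)]; congr 1; ring
  · refine ⟨a, 2 * n - c, by omega, ?_, ?_, ?_⟩
    · simp only [level]; rw [if_neg h, if_pos (by omega)]
    · simp only [up]; rw [if_neg h]; congr 1; ring
    · simp only [up]; rw [if_neg (by omega)]; congr 1; ring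

theorem eq_up (hj : j < n) (a : ℤ) {c : ℤ} (hc : c = j ∨ c = 2 * n - j) :
    ∃ a' c' : ℤ, (c' = j ∨ c' = 2 * n - j) ∧ level n a' c' = level n a c + 1 ∧
      up n a' c' = V a (c + 1) ∧ up n a' (c' + 1) = V a c := by
  by_cases h : c ≤ n
  · refine ⟨a, 2 * n - c, by omega, ?_, ?_, ?_⟩
    · simp only [level]; rw [if_pos h, if_neg (by omega)]; ring
    · simp only [up]; rw [if_neg (by omega)]; congr 1; ring
    · simp only [up]; rw [if_neg (by omega)]; congr 1; ring
  · refine ⟨a + 1, 2 * n - c, by omega, ?_, ?_, ?_⟩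
    · simp only [level]; rw [if_neg h, if_pos (by omega)]; ring
    · simp only [up]; rw [if_pos (by omega)]; congr 1 <;> ring
    · simp only [up]; rw [if_pos (by omega)]; congr 1 <;> ring

theorem level_inj (hj : j < n) {a c a' c' : ℤ} (hc : c = j ∨ c = 2 * n - j)
    (hc' : c' = j ∨ c' = 2 * n - j) (h : level n a c = level n a' c') : a = a' ∧ c = c' := by
  simp only [level] at h
  split_ifs at h <;> omega

open Classical in
/-- The effect of the exchange on the sides of the boxes, for a ladder away from the wall. -/
noncomputable def edgeMap (n : ℕ) (j p q p' q' : ℤ) (D : Finset (ℤ × ℤ)) : Edge → Edge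
  -- Inside the ladder the two vertical sides of each rung change places. The middle side of the
  -- bottom rung lies on the row strand if `(p,q)` is a crossing and on the vertical strand
  -- otherwise, and is sent back to the start of that strand. The middle side of the top rung
  -- follows `V p' q'`, from which it comes and which is sent to `V p' (q'+1)`.
  | H a c => if (a, c) = (p, q + 1) then (if (p, q) ∈ D then H p q else V p q)
    else if (a, c) = (p', q' + 1) then V p' (q' + 1) else H a c
  | V a c => if level n p' q' ≤ level n a c ∧ level n a c < level n p q then
      (if c = j ∨ c = 2 * n - j then V a (c + 1)
        else if c = j + 1 ∨ c = 2 * n - j + 1 then V a (c - 1) else V a c)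
    else V a c

theorem edgeMap_H {a c : ℤ} (h1 : (a, c) ≠ (p, q + 1)) (h2 : (a, c) ≠ (p', q' + 1)) :
    edgeMap n j p q p' q' D (H a c) = H a c := by
  simp only [edgeMap]; rw [if_neg h1, if_neg h2]

theorem edgeMap_V_in (hj : j < n) {a c : ℤ} (hc : c = j ∨ c = 2 * n - j)
    (h1 : level n p' q' ≤ level n a c) (h2 : level n a c < level n p q) :
    edgeMap n j p q p' q' D (V a c) = V a (c + 1) ∧
      edgeMap n j p q p' q' D (V a (c + 1)) = V a c := by
  have h3 : level n a (c + 1) = level n a c := by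
    simp only [level]; split_ifs <;> omega
  constructor
  · simp only [edgeMap]; rw [if_pos ⟨h1, h2⟩, if_pos hc]
  · simp only [edgeMap]; rw [h3, if_pos ⟨h1, h2⟩, if_neg (by omega), if_pos (by omega)]
    congr 1; ring

theorem edgeMap_V_out (hj : j < n) {a c : ℤ} (hc : c = j ∨ c = 2 * n - j)
    (h1 : level n a c < level n p' q' ∨ level n p q ≤ level n a c) :
    edgeMap n j p q p' q' D (V a c) = V a c ∧
      edgeMap n j p q p' q' D (V a (c + 1)) = V a (c + 1) := by
  have h3 : level n a (c + 1) = level n a c := by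
    simp only [level]; split_ifs <;> omega
  constructor
  · simp only [edgeMap]; rw [if_neg (by omega)]
  · simp only [edgeMap]; rw [h3, if_neg (by omega)]

theorem edgeMap_V_other {a c : ℤ}
    (hc : c ≠ j ∧ c ≠ 2 * n - j ∧ c ≠ j + 1 ∧ c ≠ 2 * n - j + 1) :
    edgeMap n j p q p' q' D (V a c) = V a c := by
  have h1 : ¬ (c = j ∨ c = 2 * (n : ℤ) - j) := by omega
  have h2 : ¬ (c = j + 1 ∨ c = 2 * (n : ℤ) - j + 1) := by omega
  simp only [edgeMap, if_neg h1, if_neg h2, ite_self]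

theorem edgeMap_up_in (hj : j < n) {a c : ℤ} (hc : c = j ∨ c = 2 * n - j)
    (h1 : level n p' q' < level n a c) (h2 : level n a c ≤ level n p q) :
    edgeMap n j p q p' q' D (up n a c) = up n a (c + 1) ∧
      edgeMap n j p q p' q' D (up n a (c + 1)) = up n a c := by
  obtain ⟨a', c', hc', hl, e1, e2⟩ := up_eq hj a hc
  rw [e1, e2]
  exact (edgeMap_V_in hj hc' (by omega) (by omega)).symm

theorem edgeMap_up_out (hj : j < n) {a c : ℤ} (hc : c = j ∨ c = 2 * n - j)
    (h1 : level n a c ≤ level n p' q' ∨ level n p q < level n a c) :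
    edgeMap n j p q p' q' D (up n a c) = up n a c ∧
      edgeMap n j p q p' q' D (up n a (c + 1)) = up n a (c + 1) := by
  obtain ⟨a', c', hc', hl, e1, e2⟩ := up_eq hj a hc
  rw [e1, e2]
  exact (edgeMap_V_out hj hc' (by omega)).symm

theorem edgeMap_up_other {a c : ℤ}
    (hc : c ≠ j ∧ c ≠ 2 * n - j ∧ c ≠ j + 1 ∧ c ≠ 2 * n - j + 1) :
    edgeMap n j p q p' q' D (up n a c) = up n a c := by
  simp only [up]
  split_ifs <;> exact edgeMap_V_other (by omega)

/-- A link at the box `(a,c)`. -/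
inductive LinkAt (n : ℕ) (D : Finset (ℤ × ℤ)) (a c : ℤ) : Edge → Edge → Prop
  | cross_row : (a, c) ∈ D → LinkAt n D a c (H a c) (H a (c + 1))
  | cross_col : (a, c) ∈ D → LinkAt n D a c (V a c) (up n a c)
  | turn_up : 1 ≤ a → a ≤ n → a ≤ c → c ≤ 2 * n + 1 - a → (a, c) ∉ D →
      LinkAt n D a c (H a c) (up n a c)
  | turn_row : (a, c) ∈ SY n → (a, c) ∉ D → LinkAt n D a c (V a c) (H a (c + 1))

theorem _root_.SkewPipe.Link.exists_at {s t : Edge} (h : Link n D s t) :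
    ∃ a c, LinkAt n D a c s t := by
  cases h with
  | cross_row h => exact ⟨_, _, .cross_row h⟩
  | cross_col h => exact ⟨_, _, .cross_col h⟩
  | turn_up h1 h2 h3 h4 h => exact ⟨_, _, .turn_up h1 h2 h3 h4 h⟩
  | turn_row h1 h => exact ⟨_, _, .turn_row h1 h⟩

theorem LinkAt.conn {a c : ℤ} {s t : Edge} (h : LinkAt n D a c s t)
    (hD : (a, c) ∈ D ↔ (a, c) ∈ D') : Conn n D' s t := by
  cases h with
  | cross_row h => exact .cross_row (hD.1 h)
  | cross_col h => exact .cross_col (hD.1 h)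
  | turn_up h1 h2 h3 h4 h => exact .of_link (.turn_up h1 h2 h3 h4 (fun h' => h (hD.2 h')))
  | turn_row h1 h => exact .of_link (.turn_row h1 (fun h' => h (hD.2 h')))

theorem LinkAt.conn_of_fixed {a c : ℤ} {s t : Edge} (h : LinkAt n D a c s t)
    (hD : (a, c) ∈ D ↔ (a, c) ∈ D') {f : Edge → Edge} (h1 : f (H a c) = H a c)
    (h2 : f (H a (c + 1)) = H a (c + 1)) (h3 : f (V a c) = V a c) (h4 : f (up n a c) = up n a c) :
    Conn n D' (f s) (f t) := by
  have key := h.conn hD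
  cases h with
  | cross_row h => rwa [h1, h2]
  | cross_col h => rwa [h3, h4]
  | turn_up _ _ _ _ h => rwa [h1, h4]
  | turn_row _ h => rwa [h3, h2]

/-- Each link of `D` has to become a connection in `D'`, and this is local. Outside the ladder
nothing moves. In an interior rung both boxes are crossings, so interchanging the vertical strands
does not disturb the rows. At an end rung the interchange is exactly what toggling the one box
produces. -/
theorem conn_edgeMap_at (h : Flip n j p q p' q' D D') (hj : j < n) {a c : ℤ} {s t : Edge}
    (hl : LinkAt n D a c s t) :
    Conn n D' (edgeMap n j p q p' q' D s) (edgeMap n j p q p' q' D t) := by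
  have hq := h.col
  have hq' := h.col'
  have hlt := h.lt
  have hs := h.symm
  by_cases hc : c ≠ j ∧ c ≠ 2 * n - j ∧ c ≠ j + 1 ∧ c ≠ 2 * n - j + 1
  · refine hl.conn_of_fixed (h.other _ ?_ ?_) (edgeMap_H ?_ ?_) (edgeMap_H ?_ ?_)
      (edgeMap_V_other hc) (edgeMap_up_other hc) <;>
    · simp only [ne_eq, Prod.mk.injEq]; omega
  obtain ⟨d, hd, hcd⟩ : ∃ d, (d = j ∨ d = 2 * n - j) ∧ (c = d ∨ c = d + 1) := by
    by_cases h1 : c = j ∨ c = 2 * n - j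
    · exact ⟨c, h1, .inl rfl⟩
    · exact ⟨c - 1, by omega, by omega⟩
  have hF : edgeMap n j p q p' q' D (H a d) = H a d := by
    apply edgeMap_H <;> simp only [ne_eq, Prod.mk.injEq] <;> omega
  have hO : edgeMap n j p q p' q' D (H a (d + 1 + 1)) = H a (d + 1 + 1) := by
    apply edgeMap_H <;> simp only [ne_eq, Prod.mk.injEq] <;> omega
  have hG : (a, d) ≠ (p, q) → (a, d) ≠ (p', q') →
      edgeMap n j p q p' q' D (H a (d + 1)) = H a (d + 1) := by
    intro h1 h2
    simp only [ne_eq, Prod.mk.injEq] at h1 h2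
    apply edgeMap_H <;> simp only [ne_eq, Prod.mk.injEq] <;> omega
  have hsame : (a, d) ≠ (p, q) → (a, d) ≠ (p', q') →
      ((a, d) ∈ D ↔ (a, d) ∈ D') ∧ ((a, d + 1) ∈ D ↔ (a, d + 1) ∈ D') := by
    intro h1 h2
    simp only [ne_eq, Prod.mk.injEq] at h1 h2
    constructor <;> apply h.other <;> simp only [ne_eq, Prod.mk.injEq] <;> omega
  have hne : ∀ {a' c' : ℤ}, level n a d ≠ level n a' c' → (a, d) ≠ (a', c') := by
    intro a' c' h1 h2
    simp only [Prod.mk.injEq] at h2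
    rw [h2.1, h2.2] at h1
    exact h1 rfl
  rcases lt_trichotomy (level n a d) (level n p q) with h1 | h1 | h1
  · rcases lt_trichotomy (level n a d) (level n p' q') with h2 | h2 | h2
    · have n1 := hne (by omega : level n a d ≠ level n p q)
      have n2 := hne (by omega : level n a d ≠ level n p' q')
      have hV := edgeMap_V_out (D := D) hj hd (.inl h2 : _ ∨ level n p q ≤ level n a d)
      have hU := edgeMap_up_out (D := D) hj hd (.inl h2.le : _ ∨ level n p q < level n a d)
      rcases hcd with rfl | rfl
      · exact hl.conn_of_fixed (hsame n1 n2).1 hF (hG n1 n2) hV.1 hU.1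
      · exact hl.conn_of_fixed (hsame n1 n2).2 (hG n1 n2) hO hV.2 hU.2
    · obtain ⟨rfl, rfl⟩ := level_inj hj hd hq' h2
      have hV := edgeMap_V_in (D := D) hj hd le_rfl h1
      have hU := edgeMap_up_out (D := D) hj hd (.inl le_rfl : _ ∨ level n p q < level n a d)
      have hG' : edgeMap n j p q a d D (H a (d + 1)) = V a (d + 1) := by
        simp only [edgeMap]
        rw [if_neg, if_pos trivial]
        simp only [Prod.mk.injEq]
        rintro ⟨rfl, h4⟩
        rw [show d = q by omega] at h1
        exact lt_irrefl _ h1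
      rcases hcd with rfl | rfl
      · cases hl with
        | cross_row h3 => exact absurd h3 h.notMem'
        | cross_col h3 => exact absurd h3 h.notMem'
        | turn_up _ _ _ _ h3 => rw [hF, hU.1]; exact .turn_up h.mem' hs.notMem'
        | turn_row _ h3 => rw [hV.1, hG']; exact .refl
      · cases hl with
        | cross_row h3 => rw [hG', hO]; exact .turn_row h.mem_succ (h.flip'.1 h3)
        | cross_col h3 =>
          rw [hV.2, hU.2]
          exact (Conn.turn_row h.mem' hs.notMem').trans (.turn_up h.mem_succ (h.flip'.1 h3))
        | turn_up _ _ _ _ h3 => rw [hG', hU.2]; exact .cross_col (h.mem_of_notMem' h3)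
        | turn_row _ h3 =>
          rw [hV.2, hO]
          exact (Conn.turn_row h.mem' hs.notMem').trans (.cross_row (h.mem_of_notMem' h3))
    · have n1 := hne (by omega : level n a d ≠ level n p q)
      have n2 := hne (by omega : level n a d ≠ level n p' q')
      have hV := edgeMap_V_in (D := D) hj hd h2.le h1
      have hU := edgeMap_up_in (D := D) hj hd h2 h1.le
      have hm := h.between a d hd h2 h1
      have hm' := hs.between a d hd h2 h1
      rcases hcd with rfl | rfl
      · cases hl with
        | cross_row h3 => rw [hF, hG n1 n2]; exact .cross_row hm'.1
        | cross_col h3 => rw [hV.1, hU.1]; exact .cross_col hm'.2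
        | turn_up _ _ _ _ h3 => exact absurd hm.1 h3
        | turn_row _ h3 => exact absurd hm.1 h3
      · cases hl with
        | cross_row h3 => rw [hG n1 n2, hO]; exact .cross_row hm'.2
        | cross_col h3 => rw [hV.2, hU.2]; exact .cross_col hm'.1
        | turn_up _ _ _ _ h3 => exact absurd hm.2 h3
        | turn_row _ h3 => exact absurd hm.2 h3
  · obtain ⟨rfl, rfl⟩ := level_inj hj hd hq h1
    have hV := edgeMap_V_out (D := D) hj hd (.inr le_rfl : level n a d < level n p' q' ∨ _)
    have hU := edgeMap_up_in (D := D) hj hd hlt le_rfl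
    have hG' : edgeMap n j a d p' q' D (H a (d + 1)) = if (a, d) ∈ D then H a d else V a d := by
      simp only [edgeMap]
      rw [if_pos trivial]
    have hm := mem_SY.1 h.mem
    have hup : Conn n D' (H a (d + 1)) (up n a (d + 1)) :=
      .of_link (.turn_up (by omega) (by omega) (by omega) (by omega) hs.notMem)
    rcases hcd with rfl | rfl
    · cases hl with
      | cross_row h3 => rw [hF, hG', if_pos h3]; exact .refl
      | cross_col h3 =>
        rw [hV.1, hU.1]
        exact (Conn.turn_row h.mem (h.flip.1 h3)).trans hup
      | turn_up _ _ _ _ h3 =>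
        rw [hF, hU.1]
        exact (Conn.cross_row (h.mem_of_notMem h3)).trans hup
      | turn_row _ h3 => rw [hV.1, hG', if_neg h3]; exact .refl
    · cases hl with
      | cross_row h3 => exact absurd h3 h.notMem
      | cross_col h3 => exact absurd h3 h.notMem
      | turn_up _ _ _ _ h3 =>
        rw [hG', hU.2]
        split_ifs with h4
        · exact .turn_up h.mem (h.flip.1 h4)
        · exact .cross_col (h.mem_of_notMem h4)
      | turn_row h3 _ => rw [hV.2, hO]; exact .turn_row h3 hs.notMem
  · have n1 := hne (by omega : level n a d ≠ level n p q)
    have n2 := hne (by omega : level n a d ≠ level n p' q')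
    have hV := edgeMap_V_out (D := D) hj hd (.inr h1.le : level n a d < level n p' q' ∨ _)
    have hU := edgeMap_up_out (D := D) hj hd (.inr h1 : level n a d ≤ level n p' q' ∨ _)
    rcases hcd with rfl | rfl
    · exact hl.conn_of_fixed (hsame n1 n2).1 hF (hG n1 n2) hV.1 hU.1
    · exact hl.conn_of_fixed (hsame n1 n2).2 (hG n1 n2) hO hV.2 hU.2

theorem conn_edgeMap (h : Flip n j p q p' q' D D') (hj : j < n) {s t : Edge}
    (hl : Conn n D s t) :
    Conn n D' (edgeMap n j p q p' q' D s) (edgeMap n j p q p' q' D t) := by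
  refine hl.map _ fun a b hab => ?_
  obtain ⟨a, c, hac⟩ := hab.exists_at
  exact h.conn_edgeMap_at hj hac

open Classical in
/-- The effect of the exchange on the sides of the boxes, for a ladder along the wall. -/
noncomputable def wallMap (n : ℕ) (p p' : ℤ) (D : Finset (ℤ × ℤ)) : Edge → Edge
  -- At an end rung where the toggled box is a crossing, the two sides next to the wall belong to a
  -- kink and are contracted to the side where the kink starts. Where it is empty, they form a small
  -- closed loop, and they stay connected with each other in `D'`.
  | H a c => if (a, c) = (p, (n : ℤ) + 1) ∧ (p, (n : ℤ)) ∈ D then H p n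
    else if (a, c) = (p', (n : ℤ) + 1) ∧ (p', (n : ℤ) + 1) ∈ D then V p' (n + 1) else H a c
  | V a c => if (a, c) = (p, (n : ℤ)) ∧ (p, (n : ℤ)) ∈ D then H p n
    else if (a, c) = (p', (n : ℤ)) ∧ (p', (n : ℤ) + 1) ∈ D then V p' (n + 1) else V a c

theorem wallMap_H {a c : ℤ} (h : c ≠ n + 1 ∨ (a ≠ p ∧ a ≠ p')) :
    wallMap n p p' D (H a c) = H a c := by
  simp only [wallMap, Prod.mk.injEq]; rw [if_neg (by omega), if_neg (by omega)]

theorem wallMap_V {a c : ℤ} (h : c ≠ n ∨ (a ≠ p ∧ a ≠ p')) :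
    wallMap n p p' D (V a c) = V a c := by
  simp only [wallMap, Prod.mk.injEq]; rw [if_neg (by omega), if_neg (by omega)]

theorem up_wall (a : ℤ) : up n a (n + 1) = V a n := by
  simp only [up]; rw [if_neg (by omega)]; congr 1; ring

theorem up_wall' (a : ℤ) : up n a n = V (a - 1) (n + 1) := by
  simp only [up]; rw [if_pos le_rfl]; congr 1; ring

/-- Along the wall a rung is a pair of boxes stacked in column `n` of `S̃Y_n`. Toggling an end box
inserts or removes a kink, while the pipe enters and leaves the rung at the same places as before.
-/
theorem conn_wallMap_at (h : Flip n n p n p' n D D') {a c : ℤ} {s t : Edge}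
    (hl : LinkAt n D a c s t) : Conn n D' (wallMap n p p' D s) (wallMap n p p' D t) := by
  have hs := h.symm
  have hlt : p' < p := by
    have := h.lt
    simp only [level, le_refl, if_true] at this
    omega
  have hup : wallMap n p p' D (up n a n) = up n a n := by
    rw [up_wall']; exact wallMap_V (.inl (by omega))
  have hm := mem_SY.1 h.mem
  have hup' : ∀ {D : Finset (ℤ × ℤ)}, (p, (n : ℤ) + 1) ∉ D → Conn n D (H p (n + 1)) (V p n) := by
    intro D hD
    rw [← up_wall]
    exact .of_link (.turn_up (by omega) (by omega) (by omega) (by omega) hD)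
  by_cases hc : c ≠ n ∧ c ≠ n + 1
  · refine hl.conn_of_fixed (h.other _ ?_ ?_) (wallMap_H (.inl hc.2)) (wallMap_H (.inl (by omega)))
      (wallMap_V (.inl hc.1)) ?_
    · simp only [ne_eq, Prod.mk.injEq]; omega
    · simp only [ne_eq, Prod.mk.injEq]; omega
    · simp only [up]; split_ifs <;> exact wallMap_V (.inl (by omega))
  by_cases ha : a ≠ p ∧ a ≠ p'
  · refine hl.conn_of_fixed (h.other _ ?_ ?_) (wallMap_H (.inr ha)) (wallMap_H (.inr ha))
      (wallMap_V (.inr ha)) ?_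
    · simp only [ne_eq, Prod.mk.injEq]; omega
    · simp only [ne_eq, Prod.mk.injEq]; omega
    · rcases (by omega : c = n ∨ c = n + 1) with rfl | rfl
      · exact hup
      · rw [up_wall]; exact wallMap_V (.inr ha)
  have hH : wallMap n p p' D (H a n) = H a n := wallMap_H (.inl (by omega))
  have hV : wallMap n p p' D (V a (n + 1)) = V a (n + 1) := wallMap_V (.inl (by omega))
  have hO : wallMap n p p' D (H a (n + 1 + 1)) = H a (n + 1 + 1) := wallMap_H (.inl (by omega))
  rcases (by omega : a = p ∨ a = p') with rfl | rfl
  · by_cases hx : (a, (n : ℤ)) ∈ D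
    · have e1 : wallMap n a p' D (H a (n + 1)) = H a n := by
        simp only [wallMap]; rw [if_pos ⟨trivial, hx⟩]
      have e2 : wallMap n a p' D (V a n) = H a n := by
        simp only [wallMap]; rw [if_pos ⟨trivial, hx⟩]
      rcases (by omega : c = n ∨ c = n + 1) with rfl | rfl
      · cases hl with
        | cross_row _ => rw [hH, e1]; exact .refl
        | cross_col _ => rw [e2, hup]; exact .turn_up h.mem (h.flip.1 hx)
        | turn_up _ _ _ _ h3 => exact absurd hx h3
        | turn_row _ h3 => exact absurd hx h3
      · cases hl with
        | cross_row h3 => exact absurd h3 h.notMem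
        | cross_col h3 => exact absurd h3 h.notMem
        | turn_up _ _ _ _ h3 => rw [up_wall, e1, e2]; exact .refl
        | turn_row h3 _ => rw [hV, hO]; exact .turn_row h3 hs.notMem
    · have e1 : wallMap n a p' D (H a (n + 1)) = H a (n + 1) := by
        simp only [wallMap, Prod.mk.injEq]; rw [if_neg (fun h => hx h.2), if_neg (by omega)]
      have e2 : wallMap n a p' D (V a n) = V a n := by
        simp only [wallMap, Prod.mk.injEq]; rw [if_neg (fun h => hx h.2), if_neg (by omega)]
      have hx' : (a, (n : ℤ)) ∈ D' := h.mem_of_notMem hx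
      rcases (by omega : c = n ∨ c = n + 1) with rfl | rfl
      · cases hl with
        | cross_row h3 => exact absurd h3 hx
        | cross_col h3 => exact absurd h3 hx
        | turn_up _ _ _ _ h3 =>
          rw [hH, hup]
          exact ((Conn.cross_row hx').trans (hup' hs.notMem)).trans (.cross_col hx')
        | turn_row _ h3 => rw [e1, e2]; exact (hup' hs.notMem).symm
      · cases hl with
        | cross_row h3 => exact absurd h3 h.notMem
        | cross_col h3 => exact absurd h3 h.notMem
        | turn_up _ _ _ _ h3 => rw [up_wall, e1, e2]; exact hup' hs.notMem
        | turn_row h3 _ => rw [hV, hO]; exact .turn_row h3 hs.notMem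
  · by_cases hy : (a, (n : ℤ) + 1) ∈ D
    · have e1 : wallMap n p a D (H a (n + 1)) = V a (n + 1) := by
        simp only [wallMap, Prod.mk.injEq]; rw [if_neg (by omega), if_pos ⟨by simp, hy⟩]
      have e2 : wallMap n p a D (V a n) = V a (n + 1) := by
        simp only [wallMap, Prod.mk.injEq]; rw [if_neg (by omega), if_pos ⟨by simp, hy⟩]
      rcases (by omega : c = n ∨ c = n + 1) with rfl | rfl
      · cases hl with
        | cross_row h3 => exact absurd h3 h.notMem'
        | cross_col h3 => exact absurd h3 h.notMem'
        | turn_up _ _ _ _ h3 => rw [hH, hup]; exact .turn_up h.mem' hs.notMem'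
        | turn_row _ h3 => rw [e1, e2]; exact .refl
      · cases hl with
        | cross_row h3 => rw [e1, hO]; exact .turn_row h.mem_succ (h.flip'.1 hy)
        | cross_col h3 => rw [up_wall, hV, e2]; exact .refl
        | turn_up _ _ _ _ h3 => exact absurd hy h3
        | turn_row _ h3 => exact absurd hy h3
    · have e1 : wallMap n p a D (H a (n + 1)) = H a (n + 1) := by
        simp only [wallMap, Prod.mk.injEq]; rw [if_neg (by omega), if_neg (fun h => hy h.2)]
      have e2 : wallMap n p a D (V a n) = V a n := by
        simp only [wallMap, Prod.mk.injEq]; rw [if_neg (by omega), if_neg (fun h => hy h.2)]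
      have hy' : (a, (n : ℤ) + 1) ∈ D' := h.mem_of_notMem' hy
      rcases (by omega : c = n ∨ c = n + 1) with rfl | rfl
      · cases hl with
        | cross_row h3 => exact absurd h3 h.notMem'
        | cross_col h3 => exact absurd h3 h.notMem'
        | turn_up _ _ _ _ h3 => rw [hH, hup]; exact .turn_up h.mem' hs.notMem'
        | turn_row _ h3 => rw [e1, e2]; exact .turn_row h.mem' hs.notMem'
      · cases hl with
        | cross_row h3 => exact absurd h3 hy
        | cross_col h3 => exact absurd h3 hy
        | turn_up _ _ _ _ h3 => rw [up_wall, e1, e2]; exact (Conn.turn_row h.mem' hs.notMem').symm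
        | turn_row _ h3 =>
          rw [hV, hO]
          have h4 := Conn.cross_col (n := n) hy'
          rw [up_wall] at h4
          exact (h4.trans (.turn_row h.mem' hs.notMem')).trans (.cross_row hy')

theorem conn_wallMap (h : Flip n n p n p' n D D') {s t : Edge} (hl : Conn n D s t) :
    Conn n D' (wallMap n p p' D s) (wallMap n p p' D t) := by
  refine hl.map _ fun a b hab => ?_
  obtain ⟨a, c, hac⟩ := hab.exists_at
  exact h.conn_wallMap_at hac

end Flip
end SkewPipe

/-! ### Invariance of the signed permutation under exchanges. -/

namespace SkewPipe
open Edge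

theorem card_eq_erase_erase {α : Type*} [DecidableEq α] (A : Finset α) {x y : α} (h : x ≠ y) :
    A.card = ((A.erase x).erase y).card + (if x ∈ A then 1 else 0) + (if y ∈ A then 1 else 0) := by
  by_cases hx : x ∈ A <;> by_cases hy : y ∈ A
  · rw [if_pos hx, if_pos hy, ← Finset.card_erase_add_one hx,
      ← Finset.card_erase_add_one (Finset.mem_erase.2 ⟨h.symm, hy⟩)]
  · rw [if_pos hx, if_neg hy, ← Finset.card_erase_add_one hx,
      Finset.erase_eq_of_notMem (fun h' => hy (Finset.mem_of_mem_erase h'))]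
  · rw [if_neg hx, if_pos hy, Finset.erase_eq_of_notMem hx, Finset.card_erase_add_one hy]
  · rw [if_neg hx, if_neg hy, Finset.erase_eq_of_notMem hx, Finset.erase_eq_of_notMem hy,
      add_zero, add_zero]

namespace Flip

variable {n : ℕ} {j p q p' q' : ℤ} {D D' : Finset (ℤ × ℤ)}

-- Apart from the two toggled boxes the self-crossings of `D` and `D'` are equinumerous, by `hle` in
-- both directions. `P` says that the strands at the ladder ends belong to the pipe `L_i`. If `P`
-- holds, the contributions of the two boxes before and after toggling add up to two, so they have
-- the same parity; otherwise both vanish.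
open Classical in
theorem even_iff (h : Flip n j p q p' q' D D') {i : ℤ} (hi : 1 ≤ i ∧ i ≤ n) {P : Prop}
    (hle : ∀ {D D'}, Flip n j p q p' q' D D' →
      (((D.filter (IsSelf n D i)).erase (p, q)).erase (p', q' + 1)).card ≤
        (((D'.filter (IsSelf n D' i)).erase (p, q)).erase (p', q' + 1)).card)
    (h1 : (p, q) ∈ D → (IsSelf n D i (p, q) ↔ P))
    (h2 : (p', q' + 1) ∈ D → (IsSelf n D i (p', q' + 1) ↔ P))
    (h3 : (p, q) ∈ D' → (IsSelf n D' i (p, q) ↔ P))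
    (h4 : (p', q' + 1) ∈ D' → (IsSelf n D' i (p', q' + 1) ↔ P)) :
    Even (selfCrossings n D i) ↔ Even (selfCrossings n D' i) := by
  rw [selfCrossings_eq h.subset hi, selfCrossings_eq h.subset' hi, card_eq_erase_erase _ h.ne,
    card_eq_erase_erase (D'.filter _) h.ne, le_antisymm (hle h) (hle h.symm)]
  simp only [Finset.mem_filter, and_congr_right_iff.2 h1, and_congr_right_iff.2 h2,
    and_congr_right_iff.2 h3, and_congr_right_iff.2 h4]
  simp only [h.flip, h.flip']
  generalize (((D'.filter (IsSelf n D' i)).erase (p, q)).erase (p', q' + 1)).card = m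
  by_cases hP : P <;> by_cases hx : (p, q) ∈ D' <;> by_cases hy : (p', q' + 1) ∈ D' <;>
    simp [hP, hx, hy, Nat.even_add_one]

theorem one_le_level (h : Flip n j p q p' q' D D') : 1 ≤ level n p' q' := by
  have := mem_SY.1 h.mem'
  simp only [level]
  split_ifs <;> omega

theorem edgeMap_source (h : Flip n j p q p' q' D D') (k : ℤ) :
    edgeMap n j p q p' q' D (source n k) = source n k := by
  have := mem_SY.1 h.mem
  have := mem_SY.1 h.mem'
  apply edgeMap_H <;> simp only [ne_eq, Prod.mk.injEq] <;> omega

theorem edgeMap_sink (h : Flip n j p q p' q' D D') {i : ℤ} (hi : 1 ≤ i) :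
    edgeMap n j p q p' q' D (sink n i) = sink n i := by
  have := h.one_le_level
  have h1 : level n 0 (n + i) = 0 := by
    simp only [level]; rw [if_neg (by omega)]; rfl
  simp only [sink, edgeMap]
  rw [if_neg (by omega)]

theorem conn_sink (h : Flip n j p q p' q' D D') (hj : j < n) {i : ℤ} (hi : 1 ≤ i) {t : Edge}
    (hl : Conn n D (sink n i) t) : Conn n D' (sink n i) (edgeMap n j p q p' q' D t) := by
  have := h.conn_edgeMap hj hl
  rwa [h.edgeMap_sink hi] at this

-- Since the vertical strands of the ladder are interchanged, a self-crossing in one box of an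
-- interior rung reappears in the other box of that rung. The involution `τ` records this and fixes
-- all other boxes.
open Classical in
theorem card_le (h : Flip n j p q p' q' D D') (hj : j < n) {i : ℤ} (hi : 1 ≤ i) :
    (((D.filter (IsSelf n D i)).erase (p, q)).erase (p', q' + 1)).card ≤
      (((D'.filter (IsSelf n D' i)).erase (p, q)).erase (p', q' + 1)).card := by
  set τ : ℤ × ℤ → ℤ × ℤ := fun b =>
    if level n p' q' < level n b.1 b.2 ∧ level n b.1 b.2 < level n p q then
      (if b.2 = j ∨ b.2 = 2 * n - j then (b.1, b.2 + 1)
        else if b.2 = j + 1 ∨ b.2 = 2 * n - j + 1 then (b.1, b.2 - 1) else b)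
    else b with hτ
  have hlev : ∀ {a c : ℤ}, (c = j ∨ c = 2 * n - j) → level n a (c + 1) = level n a c := by
    intro a c hc
    simp only [level]; split_ifs <;> omega
  have τ1 : ∀ {a c : ℤ}, (c = j ∨ c = 2 * n - j) → level n p' q' < level n a c →
      level n a c < level n p q → τ (a, c) = (a, c + 1) := by
    intro a c hc h1 h2
    simp only [hτ]; rw [if_pos ⟨h1, h2⟩, if_pos hc]
  have τ2 : ∀ {a c : ℤ}, (c = j ∨ c = 2 * n - j) → level n p' q' < level n a c →
      level n a c < level n p q → τ (a, c + 1) = (a, c) := by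
    intro a c hc h1 h2
    simp only [hτ]; rw [hlev hc, if_pos ⟨h1, h2⟩, if_neg (by omega), if_pos (by omega),
      add_sub_cancel_right]
  have τ3 : ∀ {b : ℤ × ℤ}, ¬ (∃ a c, (c = j ∨ c = 2 * n - j) ∧ level n p' q' < level n a c ∧
      level n a c < level n p q ∧ (b = (a, c) ∨ b = (a, c + 1))) → τ b = b := by
    rintro ⟨a, c⟩ hb
    simp only [hτ]
    split_ifs with h1 h2 h3
    · exact absurd ⟨a, c, h2, h1.1, h1.2, .inl rfl⟩ hb
    · have h4 := hlev (a := a) (c := c - 1) (by omega)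
      rw [sub_add_cancel] at h4
      exact absurd ⟨a, c - 1, by omega, by omega, by omega, .inr (by simp)⟩ hb
    · rfl
    · rfl
  have hττ : ∀ b, τ (τ b) = b := by
    intro b
    by_cases hb : ∃ a c, (c = j ∨ c = 2 * n - j) ∧ level n p' q' < level n a c ∧
      level n a c < level n p q ∧ (b = (a, c) ∨ b = (a, c + 1))
    · obtain ⟨a, c, hc, h1, h2, rfl | rfl⟩ := hb
      · rw [τ1 hc h1 h2, τ2 hc h1 h2]
      · rw [τ2 hc h1 h2, τ1 hc h1 h2]
    · rw [τ3 hb, τ3 hb]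
  have hq := h.col
  have hq' := h.col'
  refine Finset.card_le_card_of_injOn τ ?_ (fun a _ b _ hab => by rw [← hττ a, hab, hττ])
  intro b hb
  simp only [Finset.mem_coe, Finset.mem_erase, Finset.mem_filter] at hb ⊢
  obtain ⟨hb1, hb2, hb3, hb4, hb5⟩ := hb
  by_cases hm : ∃ a c, (c = j ∨ c = 2 * n - j) ∧ level n p' q' < level n a c ∧
      level n a c < level n p q ∧ (b = (a, c) ∨ b = (a, c + 1))
  · obtain ⟨a, c, hc, h1, h2, hbac⟩ := hm
    have hD := h.symm.between a c hc h1 h2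
    have hV := edgeMap_V_in (D := D) hj hc h1.le h2
    have n1 : (a, c) ≠ (p, q) := by
      intro he
      simp only [Prod.mk.injEq] at he
      rw [he.1, he.2] at h2
      exact lt_irrefl _ h2
    have n2 : (a, c) ≠ (p', q') := by
      intro he
      simp only [Prod.mk.injEq] at he
      rw [he.1, he.2] at h1
      exact lt_irrefl _ h1
    simp only [ne_eq, Prod.mk.injEq] at n1 n2
    have hH : edgeMap n j p q p' q' D (H a c) = H a c := by
      apply edgeMap_H <;> simp only [ne_eq, Prod.mk.injEq] <;> omega
    have hH' : edgeMap n j p q p' q' D (H a (c + 1)) = H a (c + 1) := by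
      apply edgeMap_H <;> simp only [ne_eq, Prod.mk.injEq] <;> omega
    have c1 := h.conn_sink hj hi hb4
    have c2 := h.conn_sink hj hi hb5
    rcases hbac with rfl | rfl
    · rw [τ1 hc h1 h2]
      simp only [hH, hV.1] at c1 c2
      refine ⟨?_, ?_, hD.2, c1.trans (.cross_row hD.1), c2⟩ <;>
        simp only [ne_eq, Prod.mk.injEq] <;> omega
    · rw [τ2 hc h1 h2]
      simp only [hH', hV.2] at c1 c2
      refine ⟨?_, ?_, hD.1, c1.trans (Conn.cross_row hD.1).symm, c2⟩ <;>
        simp only [ne_eq, Prod.mk.injEq] <;> omega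
  · rw [τ3 hm]
    refine ⟨hb1, hb2, (h.other b hb2 hb1).1 hb3, ?_⟩
    have n1 : b ≠ (p, q + 1) := fun he => h.notMem (he ▸ hb3)
    have n2 : b ≠ (p', q') := fun he => h.notMem' (he ▸ hb3)
    obtain ⟨a, c⟩ := b
    have c1 := h.conn_sink hj hi hb4
    have c2 := h.conn_sink hj hi hb5
    simp only at c1 c2
    rw [edgeMap_H n1 hb1] at c1
    refine ⟨c1, ?_⟩
    have hV : edgeMap n j p q p' q' D (V a c) = V a c := by
      have key : ∀ d, (d = j ∨ d = 2 * n - j) → (c = d ∨ c = d + 1) →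
          ¬ (level n p' q' ≤ level n a d ∧ level n a d < level n p q) := by
        rintro d hd hcd ⟨h1, h2⟩
        rcases eq_or_lt_of_le h1 with h1 | h1
        · obtain ⟨rfl, rfl⟩ := level_inj hj hq' hd h1
          rcases hcd with rfl | rfl
          · exact n2 rfl
          · exact hb1 rfl
        · refine hm ⟨a, d, hd, h1, h2, ?_⟩
          rcases hcd with rfl | rfl
          · exact .inl rfl
          · exact .inr rfl
      by_cases hc : c = j ∨ c = 2 * n - j
      · exact (edgeMap_V_out hj hc (by have := key c hc (.inl rfl); omega)).1
      by_cases hc' : c - 1 = j ∨ c - 1 = 2 * n - j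
      · have := (edgeMap_V_out (n := n) (D := D) (a := a) (p := p) (q := q) (p' := p') (q' := q')
          hj hc'
          (by have := key (c - 1) hc' (.inr (by omega)); omega)).2
        rwa [sub_add_cancel] at this
      · exact edgeMap_V_other (by omega)
    rwa [hV] at c2

/-- The two strands at the top of the ladder are those at its bottom. -/
theorem conn_chain (h : Flip n j p q p' q' D D') (hj : j < n) (s : Edge) (m : ℕ) :
    ∀ a c : ℤ, (c = j ∨ c = 2 * n - j) → level n a c = level n p q - 1 - m →
      level n p' q' ≤ level n a c →
      ((Conn n D s (V a c) ∧ Conn n D s (V a (c + 1))) ↔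
        (Conn n D s (H p q) ∧ Conn n D s (V p q))) := by
  have hm := mem_SY.1 h.mem
  induction m with
  | zero =>
    intro a c hc h1 h2
    obtain ⟨a', c', hc', h3, e1, e2⟩ := eq_up hj a hc
    obtain ⟨rfl, rfl⟩ := level_inj (a := a') (a' := p) hj hc' h.col (by simp at h1; omega)
    rw [← e1, ← e2]
    have hup : Conn n D (H a' (c' + 1)) (up n a' (c' + 1)) :=
      .of_link (.turn_up (by omega) (by omega) (by omega) (by omega) h.notMem)
    by_cases hx : (a', c') ∈ D
    · rw [← hup.right_iff, ← (Conn.cross_col hx).right_iff, ← (Conn.cross_row hx).right_iff]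
    · rw [← hup.right_iff, ← (Conn.turn_row h.mem hx).right_iff,
        ← (Conn.turn_up h.mem hx).right_iff]
      exact and_comm
  | succ m ih =>
    intro a c hc h1 h2
    obtain ⟨a', c', hc', h3, e1, e2⟩ := eq_up hj a hc
    push_cast at h1
    have hD := h.between a' c' hc' (by omega) (by omega)
    rw [← ih a' c' hc' (by omega) (by omega), ← e1, ← e2, ← (Conn.cross_col hD.1).right_iff,
      ← (Conn.cross_col hD.2).right_iff]
    exact and_comm

/-- `conn_chain` carries the two strands of the bottom rung up to the top rung. There the empty box
`(p',q')` turns one of them into the row, so both meet at `(p', q'+1)`. -/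
theorem isSelf_top_iff (h : Flip n j p q p' q' D D') (hj : j < n) (i : ℤ) :
    IsSelf n D i (p', q' + 1) ↔ IsSelf n D i (p, q) := by
  have h1 := h.lt
  have := h.conn_chain hj (sink n i) (level n p q - 1 - level n p' q').toNat p' q' h.col'
    (by omega) le_rfl
  rw [(Conn.turn_row h.mem' h.notMem').right_iff] at this
  exact this

theorem isSelf_bottom (h : Flip n j p q p' q' D D') (hj : j < n) {i : ℤ} (hi : 1 ≤ i)
    (hs : IsSelf n D i (p, q)) : IsSelf n D' i (p, q) := by
  have c1 := h.conn_sink hj hi hs.1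
  have c2 := h.conn_sink hj hi hs.2
  rw [edgeMap_H (by simp) h.ne] at c1
  rw [(edgeMap_V_out hj h.col (.inr le_rfl)).1] at c2
  exact ⟨c1, c2⟩

theorem wD_eq_of_lt (h : Flip n j p q p' q' D D') (hj : j < n) : wD n D = wD n D' := by
  refine wD_congr h.subset h.subset' (fun k i hi hki => ?_) (fun i hi hi' => ?_)
  · have := h.conn_edgeMap hj hki
    rwa [h.edgeMap_source, h.edgeMap_sink hi] at this
  · have hb : IsSelf n D' i (p, q) ↔ IsSelf n D i (p, q) :=
      ⟨h.symm.isSelf_bottom hj hi, h.isSelf_bottom hj hi⟩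
    exact h.even_iff ⟨hi, hi'⟩ (fun h' => h'.card_le hj hi) (fun _ => Iff.rfl)
      (fun _ => h.isSelf_top_iff hj i) (fun _ => hb)
      (fun _ => (h.symm.isSelf_top_iff hj i).trans hb)

/-! #### Ladders along the wall -/

theorem wall_lt (h : Flip n n p n p' n D D') : p' < p := by
  have := h.lt
  simp only [level, le_refl, if_true] at this
  omega

theorem wallMap_source (h : Flip n n p n p' n D D') {k : ℤ} :
    wallMap n p p' D (source n k) = source n k := by
  have := mem_SY.1 h.mem
  have := mem_SY.1 h.mem'
  exact wallMap_H (by omega)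

theorem wallMap_sink (h : Flip n n p n p' n D D') {i : ℤ} :
    wallMap n p p' D (sink n i) = sink n i := by
  have := mem_SY.1 h.mem
  have := mem_SY.1 h.mem'
  exact wallMap_V (by omega)

theorem conn_sink_wall (h : Flip n n p n p' n D D') {i : ℤ} {t : Edge}
    (hl : Conn n D (sink n i) t) : Conn n D' (sink n i) (wallMap n p p' D t) := by
  have := h.conn_wallMap hl
  rwa [h.wallMap_sink] at this

open Classical in
theorem card_le_wall (h : Flip n n p n p' n D D') {i : ℤ} :
    (((D.filter (IsSelf n D i)).erase (p, (n : ℤ))).erase (p', (n : ℤ) + 1)).card ≤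
      (((D'.filter (IsSelf n D' i)).erase (p, (n : ℤ))).erase (p', (n : ℤ) + 1)).card := by
  refine Finset.card_le_card fun b hb => ?_
  simp only [Finset.mem_erase, Finset.mem_filter] at hb ⊢
  obtain ⟨hb1, hb2, hb3, hb4, hb5⟩ := hb
  have n1 : b ≠ (p, (n : ℤ) + 1) := fun he => h.notMem (he ▸ hb3)
  have n2 : b ≠ (p', (n : ℤ)) := fun he => h.notMem' (he ▸ hb3)
  refine ⟨hb1, hb2, (h.other b hb2 hb1).1 hb3, ?_⟩
  obtain ⟨a, c⟩ := b
  have c1 := h.conn_sink_wall hb4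
  have c2 := h.conn_sink_wall hb5
  simp only [ne_eq, Prod.mk.injEq] at c1 c2 n1 n2 hb1 hb2
  rw [wallMap_H (by omega)] at c1
  rw [wallMap_V (by omega)] at c2
  exact ⟨c1, c2⟩

/-- The row strand through the crossing `(p,n)` reaches the wall, turns up in the empty box
`(p,n+1)` and crosses itself. Hence this crossing is always a self-crossing, of whichever pipe
passes here. -/
theorem isSelf_wall_bottom_iff (h : Flip n n p n p' n D D') (hx : (p, (n : ℤ)) ∈ D) (i : ℤ) :
    IsSelf n D i (p, (n : ℤ)) ↔ Conn n D (sink n i) (H p n) := by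
  have hm := mem_SY.1 h.mem
  have hup : Conn n D (H p (n + 1)) (up n p (n + 1)) :=
    .of_link (.turn_up (by omega) (by omega) (by omega) (by omega) h.notMem)
  rw [up_wall] at hup
  have := (Conn.cross_row (n := n) hx).trans hup
  exact ⟨fun h => h.1, fun h => ⟨h, h.trans this⟩⟩

theorem isSelf_wall_top_iff (h : Flip n n p n p' n D D') (hy : (p', (n : ℤ) + 1) ∈ D) (i : ℤ) :
    IsSelf n D i (p', (n : ℤ) + 1) ↔ Conn n D (sink n i) (V p' (n + 1)) := by
  have hup := Conn.cross_col (n := n) hy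
  rw [up_wall] at hup
  have := hup.trans (.turn_row h.mem' h.notMem')
  exact ⟨fun h => h.2, fun h => ⟨h.trans this, h⟩⟩

/-- One vertical strand climbs column `n` through all the crossings of the interior rungs, so the
kinks at both ends lie on the same pipe. -/
theorem conn_chain_wall (h : Flip n n p n p' n D D') (m : ℕ) :
    p' ≤ p - 1 - m → Conn n D (H p n) (V (p - 1 - m) (n + 1)) := by
  have hm := mem_SY.1 h.mem
  have hlt := h.wall_lt
  induction m with
  | zero =>
    intro _
    have e : V (p - 1 - (0 : ℕ)) ((n : ℤ) + 1) = up n p n := by rw [up_wall']; simp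
    rw [e]
    have hup : Conn n D (H p (n + 1)) (up n p (n + 1)) :=
      .of_link (.turn_up (by omega) (by omega) (by omega) (by omega) h.notMem)
    rw [up_wall] at hup
    by_cases hx : (p, (n : ℤ)) ∈ D
    · exact ((Conn.cross_row hx).trans hup).trans (.cross_col hx)
    · exact .turn_up h.mem hx
  | succ m ih =>
    intro hle
    push_cast at hle
    refine (ih (by omega)).trans ?_
    have hl : ∀ a : ℤ, level n a n = 2 * a - 1 := fun a => by simp [level]
    have hD := h.between (p - 1 - m) n (.inl rfl) (by rw [hl, hl]; omega) (by rw [hl, hl]; omega)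
    have h1 := Conn.cross_col (n := n) hD.2
    rw [up_wall] at h1
    have h2 := Conn.cross_col (n := n) hD.1
    rw [up_wall'] at h2
    convert h1.trans h2 using 2
    push_cast; ring

theorem conn_wall (h : Flip n n p n p' n D D') : Conn n D (H p n) (V p' (n + 1)) := by
  have hlt := h.wall_lt
  have := h.conn_chain_wall (p - 1 - p').toNat (by omega)
  rwa [show p - 1 - ((p - 1 - p').toNat : ℤ) = p' by omega] at this

theorem wD_eq_wall (h : Flip n n p n p' n D D') : wD n D = wD n D' := by
  refine wD_congr h.subset h.subset' (fun k i _ hki => ?_) (fun i hi hi' => ?_)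
  · have := h.conn_wallMap hki
    rwa [h.wallMap_source, h.wallMap_sink] at this
  · have key : ∀ {D D'}, Flip n n p n p' n D D' →
        Conn n D (sink n i) (H p n) → Conn n D' (sink n i) (H p n) := by
      intro D D' h hl
      have := h.conn_sink_wall hl
      rwa [wallMap_H (.inl (by omega))] at this
    have hb : Conn n D' (sink n i) (H p n) ↔ Conn n D (sink n i) (H p n) :=
      ⟨key h.symm, key h⟩
    refine h.even_iff ⟨hi, hi'⟩ (fun h' => h'.card_le_wall)
      (fun hx => h.isSelf_wall_bottom_iff hx i) (fun hy => ?_)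
      (fun hx => (h.symm.isSelf_wall_bottom_iff hx i).trans hb) (fun hy => ?_)
    · rw [h.isSelf_wall_top_iff hy, ← h.conn_wall.right_iff]
    · rw [h.symm.isSelf_wall_top_iff hy, ← h.symm.conn_wall.right_iff, hb]

/-- The exchange does not change the signed permutation. -/
theorem wD_eq (h : Flip n j p q p' q' D D') : wD n D = wD n D' := by
  rcases lt_or_eq_of_le h.j_le with hj | rfl
  · exact h.wD_eq_of_lt hj
  · obtain rfl : q = n := by have := h.col; omega
    obtain rfl : q' = n := by have := h.col'; omega
    exact h.wD_eq_wall

end Flip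
end SkewPipe

namespace SkewPipe

/-! ### The order of the boxes -/

theorem length_flatMap_range {α : Type*} (f : ℕ → List α) (hf : ∀ a, (f a).length = 2 * a + 1)
    (n : ℕ) : ((List.range n).flatMap f).length = n ^ 2 := by
  induction n with
  | zero => simp
  | succ n ih =>
    rw [List.range_succ, List.flatMap_append, List.length_append, ih, List.flatMap_singleton, hf]
    ring

theorem getElem?_flatMap_range {α : Type*} (f : ℕ → List α) (hf : ∀ a, (f a).length = 2 * a + 1)
    {n a b : ℕ} (ha : a < n) (hb : b < 2 * a + 1) :
    ((List.range n).flatMap f)[a ^ 2 + b]? = (f a)[b]? := by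
  induction n with
  | zero => omega
  | succ n ih =>
    rw [List.range_succ, List.flatMap_append, List.flatMap_singleton]
    rcases Nat.lt_succ_iff_lt_or_eq.1 ha with h | rfl
    · rw [List.getElem?_append_left, ih h]
      rw [length_flatMap_range f hf]
      nlinarith
    · rw [List.getElem?_append_right (by rw [length_flatMap_range f hf]; omega),
        length_flatMap_range f hf, Nat.add_sub_cancel_left]

theorem pq_eq {n a b : ℕ} (ha : a < n) (hb : b < 2 * a + 1) :
    pq n (a ^ 2 + b + 1) = ((n : ℤ) - a, (n : ℤ) + a - b) := by
  unfold pq boxList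
  rw [Nat.add_sub_cancel, List.getD_eq_getElem?_getD,
    getElem?_flatMap_range _ (by simp) ha hb]
  simp [hb, ← List.map_eq_flatMap]

theorem letter_eq {n a b : ℕ} (ha : a < n) (hb : b < 2 * a + 1) :
    letter n (a ^ 2 + b + 1) = ((a : ℤ) - b).natAbs + 1 := by
  unfold letter wordC
  rw [Nat.add_sub_cancel, List.getD_eq_getElem?_getD,
    getElem?_flatMap_range _ (by simp) ha hb]
  simp [hb, ← List.map_eq_flatMap]

theorem exists_row_col {n k : ℕ} (h1 : 1 ≤ k) (h2 : k ≤ n ^ 2) :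
    ∃ a b : ℕ, a < n ∧ b < 2 * a + 1 ∧ k = a ^ 2 + b + 1 := by
  refine ⟨Nat.sqrt (k - 1), k - 1 - Nat.sqrt (k - 1) ^ 2, ?_, ?_, ?_⟩
  · rw [Nat.sqrt_lt']; omega
  · have := Nat.sqrt_le_add (k - 1)
    have := Nat.sqrt_le' (k - 1)
    rw [sq] at *
    omega
  · have := Nat.sqrt_le' (k - 1)
    omega

/-- The position of the box `(p,q)` in the list of boxes. -/
def idx (n : ℕ) (b : ℤ × ℤ) : ℕ := ((n : ℤ) - b.1).toNat ^ 2 + (2 * n - b.1 - b.2).toNat + 1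

theorem one_le_idx {n : ℕ} (b : ℤ × ℤ) : 1 ≤ idx n b := Nat.le_add_left _ _

theorem idx_spec {n : ℕ} {b : ℤ × ℤ} (h : b ∈ SY n) : idx n b ≤ n ^ 2 ∧ pq n (idx n b) = b := by
  obtain ⟨p, q⟩ := b
  have := mem_SY.1 h
  obtain ⟨a, ha⟩ : ∃ a : ℕ, (n : ℤ) - p = a := ⟨((n : ℤ) - p).toNat, by omega⟩
  obtain ⟨b, hb⟩ : ∃ b : ℕ, 2 * (n : ℤ) - p - q = b := ⟨(2 * (n : ℤ) - p - q).toNat, by omega⟩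
  have e : idx n (p, q) = a ^ 2 + b + 1 := by
    simp only [idx, ha, hb, Int.toNat_natCast]
  rw [e]
  refine ⟨?_, ?_⟩
  · have h1 : a + 1 ≤ n := by omega
    have h2 : b ≤ 2 * a := by omega
    nlinarith
  · rw [pq_eq (by omega) (by omega), Prod.mk.injEq]
    omega

theorem pq_spec {n k : ℕ} (h1 : 1 ≤ k) (h2 : k ≤ n ^ 2) :
    pq n k ∈ SY n ∧ idx n (pq n k) = k ∧ letter n k = ((pq n k).2 - n).natAbs + 1 := by
  obtain ⟨a, b, ha, hb, rfl⟩ := exists_row_col h1 h2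
  rw [pq_eq ha hb, letter_eq ha hb]
  refine ⟨mem_SY.2 (by omega), ?_, ?_⟩
  · simp only [idx]
    rw [show (n : ℤ) - (n - a) = a by ring, show 2 * (n : ℤ) - (n - a) - (n + a - b) = b by ring]
    simp
  · simp only
    omega

theorem idx_lt_of {n : ℕ} {p q p' q' : ℤ} (h : (p, q) ∈ SY n) (h' : (p', q') ∈ SY n)
    (hlt : p' < p ∨ (p = p' ∧ q' < q)) : idx n (p, q) < idx n (p', q') := by
  rw [mem_SY] at h h'
  simp only [idx]
  rcases hlt with hlt | ⟨rfl, hlt⟩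
  · obtain ⟨a, ha⟩ : ∃ a : ℕ, (n : ℤ) - p = a := ⟨((n : ℤ) - p).toNat, by omega⟩
    obtain ⟨a', ha'⟩ : ∃ a : ℕ, (n : ℤ) - p' = a := ⟨((n : ℤ) - p').toNat, by omega⟩
    rw [ha, ha', Int.toNat_natCast, Int.toNat_natCast]
    have h1 : (2 * (n : ℤ) - p - q).toNat ≤ 2 * a := by omega
    have h2 : a + 1 ≤ a' := by omega
    nlinarith
  · omega

theorem idx_lt_iff {n : ℕ} {p q p' q' : ℤ} (h : (p, q) ∈ SY n) (h' : (p', q') ∈ SY n) :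
    idx n (p, q) < idx n (p', q') ↔ p' < p ∨ (p = p' ∧ q' < q) := by
  refine ⟨fun hlt => ?_, idx_lt_of h h'⟩
  by_contra hcon
  rcases (by omega : (p < p' ∨ (p' = p ∧ q < q')) ∨ (p = p' ∧ q = q')) with h1 | ⟨rfl, rfl⟩
  · have := idx_lt_of h' h h1
    omega
  · omega

/-- Rows are listed from bottom to top and from right to left, so the right half of a row, which is
its even row in `S̃Y_n`, precedes the left half. Along a ladder the order of the list is therefore
the order of decreasing level. -/
theorem idx_lt_iff_level {n : ℕ} {j p q p' q' : ℤ} (hj : j ≤ n) (h : (p, q) ∈ SY n)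
    (h' : (p', q') ∈ SY n) (hq : q = j ∨ q = 2 * n - j) (hq' : q' = j ∨ q' = 2 * n - j) :
    idx n (p, q) < idx n (p', q') ↔ level n p' q' < level n p q := by
  rw [idx_lt_iff h h']
  simp only [level]
  split_ifs <;> omega

/-! ### Ladder moves and exchanges -/

theorem mem_SY_of_level {n : ℕ} {j p q p' q' a c : ℤ} (hj : j ≤ n) (h : (p, q) ∈ SY n)
    (h' : (p', q') ∈ SY n) (hq : q = j ∨ q = 2 * n - j) (hc : c = j ∨ c = 2 * n - j)
    (h1 : level n p' q' < level n a c) (h2 : level n a c < level n p q) : (a, c) ∈ SY n := by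
  rw [mem_SY] at *
  simp only [level] at h1 h2
  split_ifs at h1 h2 <;> omega

theorem LadderMove.flip {n : ℕ} {i j : ℤ} {D D' : Finset (ℤ × ℤ)} (hD : D ⊆ SY n)
    (h : LadderMove n i j D D') : D' ⊆ SY n ∧ D'.card = D.card ∧ wD n D = wD n D' := by
  obtain ⟨k, hk1, hk2, hk, hx, hx1, l, hl1, hl2, hq, hF, hG, hmid, rfl⟩ := h
  have hlS := pq_spec (by omega : 1 ≤ l) hl2
  have hkS := pq_spec hk1 hk2
  generalize pq n l = b at *
  obtain ⟨p', q'⟩ := b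
  rw [hk] at hkS
  simp only [Finset.mem_sdiff] at hF hG hq
  have hne : (p', q' + 1) ≠ (i, j) := by
    simp only [ne_eq, Prod.mk.injEq]; omega
  have hsub : (D ∪ {(p', q' + 1)}) \ {(i, j)} ⊆ SY n := by
    intro b hb
    simp only [Finset.mem_sdiff, Finset.mem_union, Finset.mem_singleton] at hb
    rcases hb.1 with h | rfl
    · exact hD h
    · exact hG.1
  refine ⟨hsub, ?_, ?_⟩
  · rw [Finset.sdiff_singleton_eq_erase, Finset.card_erase_of_mem (by simp [hx]),
      Finset.union_comm, ← Finset.insert_eq, Finset.card_insert_of_notMem hG.2]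
    omega
  -- The ladder of `j` is also that of `2n-j`; `J` is the smaller of the two.
  · obtain ⟨J, hJ, hjJ⟩ : ∃ J : ℤ, J ≤ n ∧ ((j = J ∧ 2 * n - j = 2 * n - J) ∨
        (j = 2 * n - J ∧ 2 * n - j = J)) := by
      by_cases h : j ≤ n
      · exact ⟨j, h, .inl ⟨rfl, rfl⟩⟩
      · exact ⟨2 * n - j, by omega, .inr ⟨by omega, rfl⟩⟩
    have hjJ' : j = J ∨ j = 2 * n - J := by omega
    have hqJ' : q' = J ∨ q' = 2 * n - J := by omega
    have hlt := (idx_lt_iff_level hJ hkS.1 hlS.1 hjJ' hqJ').1 (by omega)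
    refine Flip.wD_eq (j := J) (p := i) (q := j) (p' := p') (q' := q') ⟨hJ, hjJ', hqJ', hlt, hkS.1,
      hF.1, hG.1, hD, hsub, hx1, hF.2, ?_, ?_, ?_, ?_⟩
    · intro a c hc h1 h2
      have hac := mem_SY_of_level hJ hkS.1 hlS.1 hjJ' hc h1 h2
      have hs := idx_spec hac
      have := hmid (idx n (a, c))
        (by have := (idx_lt_iff_level hJ hkS.1 hac hjJ' hc).2 h2; omega)
        (by have := (idx_lt_iff_level hJ hac hlS.1 hc hqJ').2 h1; omega)
      rw [hs.2] at this
      exact this (by simp only; omega)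
    · intro b hb1 hb2
      simp [hb1, hb2]
    · simp [hx]
    · simp [hG.2, hne]

/-- Every row of `D` is an initial segment of the row of `SY_n`. -/
def LeftJustified (n : ℕ) (D : Finset (ℤ × ℤ)) : Prop :=
  ∀ p q : ℤ, (p, q) ∈ SY n → (p, q + 1) ∈ D → (p, q) ∈ D

/-- The lowest ladder of `D` that can be shortened. -/
theorem exists_ladder {n : ℕ} {D : Finset (ℤ × ℤ)} (hD : D ⊆ SY n) (h : ¬ LeftJustified n D) :
    ∃ J p q p' q' : ℤ, J ≤ n ∧ (q = J ∨ q = 2 * n - J) ∧ (q' = J ∨ q' = 2 * n - J) ∧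
      level n p' q' < level n p q ∧ (p, q) ∈ SY n ∧ (p', q') ∈ SY n ∧ (p, q + 1) ∉ D ∧
      (p', q') ∉ D ∧ (p', q' + 1) ∈ D ∧
      ∀ a c : ℤ, (c = J ∨ c = 2 * n - J) → level n p' q' < level n a c →
        level n a c < level n p q → (a, c) ∈ D ∧ (a, c + 1) ∈ D := by
  classical
  simp only [LeftJustified, not_forall] at h
  obtain ⟨p₀, q₀, h1, h2, h3⟩ := h
  -- The top rung is the first place in the list where a row fails to be an initial segment.
  obtain ⟨⟨p', q'⟩, hy, hmin⟩ := Finset.exists_min_image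
    ((SY n).filter fun b => (b.1, b.2 + 1) ∈ D ∧ b ∉ D) (idx n)
    ⟨(p₀, q₀), Finset.mem_filter.2 ⟨h1, h2, h3⟩⟩
  simp only [Finset.mem_filter, and_imp, Prod.forall] at hy hmin
  obtain ⟨hy1, hy2, hy3⟩ := hy
  obtain ⟨J, hJ, hqJ⟩ : ∃ J : ℤ, J ≤ n ∧ (q' = J ∨ q' = 2 * n - J) := by
    by_cases h : q' ≤ n
    · exact ⟨q', h, .inl rfl⟩
    · exact ⟨2 * n - q', by omega, by omega⟩
  have hyS := mem_SY.1 hy1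
  have hyS' := mem_SY.1 (hD hy2)
  have hbase : (J, 2 * n - J) ∈ SY n := mem_SY.2 (by omega)
  -- The bottom rung is the nearest rung below that is not full. One exists because the lowest rung
  -- `(J, 2n-J)` has its right box outside `SY_n`. If the right box of the chosen rung were in `D`,
  -- its left box would be missing, an earlier violation.
  obtain ⟨⟨p, q⟩, hx, hmax⟩ := Finset.exists_max_image
    ((SY n).filter fun b => (b.2 = J ∨ b.2 = 2 * n - J) ∧ idx n b < idx n (p', q') ∧
      ¬ (b ∈ D ∧ (b.1, b.2 + 1) ∈ D)) (idx n)
    ⟨(J, 2 * n - J), Finset.mem_filter.2 ⟨hbase, .inr rfl,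
      (idx_lt_iff hbase hy1).2 (by omega), fun h => by
        have := mem_SY.1 (hD h.2); omega⟩⟩
  simp only [Finset.mem_filter, and_imp, Prod.forall] at hx hmax
  obtain ⟨hx1, hx2, hx3, hx4⟩ := hx
  have hlt := (idx_lt_iff_level hJ hx1 hy1 hx2 hqJ).1 hx3
  refine ⟨J, p, q, p', q', hJ, hx2, hqJ, hlt, hx1, hy1, fun hx5 => ?_, hy3, hy2, ?_⟩
  · have := hmin p q hx1 hx5 (fun h => hx4 ⟨h, hx5⟩)
    omega
  · intro a c hc h1 h2
    by_contra hcon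
    have hac := mem_SY_of_level hJ hx1 hy1 hx2 hc h1 h2
    have h3 := (idx_lt_iff_level hJ hac hy1 hc hqJ).2 h1
    have h4 := (idx_lt_iff_level hJ hx1 hac hx2 hc).2 h2
    have := hmax a c hac hc h3 hcon
    omega

/-- Each toggle replaces a crossing by one earlier in the list, or deletes two. Positions start at
`1`, so their sum is a strictly decreasing measure. -/
theorem exists_leftJustified (n : ℕ) (m : ℕ) : ∀ D : Finset (ℤ × ℤ), D ⊆ SY n →
    ∑ b ∈ D, idx n b ≤ m → ∃ E, E ⊆ SY n ∧ LeftJustified n E ∧ wD n E = wD n D ∧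
      E.card ≤ D.card ∧ (E.card = D.card → D ∈ ladderSet n E) := by
  induction m with
  | zero =>
    intro D hD hm
    refine ⟨D, hD, fun p q _ h => ?_, rfl, le_rfl, fun _ => .refl⟩
    have := Finset.single_le_sum (f := idx n) (fun _ _ => Nat.zero_le _) h
    have := one_le_idx (n := n) (p, q + 1)
    omega
  | succ m ih =>
    intro D hD hm
    by_cases hLJ : LeftJustified n D
    · exact ⟨D, hD, hLJ, rfl, le_rfl, fun _ => .refl⟩
    obtain ⟨J, p, q, p', q', hJ, hq, hq', hlt, hx, hy, hx1, hy1, hy2, hmid⟩ := exists_ladder hD hLJ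
    have hne : (p, q) ≠ (p', q' + 1) := by
      simp only [ne_eq, Prod.mk.injEq]; omega
    have hne1 : (p, q + 1) ≠ (p', q' + 1) := fun h => hx1 (h ▸ hy2)
    have hidx : idx n (p, q) < idx n (p', q' + 1) := by
      have := (idx_lt_iff hx hy).1 ((idx_lt_iff_level hJ hx hy hq hq').2 hlt)
      rw [idx_lt_iff hx (hD hy2)]
      omega
    have hsum := Finset.add_sum_erase D (idx n) hy2
    have hcard := Finset.card_erase_add_one hy2
    by_cases hxD : (p, q) ∈ D
    -- Both ends are crossings. Deleting them keeps `w_D` but loses two crossings, so the hypothesis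
    -- of the last clause fails.
    · set D' := (D.erase (p', q' + 1)).erase (p, q) with hD'
      have hxe : (p, q) ∈ D.erase (p', q' + 1) := Finset.mem_erase.2 ⟨hne, hxD⟩
      have hsub : D' ⊆ SY n := fun b hb =>
        hD (Finset.mem_of_mem_erase (Finset.mem_of_mem_erase hb))
      have hflip : Flip n J p q p' q' D D' := by
        refine ⟨hJ, hq, hq', hlt, hx, hy, hD hy2, hD, hsub, hx1, hy1, hmid, ?_, ?_, ?_⟩
        · intro b h1 h2
          simp [hD', h1, h2]
        · simp [hD', hxD]
        · simp [hD', hy2]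
      have hsum' := Finset.add_sum_erase _ (idx n) hxe
      have hcard' := Finset.card_erase_add_one hxe
      rw [← hD'] at hsum' hcard'
      have := one_le_idx (n := n) (p, q)
      obtain ⟨E, hE1, hE2, hE3, hE4, hE5⟩ := ih D' hsub (by omega)
      exact ⟨E, hE1, hE2, hE3.trans hflip.wD_eq.symm, by omega, fun h => by omega⟩
    -- Only the top end is a crossing. Moving it down is the inverse of a ladder move, and `hmove`
    -- recovers `D` from `D'`.
    · set D' := insert (p, q) (D.erase (p', q' + 1)) with hD'
      have hxe : (p, q) ∉ D.erase (p', q' + 1) := fun h => hxD (Finset.mem_of_mem_erase h)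
      have hsub : D' ⊆ SY n := by
        intro b hb
        rcases Finset.mem_insert.1 hb with rfl | hb
        · exact hx
        · exact hD (Finset.mem_of_mem_erase hb)
      have hflip : Flip n J p q p' q' D D' := by
        refine ⟨hJ, hq, hq', hlt, hx, hy, hD hy2, hD, hsub, hx1, hy1, hmid, ?_, ?_, ?_⟩
        · intro b h1 h2
          simp [hD', h1, h2]
        · simp [hD', hxD]
        · simp [hD', hy2, hne.symm]
      have hsum' := Finset.sum_insert (f := idx n) hxe
      have hcard' := Finset.card_insert_of_notMem hxe
      rw [← hD'] at hsum' hcard'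
      have hmove : LadderMove n p q D' D := by
        have hxs := idx_spec hx
        have hys := idx_spec hy
        have hs := hflip.symm
        refine ⟨idx n (p, q), one_le_idx _, hxs.1, hxs.2, by simp [hD'], hs.notMem, idx n (p', q'),
          (idx_lt_iff_level hJ hx hy hq hq').2 hlt, hys.1, ?_⟩
        rw [hys.2]
        refine ⟨by simp only; omega, Finset.mem_sdiff.2 ⟨hy, hs.notMem'⟩,
          Finset.mem_sdiff.2 ⟨hD hy2, by simp [hD', hne.symm]⟩, ?_, ?_⟩
        · intro r hr1 hr2 hr3
          have hr := pq_spec (n := n) (k := r) (by omega) (by omega)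
          generalize pq n r = b at *
          obtain ⟨a, c⟩ := b
          simp only at hr3
          have hc : c = J ∨ c = 2 * n - J := by omega
          refine hs.between a c hc ?_ ?_
          · rw [← idx_lt_iff_level hJ hr.1 hy hc hq']; omega
          · rw [← idx_lt_iff_level hJ hx hr.1 hq hc]; omega
        · ext b
          simp only [hD', Finset.mem_sdiff, Finset.mem_union, Finset.mem_insert, Finset.mem_erase,
            Finset.mem_singleton]
          by_cases h1 : b = (p, q)
          · simp [h1, hxD]
          · by_cases h2 : b = (p', q' + 1)
            · simp [h2, hy2, hne.symm]
            · simp [h1, h2]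
      obtain ⟨E, hE1, hE2, hE3, hE4, hE5⟩ := ih D' hsub (by omega)
      exact ⟨E, hE1, hE2, hE3.trans hflip.wD_eq.symm, by omega,
        fun h => (hE5 (by omega)).tail ⟨p, q, hmove⟩⟩

end SkewPipe

namespace SkewPipe

/-! ### Length and inversions -/

section SignedPerm

variable {n m : ℕ} {w : Equiv.Perm ℤ}

theorem W_neg (hw : w ∈ W n) (i : ℤ) : w (-i) = -w i := hw.1 i

theorem W_fix (hw : w ∈ W n) {i : ℤ} (hi : (n : ℤ) < |i|) : w i = i := hw.2 i hi

theorem W_zero (hw : w ∈ W n) : w 0 = 0 := by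
  have := W_neg hw 0
  rw [neg_zero] at this
  omega

theorem W_abs_le (hw : w ∈ W n) {i : ℤ} (hi : |i| ≤ n) : |w i| ≤ n := by
  by_contra h
  have := W_fix hw (not_le.1 h)
  rw [w.injective this] at h
  exact h hi

theorem W_ne_zero (hw : w ∈ W n) {i : ℤ} (hi : i ≠ 0) : w i ≠ 0 := by
  intro h
  rw [← W_zero hw] at h
  exact hi (w.injective h)

theorem W_mono (h : m ≤ n) (hw : w ∈ W m) : w ∈ W n :=
  ⟨hw.1, fun i hi => hw.2 i (by omega)⟩

theorem s_one_apply (i : ℤ) : s 1 i = if i = 1 then -1 else if i = -1 then 1 else i := by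
  simp [s, Equiv.swap_apply_def]

theorem s_apply {k : ℕ} (hk : 2 ≤ k) (i : ℤ) : s k i =
    if i = k - 1 then (k : ℤ) else if i = k then k - 1 else
    if i = -(k - 1) then -k else if i = -k then -(k - 1) else i := by
  simp only [s, if_neg (show k ≠ 1 by omega), Equiv.Perm.mul_apply, Equiv.swap_apply_def]
  split_ifs <;> omega

theorem s_mem_W {k : ℕ} (hk : 1 ≤ k) (hkn : k ≤ n) : s k ∈ W n := by
  rcases eq_or_lt_of_le hk with rfl | hk
  · refine ⟨fun i => ?_, fun i hi => ?_⟩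
    · rw [s_one_apply, s_one_apply]; split_ifs <;> omega
    · rw [s_one_apply]
      rw [lt_abs] at hi
      split_ifs <;> omega
  · refine ⟨fun i => ?_, fun i hi => ?_⟩
    · rw [s_apply hk, s_apply hk]; split_ifs <;> omega
    · rw [s_apply hk]
      rw [lt_abs] at hi
      split_ifs <;> omega

theorem s_mul_self {k : ℕ} (hk : 1 ≤ k) : s k * s k = 1 := by
  ext i
  rw [Equiv.Perm.mul_apply, Equiv.Perm.one_apply]
  rcases eq_or_lt_of_le hk with rfl | hk
  · generalize h : s 1 i = x
    rw [s_one_apply] at h ⊢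
    split_ifs at h ⊢ <;> omega
  · generalize h : s k i = x
    rw [s_apply hk] at h ⊢
    split_ifs at h ⊢ <;> omega

/-- The pairs `(i,j)` indexing the positive roots. -/
noncomputable def rootPairs (n : ℕ) : Finset (ℤ × ℤ) :=
  (Finset.Icc (-n : ℤ) n ×ˢ Finset.Icc (1 : ℤ) n).filter fun b => b.1 ≠ 0 ∧ -b.2 ≤ b.1 ∧ b.1 < b.2

theorem mem_rootPairs {i j : ℤ} :
    (i, j) ∈ rootPairs n ↔ 1 ≤ j ∧ j ≤ n ∧ i ≠ 0 ∧ -j ≤ i ∧ i < j := by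
  simp only [rootPairs, Finset.mem_filter, Finset.mem_product, Finset.mem_Icc]
  omega

/-- The number of inversions of a signed permutation. -/
noncomputable def inv (n : ℕ) (w : Equiv.Perm ℤ) : ℕ :=
  ((rootPairs n).filter fun b => w b.2 < w b.1).card

/-- The index pair of the simple root `k`. -/
def simplePair (k : ℕ) : ℤ × ℤ := if k = 1 then (-1, 1) else ((k : ℤ) - 1, (k : ℤ))

theorem simplePair_one : simplePair 1 = (-1, 1) := rfl

theorem simplePair_of_two_le {k : ℕ} (hk : 2 ≤ k) : simplePair k = ((k : ℤ) - 1, (k : ℤ)) := by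
  rw [simplePair, if_neg (by omega)]

theorem simplePair_mem {k : ℕ} (hk : 1 ≤ k) (hkn : k ≤ n) : simplePair k ∈ rootPairs n := by
  rcases eq_or_lt_of_le hk with rfl | hk
  · rw [simplePair_one, mem_rootPairs]; omega
  · rw [simplePair_of_two_le hk, mem_rootPairs]; omega

theorem s_simplePair {k : ℕ} (hk : 1 ≤ k) :
    s k (simplePair k).1 = (simplePair k).2 ∧ s k (simplePair k).2 = (simplePair k).1 := by
  rcases eq_or_lt_of_le hk with rfl | hk
  · simp [simplePair_one, s_one_apply]
  · simp [simplePair_of_two_le hk, s_apply hk]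

/-- A simple reflection permutes the positive roots other than its own simple root, and it carries
inversions of `w * s k` to inversions of `w`. -/
theorem inv_erase_le (hw : w ∈ W n) {k : ℕ} (hk : 1 ≤ k) (hkn : k ≤ n) :
    (((rootPairs n).filter fun b => (w * s k) b.2 < (w * s k) b.1).erase (simplePair k)).card ≤
      (((rootPairs n).filter fun b => w b.2 < w b.1).erase (simplePair k)).card := by
  rcases eq_or_lt_of_le hk with rfl | hk
  · refine Finset.card_le_card_of_injOn (fun b => (s 1 b.1, s 1 b.2)) ?_ ?_
    · rintro ⟨i, j⟩ hb
      rw [Finset.mem_coe, Finset.mem_erase, Finset.mem_filter, mem_rootPairs, simplePair_one, ne_eq,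
        Prod.mk.injEq] at hb
      rw [Finset.mem_coe, Finset.mem_erase, Finset.mem_filter, mem_rootPairs, simplePair_one, ne_eq,
        Prod.mk.injEq]
      have hi := s_one_apply i
      have hj := s_one_apply j
      refine ⟨?_, ?_, hb.2.2⟩ <;> dsimp only
      · split_ifs at hi hj <;> omega
      · split_ifs at hi hj <;> omega
    · rintro ⟨i, j⟩ _ ⟨i', j'⟩ _ h
      simp only [Prod.mk.injEq] at h ⊢
      exact ⟨(s 1).injective h.1, (s 1).injective h.2⟩
  -- The pair `(-(k-1), k)` represents the root `e_{k-1} + e_k`, which is fixed. Applying `s k` to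
  -- its entries would give the other representative `(-k, k-1)`, which is not listed in
  -- `rootPairs`.
  · set f : ℤ × ℤ → ℤ × ℤ := fun b => if b = (-((k : ℤ) - 1), (k : ℤ)) then b
      else (s k b.1, s k b.2) with hf
    have hf1 : f (-((k : ℤ) - 1), (k : ℤ)) = (-((k : ℤ) - 1), (k : ℤ)) := by simp [hf]
    have hf2 : ∀ i j : ℤ, (i, j) ≠ (-((k : ℤ) - 1), (k : ℤ)) → f (i, j) = (s k i, s k j) := by
      intro i j h
      simp only [hf, if_neg h]
    refine Finset.card_le_card_of_injOn f ?_ ?_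
    · rintro ⟨i, j⟩ hb
      rw [Finset.mem_coe, Finset.mem_erase, Finset.mem_filter] at hb ⊢
      by_cases h : (i, j) = (-((k : ℤ) - 1), (k : ℤ))
      · rw [h] at hb ⊢
        rw [hf1]
        refine ⟨hb.1, hb.2.1, ?_⟩
        have h1 := hb.2.2
        have e1 : s k (k : ℤ) = k - 1 := by rw [s_apply hk]; split_ifs <;> omega
        have e2 : s k (-((k : ℤ) - 1)) = -k := by rw [s_apply hk]; split_ifs <;> omega
        simp only [Equiv.Perm.mul_apply] at h1 ⊢
        rw [e1, e2, W_neg hw] at h1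
        rw [W_neg hw]
        omega
      · rw [hf2 i j h]
        rw [mem_rootPairs, simplePair_of_two_le hk, ne_eq, Prod.mk.injEq] at hb
        rw [mem_rootPairs, simplePair_of_two_le hk, ne_eq, Prod.mk.injEq]
        rw [Prod.mk.injEq] at h
        have hi := s_apply hk i
        have hj := s_apply hk j
        refine ⟨?_, ?_, hb.2.2⟩
        · split_ifs at hi hj <;> omega
        · split_ifs at hi hj <;> omega
    · have key : ∀ i j : ℤ, (i, j) ∈ rootPairs n → (i, j) ≠ (-((k : ℤ) - 1), (k : ℤ)) →
          (s k i, s k j) ≠ (-((k : ℤ) - 1), (k : ℤ)) := by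
        intro i j h h'
        rw [mem_rootPairs] at h
        simp only [ne_eq, Prod.mk.injEq] at h' ⊢
        have hi := s_apply hk i
        have hj := s_apply hk j
        split_ifs at hi hj <;> omega
      rintro ⟨i, j⟩ hb ⟨i', j'⟩ hb' he
      have hb1 := (Finset.mem_filter.1 (Finset.mem_of_mem_erase hb)).1
      have hb1' := (Finset.mem_filter.1 (Finset.mem_of_mem_erase hb')).1
      by_cases h : (i, j) = (-((k : ℤ) - 1), (k : ℤ)) <;>
        by_cases h' : (i', j') = (-((k : ℤ) - 1), (k : ℤ))
      · rw [h, h']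
      · rw [h, hf1, hf2 _ _ h'] at he
        exact absurd he.symm (key _ _ hb1' h')
      · rw [h', hf1, hf2 _ _ h] at he
        exact absurd he (key _ _ hb1 h)
      · rw [hf2 _ _ h, hf2 _ _ h'] at he
        simp only [Prod.mk.injEq] at he ⊢
        exact ⟨(s k).injective he.1, (s k).injective he.2⟩

theorem inv_erase_eq (hw : w ∈ W n) {k : ℕ} (hk : 1 ≤ k) (hkn : k ≤ n) :
    (((rootPairs n).filter fun b => (w * s k) b.2 < (w * s k) b.1).erase (simplePair k)).card =
      (((rootPairs n).filter fun b => w b.2 < w b.1).erase (simplePair k)).card := by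
  refine le_antisymm (inv_erase_le hw hk hkn) ?_
  have := inv_erase_le ((W n).mul_mem hw (s_mem_W hk hkn)) hk hkn
  rwa [mul_assoc, s_mul_self hk, mul_one] at this

theorem inv_mul_s (hw : w ∈ W n) {k : ℕ} (hk : 1 ≤ k) (hkn : k ≤ n)
    (h : w (simplePair k).1 < w (simplePair k).2) : inv n (w * s k) = inv n w + 1 := by
  have h1 := inv_erase_eq hw hk hkn
  rw [Finset.card_erase_of_mem, Finset.erase_eq_of_notMem] at h1
  · have : simplePair k ∈ (rootPairs n).filter fun b => (w * s k) b.2 < (w * s k) b.1 := by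
      rw [Finset.mem_filter, Equiv.Perm.mul_apply, Equiv.Perm.mul_apply, (s_simplePair hk).1,
        (s_simplePair hk).2]
      exact ⟨simplePair_mem hk hkn, h⟩
    have := Finset.card_pos.2 ⟨_, this⟩
    simp only [inv]
    omega
  · rw [Finset.mem_filter]
    intro h'
    omega
  · rw [Finset.mem_filter, Equiv.Perm.mul_apply, Equiv.Perm.mul_apply, (s_simplePair hk).1,
      (s_simplePair hk).2]
    exact ⟨simplePair_mem hk hkn, h⟩

theorem inv_mul_s_le (hw : w ∈ W n) {k : ℕ} (hk : 1 ≤ k) (hkn : k ≤ n) :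
    inv n (w * s k) ≤ inv n w + 1 := by
  have h1 := inv_erase_eq hw hk hkn
  have h2 := Finset.pred_card_le_card_erase (a := simplePair k)
    (s := (rootPairs n).filter fun b => (w * s k) b.2 < (w * s k) b.1)
  have h3 := Finset.card_erase_le (a := simplePair k)
    (s := (rootPairs n).filter fun b => w b.2 < w b.1)
  simp only [inv]
  omega

theorem inv_one : inv n 1 = 0 := by
  rw [inv, Finset.card_eq_zero, Finset.filter_eq_empty_iff]
  rintro ⟨i, j⟩ h
  rw [mem_rootPairs] at h
  simp only [Equiv.Perm.one_apply]
  omega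

theorem prod_mem_W {l : List ℕ} (hl : ∀ k ∈ l, 1 ≤ k ∧ k ≤ n) : (l.map s).prod ∈ W n := by
  refine Subgroup.list_prod_mem _ fun x hx => ?_
  obtain ⟨k, hk, rfl⟩ := List.mem_map.1 hx
  exact s_mem_W (hl k hk).1 (hl k hk).2

theorem inv_prod_le (l : List ℕ) (hl : ∀ k ∈ l, 1 ≤ k ∧ k ≤ n) :
    inv n (l.map s).prod ≤ l.length := by
  induction l using List.reverseRecOn with
  | nil => simp [inv_one]
  | append_singleton l k ih =>
    rw [List.map_append, List.prod_append, List.map_singleton, List.prod_singleton,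
      List.length_append, List.length_singleton]
    have hl' : ∀ k ∈ l, 1 ≤ k ∧ k ≤ n := fun k hk => hl k (by simp [hk])
    have hk := hl k (by simp)
    exact (inv_mul_s_le (prod_mem_W hl') hk.1 hk.2).trans (by have := ih hl'; omega)

theorem len_le {l : List ℕ} (h : IsWord n l w) : len n w ≤ l.length :=
  Nat.sInf_le ⟨l, rfl, h⟩

/-- The length is the number of inversions as soon as some word attains it. -/
theorem len_eq_of_word {l : List ℕ} (h : IsWord n l w) (hl : l.length = inv n w) :
    len n w = inv n w := by
  refine le_antisymm (hl ▸ len_le h) ?_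
  obtain ⟨l', hl', hw⟩ := Nat.sInf_mem (⟨_, l, rfl, h⟩ : {r | ∃ l : List ℕ, l.length = r ∧
    IsWord n l w}.Nonempty)
  change l'.length = len n w at hl'
  rw [← hl', ← hw.2]
  exact inv_prod_le l' hw.1

/-! ### The canonical factorization -/

/-- The first `t` letters of the word `a+1, a, …, 1, …, a, a+1`. -/
def rowWord (a t : ℕ) : List ℕ := (List.range t).map fun b => ((a : ℤ) - (b : ℕ)).natAbs + 1

/-- The product of the first `t` letters of `a+1, a, …, 1, …, a, a+1`. -/
def rowPerm (a t : ℕ) : Equiv.Perm ℤ := ((rowWord a t).map s).prod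

/-- The preimage of `a+1` under `rowPerm a t`. -/
def theta (a t : ℕ) : ℤ := if t ≤ a then a + 1 - t else a - t

theorem rowWord_succ (a t : ℕ) : rowWord a (t + 1) = rowWord a t ++ [((a : ℤ) - t).natAbs + 1] := by
  simp [rowWord, List.range_succ]

theorem rowPerm_succ (a t : ℕ) :
    rowPerm a (t + 1) = rowPerm a t * s (((a : ℤ) - t).natAbs + 1) := by
  rw [rowPerm, rowWord_succ]
  simp [rowPerm]

theorem mem_rowWord {a t k : ℕ} (ht : t ≤ 2 * a + 1) (hk : k ∈ rowWord a t) : 1 ≤ k ∧ k ≤ a + 1 := by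
  simp only [rowWord, List.mem_map, List.mem_range] at hk
  obtain ⟨b, hb, rfl⟩ := hk
  omega

theorem rowPerm_mem {a t : ℕ} (ht : t ≤ 2 * a + 1) : rowPerm a t ∈ W (a + 1) :=
  prod_mem_W fun _ hk => mem_rowWord ht hk

theorem rowPerm_spec {a t : ℕ} (ht : t ≤ 2 * a + 1) :
    rowPerm a t (theta a t) = a + 1 ∧
      (∀ j : ℤ, 1 ≤ j → j < |theta a t| → rowPerm a t j = j) ∧
      (∀ j : ℤ, |theta a t| < j → j ≤ a + 1 → rowPerm a t j = j - 1) := by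
  induction t with
  | zero =>
    have e : theta a 0 = a + 1 := by simp [theta]
    have e1 : rowPerm a 0 = 1 := by simp [rowPerm, rowWord]
    have e2 : |(a : ℤ) + 1| = a + 1 := abs_of_pos (by omega)
    rw [e, e1, e2]
    refine ⟨rfl, fun _ _ _ => rfl, fun j h1 h2 => by omega⟩
  | succ t ih =>
    obtain ⟨h1, h2, h3⟩ := ih (by omega)
    have hneg := fun i => W_neg (rowPerm_mem (a := a) (t := t) (by omega)) i
    rw [rowPerm_succ]
    simp only [Equiv.Perm.mul_apply]
    rcases lt_trichotomy t a with hta | rfl | hta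
    · have e1 : theta a t = a + 1 - t := by rw [theta, if_pos (by omega)]
      have e2 : theta a (t + 1) = a - t := by rw [theta, if_pos (by omega)]; push_cast; ring
      have a1 : |(a : ℤ) + 1 - t| = a + 1 - t := abs_of_pos (by omega)
      have a2 : |(a : ℤ) - t| = a - t := abs_of_pos (by omega)
      rw [e1] at h1
      rw [e1, a1] at h2 h3
      rw [e2, a2]
      have hs := s_apply (k := ((a : ℤ) - t).natAbs + 1) (by omega)
      have hc : ((((a : ℤ) - t).natAbs + 1 : ℕ) : ℤ) = a + 1 - t := by omega
      rw [hc] at hs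
      refine ⟨?_, fun j hj1 hj2 => ?_, fun j hj1 hj2 => ?_⟩
      · rw [hs, if_pos (by omega), h1]
      · rw [hs, if_neg (by omega), if_neg (by omega), if_neg (by omega), if_neg (by omega)]
        exact h2 j hj1 (by omega)
      · by_cases hj : j = a + 1 - t
        · rw [hs, if_neg (by omega), if_pos hj, h2 _ (by omega) (by omega)]
          omega
        · rw [hs, if_neg (by omega), if_neg (by omega), if_neg (by omega), if_neg (by omega)]
          exact h3 j (by omega) hj2
    · have e1 : theta t t = 1 := by rw [theta, if_pos le_rfl]; ring
      have e2 : theta t (t + 1) = -1 := by rw [theta, if_neg (by omega)]; push_cast; ring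
      rw [e1] at h1
      rw [e1, abs_one] at h2 h3
      rw [e2, abs_neg, abs_one]
      rw [show ((t : ℤ) - t).natAbs + 1 = 1 by simp]
      refine ⟨?_, fun j hj1 hj2 => by omega, fun j hj1 hj2 => ?_⟩
      · rw [s_one_apply, if_neg (by omega), if_pos rfl, h1]
      · rw [s_one_apply, if_neg (by omega), if_neg (by omega)]
        exact h3 j hj1 hj2
    · have e1 : theta a t = -(t - a) := by rw [theta, if_neg (by omega)]; ring
      have e2 : theta a (t + 1) = -(t - a + 1) := by
        rw [theta, if_neg (by omega)]; push_cast; ring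
      have a1 : |(t : ℤ) - a| = t - a := abs_of_pos (by omega)
      have a2 : |(t : ℤ) - a + 1| = t - a + 1 := abs_of_pos (by omega)
      rw [e1] at h1
      rw [e1, abs_neg, a1] at h2 h3
      rw [e2, abs_neg, a2]
      have hs := s_apply (k := ((a : ℤ) - t).natAbs + 1) (by omega)
      have hc : ((((a : ℤ) - t).natAbs + 1 : ℕ) : ℤ) = t - a + 1 := by omega
      rw [hc] at hs
      refine ⟨?_, fun j hj1 hj2 => ?_, fun j hj1 hj2 => ?_⟩
      · rw [hs, if_neg (by omega), if_neg (by omega), if_neg (by omega), if_pos rfl, ← h1]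
        congr 1; ring
      · by_cases hj : j = t - a
        · rw [hs, if_pos (by omega), h3 _ (by omega) (by omega)]
          omega
        · rw [hs, if_neg (by omega), if_neg (by omega), if_neg (by omega), if_neg (by omega)]
          exact h2 j hj1 (by omega)
      · rw [hs, if_neg (by omega), if_neg (by omega), if_neg (by omega), if_neg (by omega)]
        exact h3 j (by omega) hj2

theorem theta_abs {a t : ℕ} (ht : t ≤ 2 * a + 1) : 1 ≤ |theta a t| ∧ |theta a t| ≤ a + 1 := by
  rw [theta]
  split_ifs
  · rw [abs_of_pos (by omega)]; omega
  · rw [abs_of_neg (by omega)]; omega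

theorem rowPerm_symm_top {a t : ℕ} (ht : t ≤ 2 * a + 1) : (rowPerm a t)⁻¹ (a + 1) = theta a t := by
  rw [Equiv.Perm.inv_eq_iff_eq, (rowPerm_spec ht).1]

theorem rowPerm_symm_apply {a t : ℕ} (ht : t ≤ 2 * a + 1) {i : ℤ} (h1 : 1 ≤ i) (h2 : i ≤ a) :
    (rowPerm a t)⁻¹ i = if i < |theta a t| then i else i + 1 := by
  rw [Equiv.Perm.inv_eq_iff_eq]
  split_ifs with h
  · exact ((rowPerm_spec ht).2.1 i h1 h).symm
  · rw [(rowPerm_spec ht).2.2 (i + 1) (by omega) (by omega), add_sub_cancel_right]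

/-- Since `w` fixes `a+1` and has smaller absolute values on `1, …, a`, each letter moves the
largest value `a+1` one place away from its home, which creates one inversion. -/
theorem inv_mul_rowPerm {a : ℕ} (hw : w ∈ W a) (ha : a < n) {t : ℕ} (ht : t ≤ 2 * a + 1) :
    inv n (w * rowPerm a t) = inv n w + t := by
  induction t with
  | zero => simp [rowPerm, rowWord]
  | succ t ih =>
    obtain ⟨h1, h2, h3⟩ := rowPerm_spec (a := a) (t := t) (by omega)
    have hr := rowPerm_mem (a := a) (t := t) (by omega)
    have hwb : ∀ i : ℤ, 1 ≤ i → i ≤ a → -(a : ℤ) ≤ w i ∧ w i ≤ a := by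
      intro i hi1 hi2
      exact abs_le.1 (W_abs_le hw (by rw [abs_of_pos (by omega)]; exact hi2))
    have hwt : w (a + 1) = a + 1 := W_fix hw (by rw [abs_of_pos (by omega)]; omega)
    rw [rowPerm_succ, ← mul_assoc, inv_mul_s, ih (by omega), add_assoc]
    · exact (W n).mul_mem (W_mono ha.le hw) (W_mono ha hr)
    · omega
    · omega
    · simp only [Equiv.Perm.mul_apply]
      rcases lt_trichotomy t a with hta | rfl | hta
      · have e1 : theta a t = a + 1 - t := by rw [theta, if_pos (by omega)]
        have a1 : |(a : ℤ) + 1 - t| = a + 1 - t := abs_of_pos (by omega)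
        rw [e1] at h1
        rw [e1, a1] at h2
        rw [simplePair_of_two_le (by omega)]
        have hc : ((((a : ℤ) - t).natAbs + 1 : ℕ) : ℤ) = a + 1 - t := by omega
        simp only [hc]
        rw [h1, h2 _ (by omega) (by omega), hwt]
        have := hwb (a + 1 - t - 1) (by omega) (by omega)
        omega
      · have e1 : theta t t = 1 := by rw [theta, if_pos le_rfl]; ring
        rw [e1] at h1
        rw [show ((t : ℤ) - t).natAbs + 1 = 1 by simp, simplePair_one]
        simp only
        rw [W_neg hr, h1, W_neg hw, hwt]
        omega
      · have e1 : theta a t = -(t - a) := by rw [theta, if_neg (by omega)]; ring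
        have a1 : |(t : ℤ) - a| = t - a := abs_of_pos (by omega)
        rw [e1, W_neg hr] at h1
        rw [e1, abs_neg, a1] at h3
        rw [simplePair_of_two_le (by omega)]
        have hc : ((((a : ℤ) - t).natAbs + 1 : ℕ) : ℤ) = t - a + 1 := by omega
        simp only [hc]
        rw [h3 (t - a + 1) (by omega) (by omega), add_sub_cancel_right,
          show rowPerm a t (t - a) = -(a + 1) by omega, W_neg hw, hwt]
        have := hwb (t - a) (by omega) (by omega)
        omega

/-- The product of the row permutations with parameters `t 0, …, t (m-1)`. -/
def canon (t : ℕ → ℕ) : ℕ → Equiv.Perm ℤ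
  | 0 => 1
  | m + 1 => canon t m * rowPerm m (t m)

theorem canon_mem {t : ℕ → ℕ} (ht : ∀ a, t a ≤ 2 * a + 1) (m : ℕ) : canon t m ∈ W m := by
  induction m with
  | zero => exact (W 0).one_mem
  | succ m ih => exact (W (m + 1)).mul_mem (W_mono (by omega) ih) (rowPerm_mem (ht m))

theorem inv_canon {t : ℕ → ℕ} (ht : ∀ a, t a ≤ 2 * a + 1) {m : ℕ} (hm : m ≤ n) :
    inv n (canon t m) = ∑ a ∈ Finset.range m, t a := by
  induction m with
  | zero => simp [canon, inv_one]
  | succ m ih =>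
    rw [canon, inv_mul_rowPerm (canon_mem ht m) (by omega) (ht m), ih (by omega),
      Finset.sum_range_succ]

/-- The position `x` of the value `m+1` determines the last factor, because `theta m` takes every
nonzero value between `-(m+1)` and `m+1` as the parameter runs up to `2m+1`. Dividing it off leaves
an element fixing `m+1`. -/
theorem exists_canon (m : ℕ) : ∀ w ∈ W m, ∃ t : ℕ → ℕ, (∀ a, t a ≤ 2 * a + 1) ∧ canon t m = w := by
  induction m with
  | zero =>
    intro w hw
    refine ⟨fun _ => 0, fun _ => Nat.zero_le _, ?_⟩
    ext i
    by_cases hi : i = 0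
    · rw [hi, W_zero hw]; rfl
    · rw [W_fix hw (by simpa using hi)]; rfl
  | succ m ih =>
    intro w hw
    have hinv := (W (m + 1)).inv_mem hw
    set x := w⁻¹ (m + 1) with hx
    have hx1 : |x| ≤ m + 1 := by
      have := W_abs_le hinv (i := m + 1) (by rw [abs_of_pos (by omega)]; push_cast; rfl)
      exact_mod_cast this
    have hx2 : x ≠ 0 := W_ne_zero hinv (by omega)
    rw [abs_le] at hx1
    obtain ⟨r, hr, hrx⟩ : ∃ r : ℕ, r ≤ 2 * m + 1 ∧ theta m r = x := by
      by_cases h : 0 < x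
      · exact ⟨(m + 1 - x).toNat, by omega, by rw [theta, if_pos (by omega)]; omega⟩
      · exact ⟨(m - x).toNat, by omega, by rw [theta, if_neg (by omega)]; omega⟩
    have hv : w * (rowPerm m r)⁻¹ ∈ W (m + 1) :=
      (W (m + 1)).mul_mem hw ((W (m + 1)).inv_mem (rowPerm_mem hr))
    have htop : (w * (rowPerm m r)⁻¹) (m + 1) = m + 1 := by
      rw [Equiv.Perm.mul_apply, rowPerm_symm_top hr, hrx, hx, ← Equiv.Perm.mul_apply, mul_inv_cancel,
        Equiv.Perm.one_apply]
    obtain ⟨t, ht, htw⟩ := ih (w * (rowPerm m r)⁻¹) ⟨hv.1, fun i hi => by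
      by_cases h : (m : ℤ) + 1 < |i|
      · exact W_fix hv (by exact_mod_cast h)
      · rcases abs_choice i with h1 | h1
        · rw [show i = m + 1 by omega, htop]
        · rw [show i = -(m + 1) by omega, W_neg hv, htop]⟩
    refine ⟨Function.update t m r, fun a => ?_, ?_⟩
    · by_cases h : a = m
      · rw [h, Function.update_self]; exact hr
      · rw [Function.update_of_ne h]; exact ht a
    · have hc : ∀ k ≤ m, canon (Function.update t m r) k = canon t k := by
        intro k hk
        induction k with
        | zero => rfl
        | succ k ihk => rw [canon, canon, ihk (by omega), Function.update_of_ne (by omega)]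
      rw [canon, hc m le_rfl, htw, Function.update_self, inv_mul_cancel_right]

end SignedPerm
end SkewPipe

namespace SkewPipe

/-! ### The lexicographically least reduced subword -/

theorem exists_split_of_lt {l l' : List ℕ} (h : l < l') (hl : l.length = l'.length) :
    ∃ (c : List ℕ) (x y : ℕ) (u v : List ℕ), x < y ∧ l = c ++ x :: u ∧ l' = c ++ y :: v := by
  induction l generalizing l' with
  | nil =>
    rw [List.length_nil, eq_comm, List.length_eq_zero_iff] at hl
    rw [hl] at h
    exact absurd h (lt_irrefl _)
  | cons a l ih =>
    rcases l' with _ | ⟨b, l'⟩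
    · simp at hl
    · rcases List.cons_lt_cons_iff.1 h with h' | ⟨rfl, h'⟩
      · exact ⟨[], a, b, l, l', h', rfl, rfl⟩
      · obtain ⟨c, x, y, u, v, hxy, rfl, rfl⟩ := ih h' (by simpa using hl)
        exact ⟨a :: c, x, y, u, v, hxy, rfl, rfl⟩

section

variable {n : ℕ} {w : Equiv.Perm ℤ} {t : ℕ → ℕ}

/-- The positions of the letters used in the canonical factorization. -/
def canonIdx (t : ℕ → ℕ) (m : ℕ) : List ℕ :=
  (List.range m).flatMap fun a => (List.range (t a)).map fun b => a ^ 2 + b + 1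

theorem canonIdx_succ (t : ℕ → ℕ) (m : ℕ) :
    canonIdx t (m + 1) = canonIdx t m ++ (List.range (t m)).map fun b => m ^ 2 + b + 1 := by
  simp [canonIdx, List.range_succ]

theorem mem_canonIdx {m k : ℕ} :
    k ∈ canonIdx t m ↔ ∃ a < m, ∃ b < t a, k = a ^ 2 + b + 1 := by
  simp only [canonIdx, List.mem_flatMap, List.mem_map, List.mem_range, eq_comm]

theorem canonIdx_le (ht : ∀ a, t a ≤ 2 * a + 1) {m k : ℕ} (hk : k ∈ canonIdx t m) :
    1 ≤ k ∧ k ≤ m ^ 2 := by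
  obtain ⟨a, ha, b, hb, rfl⟩ := mem_canonIdx.1 hk
  have := ht a
  refine ⟨by omega, ?_⟩
  have h1 : a + 1 ≤ m := ha
  have h2 : b ≤ 2 * a := by omega
  nlinarith

theorem canonIdx_pairwise (ht : ∀ a, t a ≤ 2 * a + 1) (m : ℕ) :
    (canonIdx t m).Pairwise (· < ·) := by
  induction m with
  | zero => simp [canonIdx]
  | succ m ih =>
    rw [canonIdx_succ, List.pairwise_append]
    refine ⟨ih, ?_, ?_⟩
    · rw [List.pairwise_map]
      exact List.pairwise_lt_range.imp (by intros; omega)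
    · intro x hx y hy
      obtain ⟨b, _, rfl⟩ := List.mem_map.1 hy
      have := (canonIdx_le ht hx).2
      omega

theorem length_canonIdx (t : ℕ → ℕ) (m : ℕ) :
    (canonIdx t m).length = ∑ a ∈ Finset.range m, t a := by
  induction m with
  | zero => simp [canonIdx]
  | succ m ih => rw [canonIdx_succ, List.length_append, ih, Finset.sum_range_succ]; simp

theorem prod_canonIdx (ht : ∀ a, t a ≤ 2 * a + 1) {m : ℕ} (hm : m ≤ n) :
    (((canonIdx t m).map (letter n)).map s).prod = canon t m := by
  induction m with
  | zero => simp [canonIdx, canon]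
  | succ m ih =>
    rw [canonIdx_succ, List.map_append, List.map_append, List.prod_append, ih (by omega), canon,
      rowPerm, rowWord]
    congr 3
    rw [List.map_map]
    refine List.map_congr_left fun b hb => ?_
    rw [List.mem_range] at hb
    have := ht m
    exact letter_eq (by omega) (by omega)

theorem letter_le {k : ℕ} (h1 : 1 ≤ k) (h2 : k ≤ n ^ 2) : 1 ≤ letter n k ∧ letter n k ≤ n := by
  obtain ⟨a, b, ha, hb, rfl⟩ := exists_row_col h1 h2
  rw [letter_eq ha hb]
  omega

theorem letters_le {l : List ℕ} (hl : ∀ k ∈ l, 1 ≤ k ∧ k ≤ n ^ 2) :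
    ∀ k ∈ l.map (letter n), 1 ≤ k ∧ k ≤ n := by
  intro k hk
  obtain ⟨r, hr, rfl⟩ := List.mem_map.1 hk
  exact letter_le (hl r hr).1 (hl r hr).2

theorem isWord_canon (ht : ∀ a, t a ≤ 2 * a + 1) :
    IsWord n ((canonIdx t n).map (letter n)) (canon t n) :=
  ⟨letters_le fun _ hk => canonIdx_le ht hk, prod_canonIdx ht le_rfl⟩

/-- The canonical factorization supplies a word whose length is the number of inversions. -/
theorem len_eq_inv (hw : w ∈ W n) : len n w = inv n w := by
  obtain ⟨t, ht, rfl⟩ := exists_canon n w hw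
  exact len_eq_of_word (isWord_canon ht) (by rw [List.length_map, length_canonIdx, inv_canon ht le_rfl])

theorem len_canon (ht : ∀ a, t a ≤ 2 * a + 1) : len n (canon t n) = ∑ a ∈ Finset.range n, t a := by
  rw [len_eq_inv (canon_mem ht n), inv_canon ht le_rfl]

theorem exists_word (hw : w ∈ W n) : ∃ l, IsWord n l w ∧ l.length = len n w := by
  obtain ⟨t, ht, rfl⟩ := exists_canon n w hw
  exact ⟨_, isWord_canon ht, by rw [List.length_map, length_canonIdx, len_canon ht]⟩

theorem IsWord.reverse {l : List ℕ} (h : IsWord n l w) : IsWord n l.reverse w⁻¹ := by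
  refine ⟨fun k hk => h.1 k (by simpa using hk), ?_⟩
  rw [← h.2, List.prod_inv_reverse, List.map_reverse, List.map_map]
  congr 2
  refine List.map_congr_left fun k hk => ?_
  exact (inv_eq_of_mul_eq_one_left (s_mul_self (h.1 k hk).1)).symm

theorem len_inv_le (hw : w ∈ W n) : len n w⁻¹ ≤ len n w := by
  obtain ⟨l, hl, hlen⟩ := exists_word hw
  have := len_le hl.reverse
  rwa [List.length_reverse, hlen] at this

theorem len_inv (hw : w ∈ W n) : len n w⁻¹ = len n w := by
  refine le_antisymm (len_inv_le hw) ?_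
  have := len_inv_le ((W n).inv_mem hw)
  rwa [inv_inv] at this

theorem len_s_mul (hw : w ∈ W n) {k : ℕ} (hk : 1 ≤ k) (hkn : k ≤ n)
    (h : w⁻¹ (simplePair k).1 < w⁻¹ (simplePair k).2) : len n (s k * w) = len n w + 1 := by
  have hs := s_mem_W hk hkn
  have h1 := inv_mul_s ((W n).inv_mem hw) hk hkn h
  have h2 : s k * w = (w⁻¹ * s k)⁻¹ := by
    rw [mul_inv_rev, inv_inv, inv_eq_of_mul_eq_one_left (s_mul_self hk)]
  rw [h2, len_inv ((W n).mul_mem ((W n).inv_mem hw) hs),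
    len_eq_inv ((W n).mul_mem ((W n).inv_mem hw) hs), h1, ← len_eq_inv ((W n).inv_mem hw), len_inv hw]

/-- The last factors of the canonical factorization preserve the order of the small letters. -/
theorem canon_tail_mono (ht : ∀ a, t a ≤ 2 * a + 1) {a m : ℕ} (ham : a ≤ m) :
    (∀ i : ℤ, 1 ≤ i → i ≤ a → 1 ≤ ((canon t m)⁻¹ * canon t a) i ∧
      ((canon t m)⁻¹ * canon t a) i ≤ m) ∧
    ∀ i j : ℤ, 1 ≤ i → i < j → j ≤ a →
      ((canon t m)⁻¹ * canon t a) i < ((canon t m)⁻¹ * canon t a) j := by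
  induction m, ham using Nat.le_induction with
  | base =>
    rw [inv_mul_cancel]
    exact ⟨fun i h1 h2 => ⟨h1, h2⟩, fun i j _ h _ => h⟩
  | succ m ham ih =>
    have e : ∀ i, ((canon t (m + 1))⁻¹ * canon t a) i =
        (rowPerm m (t m))⁻¹ (((canon t m)⁻¹ * canon t a) i) := by
      intro i
      rw [canon, mul_inv_rev, mul_assoc]
      rfl
    refine ⟨fun i h1 h2 => ?_, fun i j h1 h2 h3 => ?_⟩
    · have := ih.1 i h1 h2
      rw [e, rowPerm_symm_apply (ht m) this.1 this.2]
      split_ifs <;> constructor <;> omega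
    · have hi := ih.1 i h1 (by omega)
      have hj := ih.1 j (by omega) h3
      have := ih.2 i j h1 h2 h3
      rw [e, e, rowPerm_symm_apply (ht m) hi.1 hi.2, rowPerm_symm_apply (ht m) hj.1 hj.2]
      split_ifs <;> omega

theorem canonIdx_prefix (t : ℕ → ℕ) {a m : ℕ} (h : a ≤ m) : ∃ l, canonIdx t m = canonIdx t a ++ l ∧
    ∀ k ∈ l, a ^ 2 + 1 ≤ k := by
  induction m, h using Nat.le_induction with
  | base => exact ⟨[], by simp, by simp⟩
  | succ m h ih =>
    obtain ⟨l, hl, hl'⟩ := ih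
    refine ⟨l ++ (List.range (t m)).map fun b => m ^ 2 + b + 1, ?_, ?_⟩
    · rw [canonIdx_succ, hl, List.append_assoc]
    · intro k hk
      rcases List.mem_append.1 hk with hk | hk
      · exact hl' k hk
      · obtain ⟨b, _, rfl⟩ := List.mem_map.1 hk
        have := Nat.pow_le_pow_left h 2
        omega

theorem canonIdx_mem_R (ht : ∀ a, t a ≤ 2 * a + 1) : canonIdx t n ∈ R n (canon t n) := by
  have hlen : (canonIdx t n).length = len n (canon t n) := by rw [length_canonIdx, len_canon ht]
  exact ⟨hlen, canonIdx_pairwise ht n, fun _ hk => canonIdx_le ht hk, isWord_canon ht,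
    by rw [List.length_map, hlen]⟩

/-- At the first difference a smaller sequence would use an earlier letter while the canonical one
opens a new block `a`. That letter is at most `a`, but the remaining factor `z` has no left descent
among the letters up to `a`, so the competing word would not be reduced. -/
theorem canonIdx_isLeast (ht : ∀ a, t a ≤ 2 * a + 1) : IsLeast (R n (canon t n)) (canonIdx t n) := by
  refine ⟨canonIdx_mem_R ht, fun ks hks => ?_⟩
  by_contra hlt
  rw [not_le] at hlt
  obtain ⟨h1, h2, h3, ⟨h4, h5⟩, h6⟩ := hks
  have hlen : (canonIdx t n).length = len n (canon t n) := (canonIdx_mem_R ht).1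
  obtain ⟨c, x, y, u, v, hxy, rfl, hc⟩ := exists_split_of_lt hlt (by rw [h1, hlen])
  have hpw := canonIdx_pairwise ht n
  rw [hc, List.pairwise_append, List.pairwise_cons] at hpw
  rw [List.pairwise_append, List.pairwise_cons] at h2
  have hx := h3 x (by simp)
  have hy : y ∈ canonIdx t n := by rw [hc]; simp
  obtain ⟨a, ha, b, hb, rfl⟩ := mem_canonIdx.1 hy
  have hta := ht a
  -- Otherwise `y - 1` is also canonical and belongs to the common prefix, which leaves no room for
  -- `x` between `y - 1` and `y`.
  obtain rfl : b = 0 := by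
    by_contra hb0
    have hy' : a ^ 2 + (b - 1) + 1 ∈ canonIdx t n := mem_canonIdx.2 ⟨a, ha, b - 1, by omega, rfl⟩
    rw [hc, List.mem_append, List.mem_cons] at hy'
    rcases hy' with hy' | hy' | hy'
    · have := h2.2.2 _ hy' x (by simp)
      omega
    · omega
    · have := hpw.2.1.1 _ hy'
      omega
  obtain ⟨l, hl, hl'⟩ := canonIdx_prefix t ha.le
  have hca : c = canonIdx t a := by
    rw [hc, List.append_eq_append_iff] at hl
    rcases hl with ⟨d, hd1, hd2⟩ | ⟨d, hd1, hd2⟩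
    · rcases d with _ | ⟨e, d⟩
      · simpa using hd1.symm
      · rw [List.cons_append, List.cons.injEq] at hd2
        have : e ∈ canonIdx t a := by rw [hd1]; simp
        have := (canonIdx_le ht this).2
        omega
    · rcases d with _ | ⟨e, d⟩
      · simpa using hd1
      · have h7 := hpw.2.2 e (by rw [hd1]; simp) (a ^ 2 + 0 + 1) (by simp)
        have h8 := hl' e (by rw [hd2]; simp)
        omega
  have hprod : (((x :: u).map (letter n)).map s).prod = (canon t a)⁻¹ * canon t n := by
    rw [List.map_append, List.map_append, List.prod_append, hca, prod_canonIdx ht ha.le] at h5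
    rw [← h5, inv_mul_cancel_left]
  set z := (canon t a)⁻¹ * canon t n with hz
  have hzW : z ∈ W n :=
    (W n).mul_mem ((W n).inv_mem (W_mono ha.le (canon_mem ht a))) (canon_mem ht n)
  have hux : ∀ k ∈ u, 1 ≤ k ∧ k ≤ n ^ 2 := fun k hk => h3 k (by simp [hk])
  have hlx := letter_le hx.1 hx.2
  have hu : len n (s (letter n x) * z) ≤ u.length := by
    have : IsWord n (u.map (letter n)) (s (letter n x) * z) := by
      refine ⟨letters_le hux, ?_⟩
      rw [← hprod, List.map_cons, List.map_cons, List.prod_cons, ← mul_assoc, s_mul_self hlx.1,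
        one_mul]
    have := len_le this
    rwa [List.length_map] at this
  -- A shorter word for `z`, preceded by the letters of the common prefix, would be too short a word
  -- for `canon t n`.
  have hzl : u.length + 1 ≤ len n z := by
    obtain ⟨l, hl, hll⟩ := exists_word hzW
    have : IsWord n (c.map (letter n) ++ l) (canon t n) := by
      refine ⟨fun k hk => ?_, ?_⟩
      · rcases List.mem_append.1 hk with hk | hk
        · exact letters_le (fun k hk => h3 k (by simp [hk])) k hk
        · exact hl.1 k hk
      · rw [List.map_append, List.prod_append, hl.2, hca, prod_canonIdx ht ha.le, hz,
          mul_inv_cancel_left]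
    have := len_le this
    rw [List.length_append, List.length_map] at this
    rw [List.length_append, List.length_cons] at h1
    omega
  -- Since `x ≤ a²`, it lies in a block before block `a`.
  have hxa : letter n x ≤ a := by
    obtain ⟨a', b', ha', hb', rfl⟩ := exists_row_col hx.1 hx.2
    rw [letter_eq ha' hb']
    have : a' < a := by
      by_contra h
      have := Nat.pow_le_pow_left (not_lt.1 h) 2
      omega
    omega
  have hmono := canon_tail_mono ht ha.le
  have hzi : z⁻¹ = (canon t n)⁻¹ * canon t a := by rw [hz, mul_inv_rev, inv_inv]
  rw [← hzi] at hmono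
  -- Order and positivity of `z⁻¹` on `1, …, a` make left multiplication by this letter increase the
  -- length, contrary to `hu` and `hzl`.
  have := len_s_mul hzW hlx.1 hlx.2 (by
    rcases eq_or_lt_of_le hlx.1 with h | h
    · rw [← h, simplePair_one]
      simp only
      rw [W_neg ((W n).inv_mem hzW)]
      have := (hmono.1 1 le_rfl (by omega)).1
      omega
    · rw [simplePair_of_two_le h]
      exact hmono.2 _ _ (by omega) (by omega) (by omega))
  omega

theorem kMin_canon (ht : ∀ a, t a ≤ 2 * a + 1) : kMin n (canon t n) = canonIdx t n := by
  have h : ∃ ks, IsLeast (R n (canon t n)) ks := ⟨_, canonIdx_isLeast ht⟩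
  rw [kMin, dif_pos h]
  exact h.choose_spec.unique (canonIdx_isLeast ht)

/-! ### Left-justified skew pipe dreams are the sets `D(w)`. -/

/-- The left-justified skew pipe dream whose complement has `t a` boxes in row `n - a`. -/
noncomputable def shape (n : ℕ) (t : ℕ → ℕ) : Finset (ℤ × ℤ) :=
  (SY n).filter fun b => (t ((n : ℤ) - b.1).toNat : ℤ) ≤ 2 * n - b.1 - b.2

theorem mem_shape {p q : ℤ} : (p, q) ∈ shape n t ↔
    (p, q) ∈ SY n ∧ (t ((n : ℤ) - p).toNat : ℤ) ≤ 2 * n - p - q := by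
  rw [shape, Finset.mem_filter]

theorem shape_subset : shape n t ⊆ SY n := Finset.filter_subset _ _

theorem mem_shape_iff (ht : ∀ a, t a ≤ 2 * a + 1) {b : ℤ × ℤ} (hb : b ∈ SY n) :
    b ∈ shape n t ↔ idx n b ∉ canonIdx t n := by
  obtain ⟨p, q⟩ := b
  have h := mem_SY.1 hb
  obtain ⟨a, ha⟩ : ∃ a : ℕ, (n : ℤ) - p = a := ⟨((n : ℤ) - p).toNat, by omega⟩
  obtain ⟨b, hb'⟩ : ∃ b : ℕ, 2 * (n : ℤ) - p - q = b := ⟨(2 * (n : ℤ) - p - q).toNat, by omega⟩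
  have e : idx n (p, q) = a ^ 2 + b + 1 := by
    simp only [idx, ha, hb', Int.toNat_natCast]
  rw [mem_shape, ha, hb', e, Int.toNat_natCast, mem_canonIdx]
  constructor
  · rintro ⟨-, h1⟩ ⟨a', h2, b', h3, h4⟩
    have h5 := ht a'
    have e1 := pq_eq (n := n) (a := a) (b := b) (by omega) (by omega)
    have e2 := pq_eq (n := n) (a := a') (b := b') (by omega) (by omega)
    rw [h4, e2, Prod.mk.injEq] at e1
    obtain rfl : a = a' := by omega
    omega
  · intro h1
    refine ⟨hb, ?_⟩
    by_contra h2
    exact h1 ⟨a, by omega, b, by omega, rfl⟩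

theorem Dw_canon (ht : ∀ a, t a ≤ 2 * a + 1) : Dw n (canon t n) = shape n t := by
  ext b
  rw [Dw, Finset.mem_filter, kMin_canon ht]
  constructor
  · rintro ⟨h1, h2⟩
    rw [mem_shape_iff ht h1]
    exact fun h => h2 _ h (idx_spec h1).2
  · intro h
    have h1 := shape_subset h
    refine ⟨h1, fun k hk e => (mem_shape_iff ht h1).1 h ?_⟩
    have := canonIdx_le ht hk
    rw [← e, (pq_spec this.1 this.2).2.1]
    exact hk

theorem card_shape (ht : ∀ a, t a ≤ 2 * a + 1) :
    (shape n t).card + ∑ a ∈ Finset.range n, t a = n ^ 2 := by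
  have h1 : (SY n \ shape n t).card = ∑ a ∈ Finset.range n, t a := by
    rw [← length_canonIdx, ← List.toFinset_card_of_nodup ((canonIdx_pairwise ht n).imp ne_of_lt)]
    refine Finset.card_bij (fun b _ => idx n b) ?_ ?_ ?_
    · intro b hb
      rw [Finset.mem_sdiff] at hb
      rw [List.mem_toFinset]
      by_contra h
      exact hb.2 ((mem_shape_iff ht hb.1).2 h)
    · intro b hb c hc e
      rw [Finset.mem_sdiff] at hb hc
      rw [← (idx_spec hb.1).2, e, (idx_spec hc.1).2]
    · intro k hk
      rw [List.mem_toFinset] at hk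
      have h := canonIdx_le ht hk
      have h' := pq_spec h.1 h.2
      refine ⟨pq n k, ?_, h'.2.1⟩
      rw [Finset.mem_sdiff, mem_shape_iff ht h'.1, h'.2.1]
      exact ⟨h'.1, fun h => h hk⟩
  have h2 : (SY n).card = n ^ 2 := by
    have : (Finset.Icc 1 (n ^ 2)).card = n ^ 2 := by simp
    rw [← this]
    refine Finset.card_bij (fun b _ => idx n b) ?_ ?_ ?_
    · intro b hb
      exact Finset.mem_Icc.2 ⟨one_le_idx b, (idx_spec hb).1⟩
    · intro b hb c hc e
      rw [← (idx_spec hb).2, e, (idx_spec hc).2]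
    · intro k hk
      rw [Finset.mem_Icc] at hk
      have h' := pq_spec hk.1 hk.2
      exact ⟨pq n k, h'.1, h'.2.1⟩
  have := Finset.card_sdiff_add_card_eq_card (shape_subset (n := n) (t := t))
  omega

theorem canon_full {m : ℕ} {i : ℤ} (h1 : 1 ≤ i) (h2 : i ≤ m) :
    (canon (fun a => 2 * a + 1) m)⁻¹ i = -i := by
  induction m with
  | zero => omega
  | succ m ih =>
    have hθ : theta m (2 * m + 1) = -(m + 1) := by
      rw [theta, if_neg (by omega)]; push_cast; ring
    rw [canon, mul_inv_rev, Equiv.Perm.mul_apply]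
    have hr : rowPerm m (2 * m + 1) ∈ W (m + 1) := rowPerm_mem le_rfl
    rcases eq_or_lt_of_le h2 with rfl | h
    · rw [W_fix ((W m).inv_mem (canon_mem (fun _ => le_rfl) m)) (by rw [abs_of_pos] <;> omega),
        Nat.cast_succ, rowPerm_symm_top le_rfl, hθ]
    · rw [ih (by omega), W_neg ((W _).inv_mem hr), rowPerm_symm_apply le_rfl h1 (by omega), hθ, abs_neg,
        abs_of_pos (by omega), if_pos (by omega)]

/-- With every block full, the factor of block `a` negates `a+1` and fixes `1, …, a`. The length is
the sum of the first `n` odd numbers. -/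
theorem len_w0 : len n (w0 n) = n ^ 2 := by
  have ht : ∀ a, (fun a => 2 * a + 1) a ≤ 2 * a + 1 := fun _ => le_rfl
  have h : w0 n = (⟨canon (fun a => 2 * a + 1) n, canon_mem ht n⟩ : W n) := by
    refine W_ext fun j h1 h2 => ?_
    have h3 : (w0 n : Equiv.Perm ℤ) j = -j := if_pos (by rw [abs_of_pos] <;> omega)
    have h4 : canon (fun a => 2 * a + 1) n (-j) = j := by
      rw [← canon_full h1 h2]
      exact Equiv.apply_symm_apply _ _
    rw [h3]
    change _ = canon (fun a => 2 * a + 1) n j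
    rw [W_neg (canon_mem ht n)] at h4
    omega
  rw [h]
  change len n (canon (fun a => 2 * a + 1) n) = n ^ 2
  rw [len_canon ht]
  clear h
  induction n with
  | zero => simp
  | succ n ih => rw [Finset.sum_range_succ, ih]; ring

theorem LeftJustified.exists_shape {D : Finset (ℤ × ℤ)} (hD : D ⊆ SY n) (h : LeftJustified n D) :
    ∃ t : ℕ → ℕ, (∀ a, t a ≤ 2 * a + 1) ∧ shape n t = D := by
  classical
  -- `t a` counts the boxes of row `n-a` to the right of its last box in `D`; the alternative `2a+1`
  -- covers an empty row.
  have hex : ∀ a : ℕ, ∃ b : ℕ, b = 2 * a + 1 ∨ ((n : ℤ) - a, (n : ℤ) + a - b) ∈ D :=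
    fun a => ⟨_, .inl rfl⟩
  refine ⟨fun a => Nat.find (hex a), fun a => Nat.find_min' _ (.inl rfl), ?_⟩
  ext ⟨p, q⟩
  rw [mem_shape]
  constructor
  · rintro ⟨h1, h2⟩
    have h3 := mem_SY.1 h1
    obtain ⟨a, ha⟩ : ∃ a : ℕ, (n : ℤ) - p = a := ⟨((n : ℤ) - p).toNat, by omega⟩
    rw [ha, Int.toNat_natCast] at h2
    have key : ∀ d : ℕ, (p, q + d) ∈ D → (p, q) ∈ D := by
      intro d
      induction d with
      | zero => simp
      | succ d ih =>
        intro hd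
        rw [Nat.cast_succ, ← add_assoc] at hd
        have := mem_SY.1 (hD hd)
        exact ih (h _ _ (mem_SY.2 (by omega)) hd)
    rcases Nat.find_spec (hex a) with h4 | h4
    · omega
    · refine key (2 * n - p - q - Nat.find (hex a)).toNat ?_
      convert h4 using 2 <;> omega
  · intro h1
    have h2 := hD h1
    have h3 := mem_SY.1 h2
    refine ⟨h2, ?_⟩
    obtain ⟨a, ha⟩ : ∃ a : ℕ, (n : ℤ) - p = a := ⟨((n : ℤ) - p).toNat, by omega⟩
    rw [ha, Int.toNat_natCast]
    have : Nat.find (hex a) ≤ (2 * (n : ℤ) - p - q).toNat := by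
      refine Nat.find_min' _ (.inr ?_)
      convert h1 using 2 <;> omega
    omega

end
end SkewPipe

namespace SkewPipe

open Edge

/-! ### The pipes of a left-justified skew pipe dream -/

section

variable {n : ℕ} {t : ℕ → ℕ}

theorem mem_shape_row {m : ℕ} (hm : m < n) {q : ℤ} :
    ((n : ℤ) - m, q) ∈ shape n t ↔ (n : ℤ) - m ≤ q ∧ q ≤ n + m - t m := by
  rw [mem_shape, mem_SY, sub_sub_cancel, Int.toNat_natCast]
  omega

theorem conn_row {m : ℕ} (hm : m < n) {q : ℤ} (h1 : (n : ℤ) - m ≤ q) (h2 : q ≤ n + m + 1 - t m) :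
    Conn n (shape n t) (source n (m + 1)) (H (n - m) q) := by
  induction q, h1 using Int.leInduction with
  | base =>
    rw [source, add_sub_add_right_eq_sub]
    exact .refl
  | succ q h1 ih => exact (ih (by omega)).trans (.cross_row ((mem_shape_row hm).2 ⟨h1, by omega⟩))

theorem up_of_le {p q : ℤ} (h : q ≤ n) : up n p q = V (p - 1) (2 * n + 1 - q) := if_pos h

theorem up_of_lt {p q : ℤ} (h : (n : ℤ) < q) : up n p q = V p (2 * n + 1 - q) := if_neg (by omega)

theorem theta_of_le {a t : ℕ} (h : t ≤ a) : theta a t = a + 1 - t := if_pos h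

theorem theta_of_lt {a t : ℕ} (h : a < t) : theta a t = -(t - a) := by
  rw [theta, if_neg (by omega), neg_sub]

theorem abs_theta_of_le {a t : ℕ} (h : t ≤ a) : |theta a t| = a + 1 - t := by
  rw [theta_of_le h, abs_of_pos (by omega)]

theorem abs_theta_of_lt {a t : ℕ} (h : a < t) : |theta a t| = t - a := by
  rw [theta_of_lt h, abs_neg, abs_of_pos (by omega)]

/-- In a row, the pipe starting there turns upwards at the first empty box. -/
theorem conn_turn (ht : ∀ a, t a ≤ 2 * a + 1) {m : ℕ} (hm : m < n) :
    Conn n (shape n t) (source n (m + 1)) (up n (n - m) (n + m + 1 - t m)) := by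
  have := ht m
  refine (conn_row hm (by omega) le_rfl).trans (.of_link (.turn_up ?_ ?_ ?_ ?_ ?_))
  all_goals first
    | omega
    | (rw [mem_shape_row hm]; omega)

/-- If the turn happens in the right half of the row (`t m ≤ m`), the rising pipe crosses its own
row strand in the left half. If it happens in the left half, the pipe leaves the row directly. -/
theorem conn_source_step (ht : ∀ a, t a ≤ 2 * a + 1) {m : ℕ} (hm : m < n) :
    Conn n (shape n t) (source n (m + 1)) (V (n - m - 1) (n + |theta m (t m)|)) := by
  have := ht m
  have h := conn_turn ht hm
  by_cases hc : t m ≤ m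
  · rw [abs_theta_of_le hc]
    rw [up_of_lt (by omega)] at h
    have h' := h.trans (.cross_col ((mem_shape_row hm).2 (by omega)))
    rw [up_of_le (by omega)] at h'
    convert h' using 2
    omega
  · rw [abs_theta_of_lt (by omega)]
    rw [up_of_le (by omega)] at h
    convert h using 2
    omega

/-- The pipe through a non-empty column enters the left half of the row. -/
theorem conn_cross {m : ℕ} (hm : m < n) {j : ℤ} (h1 : 1 ≤ j) (h2 : j ≤ m - t m) :
    Conn n (shape n t) (V (n - m) (n + j)) (V (n - m) (n + 1 - j)) := by
  have h : Conn n (shape n t) (V (n - m) (n + j)) (up n (n - m) (n + j)) :=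
    .cross_col ((mem_shape_row hm).2 (by omega))
  rw [up_of_lt (by omega)] at h
  convert h using 2
  omega

/-- Two adjacent empty boxes shift a rising pipe by one column. -/
theorem conn_shift {m : ℕ} (hm : m < n) {j : ℤ} (h1 : 1 ≤ j) (h2 : j ≤ m) (h3 : m - t m < j) :
    Conn n (shape n t) (V (n - m) (n + j)) (V (n - m) (n - j)) := by
  have h : Conn n (shape n t) (V (n - m) (n + j)) (H (n - m) (n + j + 1)) :=
    .turn_row (mem_SY.2 (by omega)) (by rw [mem_shape_row hm]; omega)
  have h' : Conn n (shape n t) (H (n - m) (n + j + 1)) (up n (n - m) (n + j + 1)) :=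
    .of_link (.turn_up (by omega) (by omega) (by omega) (by omega) (by rw [mem_shape_row hm]; omega))
  rw [up_of_lt (by omega)] at h'
  convert h.trans h' using 2
  omega

/-- A rising pipe meets row `n-m` twice, in each half either crossing it or being shifted by one
column. No shift, or one in each half, keeps the index `j`; a single shift raises it to `j+1`. This
is the rule of `rowPerm_symm_apply`. -/
theorem conn_step (ht : ∀ a, t a ≤ 2 * a + 1) {m : ℕ} (hm : m < n) {j : ℤ} (h1 : 1 ≤ j)
    (h2 : j ≤ m) : Conn n (shape n t) (V (n - m) (n + j))
      (V (n - m - 1) (n + if j < |theta m (t m)| then j else j + 1)) := by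
  have := ht m
  have cross : ∀ q : ℤ, (n : ℤ) - m ≤ q → q ≤ n → q ≤ n + m - t m →
      Conn n (shape n t) (V (n - m) q) (V (n - m - 1) (2 * n + 1 - q)) := by
    intro q hq1 hq2 hq3
    have h : Conn n (shape n t) (V (n - m) q) (up n (n - m) q) :=
      .cross_col ((mem_shape_row hm).2 ⟨hq1, hq3⟩)
    rwa [up_of_le hq2] at h
  by_cases hc : t m ≤ m
  · rw [abs_theta_of_le hc]
    split_ifs with h
    · convert (conn_cross hm h1 (by omega)).trans (cross _ (by omega) (by omega) (by omega)) using 2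
      omega
    · convert (conn_shift hm h1 h2 (by omega)).trans (cross _ (by omega) (by omega) (by omega)) using 2
      omega
  · rw [abs_theta_of_lt (by omega)]
    have h3 := conn_shift (t := t) hm h1 h2 (by omega)
    split_ifs with h
    · have h4 : Conn n (shape n t) (V (n - m) (n - j)) (H (n - m) (n - j + 1)) :=
        .turn_row (mem_SY.2 (by omega)) (by rw [mem_shape_row hm]; omega)
      have h5 : Conn n (shape n t) (H (n - m) (n - j + 1)) (up n (n - m) (n - j + 1)) :=
        .turn_up (mem_SY.2 (by omega)) (by rw [mem_shape_row hm]; omega)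
      rw [up_of_le (by omega)] at h5
      convert h3.trans (h4.trans h5) using 2
      omega
    · convert h3.trans (cross _ (by omega) (by omega) (by omega)) using 2
      omega

/-- The sign of the pipe starting in row `n - m`. -/
def rowSign (t : ℕ → ℕ) (m : ℕ) : ℤ := if t m ≤ m then 1 else -1

theorem theta_eq (t : ℕ → ℕ) (m : ℕ) : theta m (t m) = rowSign t m * |theta m (t m)| := by
  rw [rowSign]
  split_ifs with h
  · rw [abs_theta_of_le h, theta_of_le h, one_mul]
  · rw [abs_theta_of_lt (by omega), theta_of_lt (by omega), neg_one_mul]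

theorem W_rowSign {w : Equiv.Perm ℤ} (hw : w ∈ W n) (m : ℕ) (j : ℤ) :
    w (rowSign t m * j) = rowSign t m * w j := by
  rw [rowSign]
  split_ifs
  · rw [one_mul, one_mul]
  · rw [neg_one_mul, neg_one_mul, W_neg hw]

/-- The course of the pipe starting in row `n - m`. -/
theorem exists_conn (ht : ∀ a, t a ≤ 2 * a + 1) {m r : ℕ} (hmr : m + 1 ≤ r) (hr : r ≤ n) :
    ∃ j : ℤ, 1 ≤ j ∧ j ≤ r ∧ (canon t r)⁻¹ (m + 1) = rowSign t m * j ∧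
      Conn n (shape n t) (source n (m + 1)) (V (n - r) (n + j)) := by
  induction r, hmr using Nat.le_induction with
  | base =>
    have hθ := theta_abs (ht m)
    refine ⟨|theta m (t m)|, hθ.1, by push_cast; exact hθ.2, ?_, ?_⟩
    · rw [← theta_eq, canon, mul_inv_rev, Equiv.Perm.mul_apply,
        W_fix ((W m).inv_mem (canon_mem ht m)) (by rw [abs_of_pos] <;> omega), rowPerm_symm_top (ht m)]
    · have := conn_source_step ht (by omega : m < n)
      rwa [Nat.cast_succ, ← sub_sub]
  | succ r hmr ih =>
    obtain ⟨j, h1, h2, h3, h4⟩ := ih (by omega)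
    refine ⟨if j < |theta r (t r)| then j else j + 1, by split_ifs <;> omega,
      by split_ifs <;> omega, ?_, ?_⟩
    · rw [canon, mul_inv_rev, Equiv.Perm.mul_apply, h3,
        W_rowSign ((W _).inv_mem (rowPerm_mem (ht r))), rowPerm_symm_apply (ht r) h1 h2]
    · have := conn_step ht (by omega : r < n) h1 h2
      rw [Nat.cast_succ, ← sub_sub]
      exact h4.trans this

/-- Inverts `exists_conn`: the absolute value of `canon t r j` names the pipe, and injectivity
together with oddness shows that it arrives at `j`. -/
theorem exists_source_conn (ht : ∀ a, t a ≤ 2 * a + 1) {r : ℕ} (hr : r ≤ n) {j : ℤ} (h1 : 1 ≤ j)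
    (h2 : j ≤ r) : ∃ m < r, canon t r j = rowSign t m * (m + 1) ∧
      Conn n (shape n t) (source n (m + 1)) (V (n - r) (n + j)) := by
  have hw := canon_mem ht r
  have hne : canon t r j ≠ 0 := W_ne_zero hw (by omega)
  have hle : |canon t r j| ≤ r := W_abs_le hw (by rw [abs_of_pos] <;> omega)
  obtain ⟨m, hm⟩ : ∃ m : ℕ, |canon t r j| = m + 1 := by
    have := abs_pos.2 hne
    exact ⟨(|canon t r j| - 1).toNat, by omega⟩
  obtain ⟨i, h3, h4, h5, h6⟩ := exists_conn ht (m := m) (r := r) (by omega) hr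
  have h7 : canon t r i = rowSign t m * (m + 1) := by
    have h8 : canon t r (rowSign t m * i) = m + 1 := by
      rw [← h5]
      exact Equiv.apply_symm_apply _ _
    rw [W_rowSign hw] at h8
    rw [rowSign] at h8 ⊢
    split_ifs at h8 ⊢ <;> linarith
  have h9 : i = j := by
    rw [abs_eq (by omega), or_comm] at hm
    have h8 : canon t r j = canon t r i ∨ canon t r j = canon t r (-i) := by
      rw [W_neg hw, h7, rowSign]
      split_ifs <;> omega
    rcases h8 with h8 | h8
    · exact ((canon t r).injective h8).symm
    · have := (canon t r).injective h8
      omega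
  subst h9
  exact ⟨m, by omega, h7, h6⟩

/-- The row strand of any crossing belongs to the pipe starting in that row, so a pipe can cross
itself only there. In that row all vertical strands come from pipes that started lower, except the
one on which the pipe itself rises after its turn. -/
theorem isSelf_shape_iff (ht : ∀ a, t a ≤ 2 * a + 1) {m : ℕ} (hm : m < n) {j : ℤ}
    (h : Conn n (shape n t) (source n (m + 1)) (sink n j)) {b : ℤ × ℤ} (hb : b ∈ shape n t) :
    IsSelf n (shape n t) j b ↔ b = ((n : ℤ) - m, (n : ℤ) - m + t m) := by
  obtain ⟨p, q⟩ := b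
  have hpq := mem_SY.1 (shape_subset hb)
  obtain ⟨a, rfl⟩ : ∃ a : ℕ, p = (n : ℤ) - a := ⟨((n : ℤ) - p).toNat, by omega⟩
  have han : a < n := by omega
  have hq := (mem_shape_row han).1 hb
  have hrow := conn_row (t := t) han hq.1 (by omega)
  simp only [IsSelf, Prod.mk.injEq]
  have other : ∀ i : ℤ, 1 ≤ i → i ≤ m →
      ¬ Conn n (shape n t) (sink n j) (V (n - m) (n + i)) := by
    intro i hi1 hi2 hcon
    obtain ⟨k, hk, -, hk'⟩ := exists_source_conn ht hm.le hi1 hi2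
    have := Conn.source_unique shape_subset (by omega) (by omega) (hk'.trans (h.trans hcon).symm)
    omega
  have key : a = m → (Conn n (shape n t) (sink n j) (V (n - m) q) ↔ q = n - m + t m) := by
    rintro rfl
    constructor
    · intro hcon
      by_contra hne
      by_cases hqn : q ≤ n
      · rcases lt_or_gt_of_ne hne with hlt | hlt
        · refine other (n - q) (by omega) (by omega) (hcon.trans (Conn.symm ?_))
          convert conn_shift (t := t) hm (j := n - q) (by omega) (by omega) (by omega) using 2
          omega
        · refine other (n + 1 - q) (by omega) (by omega) (hcon.trans (Conn.symm ?_))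
          convert conn_cross (t := t) hm (j := n + 1 - q) (by omega) (by omega) using 2
          omega
      · refine other (q - n) (by omega) (by omega) ?_
        rwa [add_sub_cancel]
    · rintro rfl
      have h' := conn_turn ht hm
      rw [up_of_lt (by omega)] at h'
      refine h.symm.trans ?_
      convert h' using 2
      omega
  constructor
  · rintro ⟨h1, h2⟩
    have := Conn.source_unique shape_subset (by omega) (by omega) (h.trans (h1.trans hrow.symm))
    obtain rfl : a = m := by omega
    exact ⟨rfl, (key rfl).1 h2⟩
  · rintro ⟨h1, h2⟩
    obtain rfl : a = m := by omega
    exact ⟨h.symm.trans hrow, (key rfl).2 h2⟩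

theorem selfCrossings_shape (ht : ∀ a, t a ≤ 2 * a + 1) {m : ℕ} (hm : m < n) {j : ℤ}
    (hj : 1 ≤ j ∧ j ≤ n) (h : Conn n (shape n t) (source n (m + 1)) (sink n j)) :
    selfCrossings n (shape n t) j = if t m ≤ m then 1 else 0 := by
  classical
  rw [selfCrossings_eq shape_subset hj]
  have e : (shape n t).filter (IsSelf n (shape n t) j) =
      (shape n t).filter (· = ((n : ℤ) - m, (n : ℤ) - m + t m)) :=
    Finset.filter_congr fun b hb => isSelf_shape_iff ht hm h hb
  rw [e, Finset.filter_eq', apply_ite Finset.card, Finset.card_singleton, Finset.card_empty]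
  -- The only candidate box is a crossing exactly when the turn takes place in the right half of the
  -- row.
  refine if_congr ?_ rfl rfl
  rw [mem_shape_row hm]
  omega

theorem wD_shape (ht : ∀ a, t a ≤ 2 * a + 1) : (wD n (shape n t) : Equiv.Perm ℤ) = canon t n := by
  have : wD n (shape n t) = ⟨canon t n, canon_mem ht n⟩ := by
    refine W_ext fun j h1 h2 => ?_
    obtain ⟨m, hm, h3, h4⟩ := exists_source_conn ht le_rfl h1 h2
    rw [sub_self] at h4
    rw [wD_apply shape_subset (by omega) ⟨h1, h2⟩ h4, selfCrossings_shape ht hm ⟨h1, h2⟩ h4]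
    change _ = canon t n j
    rw [h3, rowSign]
    split_ifs <;> simp
  rw [this]

end

/-! ### The two inclusions. -/

theorem ladderSet_spec {n : ℕ} {D E : Finset (ℤ × ℤ)} (hD : D ⊆ SY n) (h : E ∈ ladderSet n D) :
    E ⊆ SY n ∧ E.card = D.card ∧ wD n E = wD n D := by
  induction h with
  | refl => exact ⟨hD, rfl, rfl⟩
  | tail _ h ih =>
    obtain ⟨i, j, h⟩ := h
    obtain ⟨h1, h2, h3⟩ := h.flip ih.1
    exact ⟨h1, h2.trans ih.2.1, h3.symm.trans ih.2.2⟩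

end SkewPipe

theorem theoremt (n : ℕ) (w : SkewPipe.W n) :
    SkewPipe.ladderSet n (SkewPipe.Dw n w) =
      {D | D ∈ SkewPipe.SPD n ∧ SkewPipe.IsReduced n D ∧ SkewPipe.wD n D = w} := by
  open SkewPipe in
  have key : ∀ t : ℕ → ℕ, (∀ a, t a ≤ 2 * a + 1) → canon t n = w →
      Dw n w = shape n t ∧ wD n (shape n t) = w ∧ (shape n t).card + len n w = n ^ 2 := by
    intro t ht hw
    refine ⟨?_, ?_, ?_⟩
    · rw [← hw, Dw_canon ht]
    · exact Subtype.ext ((wD_shape ht).trans hw)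
    · rw [← hw, len_canon ht, card_shape ht]
  obtain ⟨t, ht, hw⟩ := SkewPipe.exists_canon n w w.2
  obtain ⟨h1, h2, h3⟩ := key t ht hw
  ext D
  rw [Set.mem_ofPred_eq, SkewPipe.SPD, Finset.mem_powerset, SkewPipe.IsReduced, SkewPipe.len_w0]
  constructor
  · intro h
    rw [h1] at h
    obtain ⟨h4, h5, h6⟩ := SkewPipe.ladderSet_spec SkewPipe.shape_subset h
    rw [h6, h2, h5]
    refine ⟨h4, ?_, rfl⟩
    rw [← h3]
    push_cast
    ring
  · rintro ⟨h4, h5, h6⟩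
    obtain ⟨E, h7, h8, h9, -, h10⟩ := SkewPipe.exists_leftJustified n _ D h4 le_rfl
    -- The parameters `t'` need not be compared with `t`: any parameters with product `w` describe
    -- `D(w)`, so uniqueness of the factorization is not needed.
    obtain ⟨t', ht', rfl⟩ := h8.exists_shape h7
    have hw' : SkewPipe.canon t' n = w := by rw [← SkewPipe.wD_shape ht', h9, h6]
    obtain ⟨h11, -, h12⟩ := key t' ht' hw'
    rw [h11]
    -- Reducedness of `D` says that the descent lost no crossings.
    refine h10 ?_
    rw [h6, ← h12] at h5
    push_cast at h5
    omega
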